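/- **Setting.** Let $\mathcal G=(V,E)$ be a connected planar graph embedded in $\mathbb R^2$, with straight edges that intersect only at common end-points, locally finite (every bounded region contains finitely many vertices, and all degrees are finite), with $0\in V$, and invariant under the translations by two non-collinear vectors, under the rotation by some angle $\theta\in(0,\pi)$ around $0$, and under the orthogonal reflection in the vertical axis $\{(0,y):y\in\mathbb R\}$. Fix $q\ge 1$. For a finite set $E_G\subset E$, let $G$ be the graph with edge set $E_G$ whose vertex set $V_G$ is the set of end-points of $E_G$. A boundary condition $\xi$ on $G$ is a partition of $V_G$ (vertices in the same class are wired), and for $p\in(0,1)$ and $\eta\in\{0,1\}^{E_G}$, $$\phi^{\xi}_{p,q,G}(\eta)=\frac{p^{o(\eta)}(1-p)^{c(\eta)}q^{k(\eta^\xi)}}{Z^\xi(p,q,G)},$$ where $o(\eta)$ and $c(\eta)$ are the numbers of open and closed edges, $k(\eta^\xi)$ is the number of clusters after wired vertices are identified, and $Z^\xi(p,q,G)$ normalizes. The free boundary condition $\xi=0$ has no wiring. An infinite-volume random-cluster measure with edge-weight $p$ (and cluster-weight $q$) is a probability measure $\phi_p$ on $\{0,1\}^{E}$ such that, for every such finite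 $G$ and every $\xi$, conditionally on the event that $\xi$ is the partition of $V_G$ according to connection by open paths using no edge of $E_G$, the configuration on $E_G$ has law $\phi^\xi_{p,q,G}$ (whenever this event has positive probability). Let $\phi^0_p$ be the limit of $\phi^0_{p,q,G}$ as $G$ increases to $\mathcal G$, write $\{0\leftrightarrow\infty\}$ for the event that the open cluster of $0$ is infinite, and let $$p_c=\inf\{p\in(0,1):\phi^0_p(0\leftrightarrow\infty)>0\}\qquad(\inf\emptyset=1).$$ The dual lattice $\mathcal G^*$ has one vertex placed in each face of $\mathcal G$, and each $e\in E$ has a dual edge $e^*$ joining the faces on the two sides of $e$; $e^*$ is dual-open if $e$ is closed. Write $u\overset{*}{\longleftrightarrow}v$ if the dual vertices $u,v$ are joined by a path of dual-open edges. **Proposition.** Let $p\in(0,1)$ and let $\phi_p$ be any infinite-volume random-cluster measure on $\mathcal G$ with edge-weight $p$ and cluster-weight $q$. Suppose that there exists $c>0$ such that, for all vertices $u,v$ of $\mathcal G^*$, $$\phi_p(u\overset{*}{\longleftrightarrow}v)\le \exp(-c|u-v|).$$ Then $\phi_p(0\leftrightarrow\infty)>0$ and $p\ge p_c$. -/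

import Mathlib

open MeasureTheory Set Filter Topology

/-- The map `f` of the plane `ℝ² = ℂ` restricts to an automorphism of the graph `G`, whose vertices
are points of the plane. (Edges are drawn as straight segments, so for an affine map `f` this says
that `f` is an automorphism of the embedded graph.) -/
def IsEmbeddedAut {V : Set ℂ} (G : SimpleGraph V) (f : ℂ → ℂ) : Prop :=
  ∃ φ : G ≃g G, ∀ x : V, ((φ x : V) : ℂ) = f x

/-- The closed straight segment along which an edge is drawn. -/
def edgeSegment {V : Set ℂ} : Sym2 V → Set ℂ :=
  Sym2.lift ⟨fun x y => segment ℝ (x : ℂ) (y : ℂ), fun x y => segment_symm ℝ (x : ℂ) (y : ℂ)⟩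

/-- A connected, locally finite, doubly periodic planar graph, embedded in the plane `ℝ² = ℂ` with
straight edges, one of whose vertices is the origin, and which is invariant under a rotation of
angle `θ ∈ (0, π)` around the origin and under the reflection in the vertical axis. -/
structure PlanarLattice where
  /-- the set of vertices -/
  V : Set ℂ
  /-- the adjacency relation -/
  graph : SimpleGraph V
  zero_mem : (0 : ℂ) ∈ V
  connected : graph.Connected
  /-- a bounded region contains finitely many vertices -/
  finite_vertices : ∀ r : ℝ, (V ∩ Metric.closedBall (0 : ℂ) r).Finite
  /-- a vertex has finitely many neighbours -/
  finite_neighbors : ∀ x : V, (graph.neighborSet x).Finite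
  /-- two distinct edges can meet only at a common end-point -/
  planar : ∀ e ∈ graph.edgeSet, ∀ f ∈ graph.edgeSet, e ≠ f →
    ∀ z ∈ edgeSegment e ∩ edgeSegment f, ∃ x : V, (x : ℂ) = z ∧ x ∈ e ∧ x ∈ f
  periodic : ∃ u v : ℂ, LinearIndependent ℝ ![u, v] ∧
    IsEmbeddedAut graph (fun z => z + u) ∧ IsEmbeddedAut graph (fun z => z + v)
  rotation : ∃ θ ∈ Ioo (0 : ℝ) Real.pi,
    IsEmbeddedAut graph (fun z => Complex.exp (θ * Complex.I) * z)
  reflection : IsEmbeddedAut graph (fun z => -(starRingEnd ℂ) z)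

namespace PlanarLattice

variable (L : PlanarLattice)

/-- The origin, as a vertex of the lattice. -/
def origin : L.V := ⟨0, L.zero_mem⟩

/-- The edges of the lattice. -/
abbrev Edge : Type := L.graph.edgeSet

/-- Configurations on the whole lattice: the edge `e` is open if `ω e = true`, and closed
otherwise. The space carries the product σ-algebra. -/
abbrev Config : Type := L.Edge → Bool

/-- The graph on the vertices of the lattice whose edges are those in `S`. -/
def subgraphOf (S : Set L.Edge) : SimpleGraph L.V :=
  SimpleGraph.fromEdgeSet ((fun e : L.Edge => (e : Sym2 L.V)) '' S)

/-! ### Finite-volume random-cluster measures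

A finite subgraph is given by its finite set of edges `E`; its vertices are the end-points of the
edges in `E`. -/

/-- The vertex set of the finite subgraph with edge set `E`. -/
def verts (E : Finset L.Edge) : Set L.V := {x | ∃ e ∈ E, x ∈ (e : Sym2 L.V)}

/-- A boundary condition on the finite subgraph with edge set `E`, written as a partition (an
equivalence relation) of all its vertices; the vertices that are wired to no other vertex, in
particular those that have no edge outside `E`, form classes of size one. -/
abbrev BoundaryCondition (E : Finset L.Edge) : Type := Setoid (L.verts E)

variable {L}

/-- Two vertices of the finite subgraph are related if an open path of `η` joins them. -/
def openSetoid (E : Finset L.Edge) (η : E → Bool) : Setoid (L.verts E) :=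
  (L.subgraphOf {e | ∃ h : e ∈ E, η ⟨e, h⟩ = true}).reachableSetoid.comap Subtype.val

/-- The number of open edges of `η`. -/
def numOpen (E : Finset L.Edge) (η : E → Bool) : ℕ := (Finset.univ.filter fun e => η e = true).card

/-- The number of closed edges of `η`. -/
def numClosed (E : Finset L.Edge) (η : E → Bool) : ℕ :=
  (Finset.univ.filter fun e => η e = false).card

/-- The number of clusters of `η`, after the vertices in a same class of the boundary condition `ξ`
have been identified. -/
noncomputable def numClusters (E : Finset L.Edge) (ξ : L.BoundaryCondition E) (η : E → Bool) : ℕ :=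
  Nat.card (Quotient (openSetoid E η ⊔ ξ))

/-- The weight `p ^ o(η) * (1 - p) ^ c(η) * q ^ k(η ^ ξ)`. -/
noncomputable def fvWeight (p q : ℝ) (E : Finset L.Edge) (ξ : L.BoundaryCondition E)
    (η : E → Bool) : ℝ :=
  p ^ numOpen E η * (1 - p) ^ numClosed E η * q ^ numClusters E ξ η

/-- The probability of `η` under the random-cluster measure on the finite subgraph with edge set
`E`, with edge-weight `p`, cluster-weight `q` and boundary condition `ξ`. -/
noncomputable def fvProb (p q : ℝ) (E : Finset L.Edge) (ξ : L.BoundaryCondition E)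
    (η : E → Bool) : ℝ :=
  fvWeight p q E ξ η / ∑ η' : E → Bool, fvWeight p q E ξ η'

/-- The probability of an event under the finite-volume random-cluster measure. -/
noncomputable def fvEventProb (p q : ℝ) (E : Finset L.Edge) (ξ : L.BoundaryCondition E)
    (A : Set (E → Bool)) : ℝ :=
  ∑ η : E → Bool, A.indicator (fvProb p q E ξ) η

/-! ### Infinite-volume measures -/

/-- The boundary condition induced by `ω` on the finite subgraph with edge set `E`: two vertices are
wired if they are joined by a path of open edges of `ω` outside `E`. -/
def inducedBC (E : Finset L.Edge) (ω : L.Config) : L.BoundaryCondition E :=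
  (L.subgraphOf {e | e ∉ E ∧ ω e = true}).reachableSetoid.comap Subtype.val

/-- `φ` is an infinite-volume random-cluster measure with edge-weight `p` and cluster-weight `q`:
for every finite subgraph and every boundary condition `ξ`, conditionally on inducing `ξ`, the
restriction of the configuration to the subgraph has the finite-volume law with boundary condition
`ξ`. (The condition is void when `ξ` is induced with probability zero.) -/
structure IsRandomClusterMeasure (p q : ℝ) (φ : Measure L.Config) : Prop where
  isProbabilityMeasure : IsProbabilityMeasure φ
  conditional : ∀ (E : Finset L.Edge) (ξ : L.BoundaryCondition E) (η : E → Bool),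
    φ.real {ω | E.restrict ω = η ∧ inducedBC E ω = ξ} =
      fvProb p q E ξ η * φ.real {ω | inducedBC E ω = ξ}

/-- `φ` is the infinite-volume measure with free boundary conditions: the limit, as the finite
subgraph `E` increases to the whole lattice, of the finite-volume measures on `E` with free boundary
conditions (no wiring, `⊥`). The probability of every event `{ω = ζ on F}`, `F` finite,
converges. -/
structure IsFreeMeasure (p q : ℝ) (φ : Measure L.Config) : Prop where
  isProbabilityMeasure : IsProbabilityMeasure φ
  tendsto : ∀ (F : Finset L.Edge) (ζ : F → Bool),
    Tendsto
      (fun E : Finset L.Edge => fvEventProb p q E ⊥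
        {η | ∀ (e : L.Edge) (hE : e ∈ E) (hF : e ∈ F), η ⟨e, hE⟩ = ζ ⟨e, hF⟩})
      atTop (𝓝 (φ.real {ω | F.restrict ω = ζ}))

/-- The event `x ↔ ∞`: the open cluster of `x` is infinite. -/
def ConnectedToInfinity (ω : L.Config) (x : L.V) : Prop :=
  {y : L.V | (L.subgraphOf {e | ω e = true}).Reachable x y}.Infinite

variable (L) in
/-- The critical point: the infimum, in `[0, 1]`, of the set of those `p ∈ (0, 1)` for which the
origin is in an infinite cluster with positive probability under the infinite-volume measure with
free boundary conditions. (The element `1` makes the infimum of the empty set equal to `1`.) -/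
noncomputable def criticalPoint (q : ℝ) : ℝ :=
  sInf (insert 1 {p : ℝ | p ∈ Ioo (0 : ℝ) 1 ∧ ∃ φ : Measure L.Config,
    IsFreeMeasure p q φ ∧ 0 < φ {ω | ConnectedToInfinity ω L.origin}})

/-! ### Planar duality -/

variable (L) in
/-- The points of the plane that are on the drawing of the lattice. -/
def drawing : Set ℂ := L.V ∪ ⋃ e ∈ L.graph.edgeSet, edgeSegment e

variable (L) in
/-- The faces of the lattice, i.e. the connected components of the complement of the drawing. They
are the vertices of the dual lattice. -/
def Face : Type := {F : Set ℂ // ∃ z ∈ L.drawingᶜ, F = connectedComponentIn L.drawingᶜ z}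

/-- The dual edge `e*` joins the faces `F` and `F'`: the edge `e` lies on the boundary of both.
(Loops of the dual lattice play no role for dual connections, so `F = F'` need not be excluded.) -/
def DualJoins (e : L.Edge) (F F' : L.Face) : Prop :=
  edgeSegment (e : Sym2 L.V) ⊆ frontier F.1 ∧ edgeSegment (e : Sym2 L.V) ⊆ frontier F'.1

/-- The faces `F` and `F'` are dual-connected in `ω`: there is a path from `F` to `F'` in the dual
lattice whose edges `e*` are all dual-open, i.e. the edges `e` are closed in `ω`. -/
def DualConnected (ω : L.Config) : L.Face → L.Face → Prop :=
  Relation.ReflTransGen fun F F' => ∃ e : L.Edge, ω e = false ∧ DualJoins e F F'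

variable (L) in
/-- A choice of the position in the plane of each vertex of the dual lattice: the vertex is placed
in the corresponding face. -/
structure DualPlacement where
  pos : L.Face → ℂ
  pos_mem : ∀ F : L.Face, pos F ∈ F.1

end PlanarLattice

/-! The two conclusions rest on one estimate, uniform over the translates of the origin by periods.
Uniformity matters because `φ` need not be invariant under translations.

Percolation. Fix a doubly infinite periodic lattice path through a translate `o` of the origin and
open a long central stretch of it. If the cluster of `o` is then still finite, all edges leaving it
are closed. A dual path in these closed edges joins the two halves of the lattice path beyond the
stretch (`exists_dualConnected_of_finite`), so two remote faces were dual-connected before the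
opening. Exponential decay and a union bound give this event probability at most 1/2 when the
stretch is long (`exists_measure_finite_cluster_le`). Opening a fixed number of edges multiplies
probabilities by at most a constant (`preimage_openAll_le`), so `o` is in an infinite cluster with
probability at least some `δ > 0` independent of the translate.

The topological input avoids contours. A function that is 1 on the cluster, 0 on the rest of the
graph and far away is an integer where the faces reached by dual paths meet the other faces. It can
then be modified by integers, because the plane is simply connected
(`exists_continuous_integer_gluing`). Following the modified function along the two halves of the
path gives incompatible values at `o`. Faces have bounded diameter because a periodic lattice path
blocks any long face (`exists_face_coordinate_le`); hence edge distances control distances of dual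
vertices.

Critical point. As `p_c` is defined by free measures, `φ` is compared with the free measure at an
arbitrary `p' > p`. The logarithms of the wired and free partition functions of a box differ by at
most a multiple of the boundary size, and their derivatives in the edge-weight are densities of open
edges. By the mean value theorem the wired and free densities nearly agree at some `s` between `p`
and `p'`. By monotone coupling a small difference of densities controls the difference of increasing
local events, so on average over translates the free measure at `p'` gives them at least the lower
bound valid under `φ` (`le_real_of_isFreeMeasure`). Local events approximating an infinite cluster
then give `p_c ≤ p'`. All monotonicity comes from Holley's inequality, whose hypothesis reduces to
supermodularity of the number of clusters (`card_quotient_add_card_quotient_le`). -/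

/-! ### Counting the classes of a setoid by linear algebra -/

namespace Setoid

variable {W : Type*}

/-- The space of real functions that are constant on the classes of a setoid. -/
def invariantFunctions (s : Setoid W) : Submodule ℝ (W → ℝ) where
  carrier := {f | s ≤ Setoid.ker f}
  add_mem' {f g} hf hg x y h := by
    have h1 : f x = f y := hf h
    have h2 : g x = g y := hg h
    change f x + g x = f y + g y
    rw [h1, h2]
  zero_mem' _ _ _ := rfl
  smul_mem' c f hf x y h := by
    have h1 : f x = f y := hf h
    change c * f x = c * f y
    rw [h1]

theorem mem_invariantFunctions {s : Setoid W} {f : W → ℝ} :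
    f ∈ s.invariantFunctions ↔ s ≤ Setoid.ker f := Iff.rfl

theorem invariantFunctions_sup (s t : Setoid W) :
    (s ⊔ t).invariantFunctions = s.invariantFunctions ⊓ t.invariantFunctions := by
  ext f
  simp only [Submodule.mem_inf, mem_invariantFunctions, sup_le_iff]

theorem invariantFunctions_anti {s t : Setoid W} (h : s ≤ t) :
    t.invariantFunctions ≤ s.invariantFunctions := fun _ hf => h.trans hf

/-- Functions constant on the classes are the functions on the quotient. -/
noncomputable def invariantFunctionsEquiv (s : Setoid W) :
    (Quotient s → ℝ) ≃ₗ[ℝ] s.invariantFunctions where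
  toFun g := ⟨fun x => g (Quotient.mk s x), fun _ _ h => congrArg g (Quotient.sound h)⟩
  invFun f := Quotient.lift f.1 fun _ _ h => f.2 h
  map_add' _ _ := rfl
  map_smul' _ _ := rfl
  left_inv g := by
    funext x
    induction x using Quotient.inductionOn
    rfl
  right_inv f := rfl

theorem finrank_invariantFunctions [Finite W] (s : Setoid W) :
    Module.finrank ℝ s.invariantFunctions = Nat.card (Quotient s) := by
  classical
  have := Fintype.ofFinite (Quotient s)
  rw [← s.invariantFunctionsEquiv.finrank_eq, Module.finrank_fintype_fun_eq_card,
    Nat.card_eq_fintype_card]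

/-- The number of classes is a supermodular function of the setoid. -/
theorem card_quotient_add_card_quotient_le [Finite W] {s t : Setoid W} (h : s ≤ t) (u : Setoid W) :
    Nat.card (Quotient t) + Nat.card (Quotient (s ⊔ u)) ≤
      Nat.card (Quotient s) + Nat.card (Quotient (t ⊔ u)) := by
  classical
  have := Fintype.ofFinite W
  simp only [← finrank_invariantFunctions]
  rw [invariantFunctions_sup s, invariantFunctions_sup t]
  -- Joins of setoids become intersections of the spaces `S`, `T`, `U` of invariant functions. The
  -- claim is the dimension formula for `T` and `S ∩ U`, whose sum lies in `S` because `T ⊆ S`.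
  have h1 := Submodule.finrank_sup_add_finrank_inf_eq t.invariantFunctions
    (s.invariantFunctions ⊓ u.invariantFunctions)
  have h2 : t.invariantFunctions ⊓ (s.invariantFunctions ⊓ u.invariantFunctions) =
      t.invariantFunctions ⊓ u.invariantFunctions := by
    rw [← inf_assoc, inf_eq_left.2 (invariantFunctions_anti h)]
  have h3 : Module.finrank ℝ ↥(t.invariantFunctions ⊔
      (s.invariantFunctions ⊓ u.invariantFunctions)) ≤ Module.finrank ℝ s.invariantFunctions :=
    Submodule.finrank_mono (sup_le (invariantFunctions_anti h) inf_le_left)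
  rw [h2] at h1
  omega

theorem card_quotient_anti [Finite W] {s t : Setoid W} (h : s ≤ t) :
    Nat.card (Quotient t) ≤ Nat.card (Quotient s) := by
  classical
  have := Fintype.ofFinite W
  simp only [← finrank_invariantFunctions]
  exact Submodule.finrank_mono (invariantFunctions_anti h)

/-- Wiring vertices of `D` together lowers the number of classes by at most the size of `D`. -/
theorem card_quotient_le_add_ncard [Finite W] (s w : Setoid W) (D : Set W)
    (hw : ∀ x y, w x y → x = y ∨ (x ∈ D ∧ y ∈ D)) :
    Nat.card (Quotient s) ≤ Nat.card (Quotient (s ⊔ w)) + D.ncard := by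
  -- By supermodularity the loss is largest for the discrete setoid, where the points outside `D`
  -- stay in distinct classes.
  have h1 := card_quotient_add_card_quotient_le (bot_le : (⊥ : Setoid W) ≤ s) w
  rw [bot_sup_eq] at h1
  have h2 : Nat.card (Quotient (⊥ : Setoid W)) ≤ Nat.card W :=
    Nat.card_le_card_of_surjective _ (Quotient.mk_surjective)
  have h3 : Dᶜ.ncard ≤ Nat.card (Quotient w) := by
    rw [← Nat.card_coe_set_eq]
    refine Nat.card_le_card_of_injective (fun x : ↥(Dᶜ) => Quotient.mk w x.1) ?_
    intro x y hxy
    rcases hw _ _ (Quotient.exact hxy) with h | h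
    · exact Subtype.ext h
    · exact absurd h.1 x.2
  have h4 := Set.ncard_add_ncard_compl D
  omega

/-- The number of classes of a setoid, all of whose non-trivial relations are in the range of an
injection. -/
theorem card_quotient_comap_add {W' : Type*} [Finite W'] {f : W → W'}
    (hf : Function.Injective f) (s : Setoid W') (hs : ∀ x y, s x y → x ∉ range f → x = y) :
    Nat.card (Quotient s) = Nat.card (Quotient (s.comap f)) + (range f)ᶜ.ncard := by
  have : Finite W := Finite.of_injective f hf
  rw [← Nat.card_coe_set_eq, ← Nat.card_sum]
  symm
  refine Nat.card_congr (Equiv.ofBijective (Sum.elim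
    (Quotient.lift (fun x => Quotient.mk s (f x)) fun a b h => Quotient.sound h)
    (fun x : ↥((range f)ᶜ) => Quotient.mk s x.1)) ⟨?_, ?_⟩)
  · rintro (a | a) (b | b) h
    · induction a using Quotient.inductionOn
      induction b using Quotient.inductionOn
      exact congrArg Sum.inl (Quotient.sound (Quotient.exact (s := s) h))
    · induction a using Quotient.inductionOn with | _ a => ?_
      have h1 : s (f a) b.1 := Quotient.exact h
      have h2 := hs _ _ (s.symm h1) b.2
      exact absurd ⟨a, h2.symm⟩ b.2
    · induction b using Quotient.inductionOn with | _ b => ?_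
      have h1 : s a.1 (f b) := Quotient.exact h
      have h2 := hs _ _ h1 a.2
      exact absurd ⟨b, h2.symm⟩ a.2
    · have h1 : s a.1 b.1 := Quotient.exact h
      exact congrArg Sum.inr (Subtype.ext (hs _ _ h1 a.2))
  · intro x
    induction x using Quotient.inductionOn with | _ x => ?_
    by_cases hx : x ∈ range f
    · obtain ⟨a, rfl⟩ := hx
      exact ⟨Sum.inl (Quotient.mk _ a), rfl⟩
    · exact ⟨Sum.inr ⟨x, hx⟩, rfl⟩

end Setoid

/-! ### Open connections as setoids and the number of clusters -/

namespace PlanarLattice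

variable {L : PlanarLattice}

theorem finite_verts (E : Finset L.Edge) : (L.verts E).Finite := by
  classical
  have : L.verts E = ⋃ e ∈ E, {x | x ∈ (e : Sym2 L.V)} := by
    ext x; simp [verts]
  rw [this]
  refine Set.Finite.biUnion E.finite_toSet fun e _ => ?_
  exact Set.Finite.subset (e : Sym2 L.V).toFinset.finite_toSet fun x hx => by simpa using hx

instance (E : Finset L.Edge) : Finite (L.verts E) := (finite_verts E).to_subtype

theorem subgraphOf_adj {S : Set L.Edge} {x y : L.V} :
    (L.subgraphOf S).Adj x y ↔ ∃ e ∈ S, (e : Sym2 L.V) = s(x, y) := by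
  simp only [subgraphOf, SimpleGraph.fromEdgeSet_adj, mem_image]
  refine ⟨fun h => h.1, fun h => ⟨h, ?_⟩⟩
  obtain ⟨e, -, he⟩ := h
  have := e.2
  rw [he] at this
  exact (L.graph.mem_edgeSet.1 this).ne

theorem subgraphOf_mono {S T : Set L.Edge} (h : S ⊆ T) : L.subgraphOf S ≤ L.subgraphOf T :=
  SimpleGraph.fromEdgeSet_mono (image_mono h)

/-- The setoid of open connections is generated by the open edges. -/
theorem openSetoid_le_iff {E : Finset L.Edge} {η : E → Bool} {r : Setoid (L.verts E)} :
    openSetoid E η ≤ r ↔ ∀ e (he : e ∈ E), η ⟨e, he⟩ = true →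
      ∀ x y : L.verts E, (e : Sym2 L.V) = s(x.1, y.1) → r x y := by
  constructor
  · intro h e he ho x y hxy
    exact h (SimpleGraph.Adj.reachable (subgraphOf_adj.2 ⟨e, ⟨he, ho⟩, hxy⟩))
  · intro h x y hxy
    obtain ⟨w⟩ : (L.subgraphOf {e | ∃ h : e ∈ E, η ⟨e, h⟩ = true}).Reachable x.1 y.1 := hxy
    have key : ∀ (a b : L.V) (w : (L.subgraphOf {e | ∃ h : e ∈ E, η ⟨e, h⟩ = true}).Walk a b)
        (ha : a ∈ L.verts E) (hb : b ∈ L.verts E), r ⟨a, ha⟩ ⟨b, hb⟩ := by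
      intro a b w
      induction w with
      | nil => intro _ _; exact r.refl _
      | cons hadj _ ih =>
        intro ha hb
        obtain ⟨e, ⟨he, ho⟩, hxy⟩ := subgraphOf_adj.1 hadj
        have hc : _ ∈ L.verts E := ⟨e, he, hxy ▸ Sym2.mem_mk_right _ _⟩
        exact r.trans (h e he ho ⟨_, ha⟩ ⟨_, hc⟩ hxy) (ih hc hb)
    exact key _ _ w x.2 y.2

theorem openSetoid_mono {E : Finset L.Edge} {a b : E → Bool} (h : a ≤ b) :
    openSetoid E a ≤ openSetoid E b :=
  openSetoid_le_iff.2 fun e he ho x y hxy =>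
    openSetoid_le_iff.1 le_rfl e he (Bool.eq_true_of_true_le (by rw [← ho]; exact h ⟨e, he⟩))
      x y hxy

theorem openSetoid_sup {E : Finset L.Edge} (a b : E → Bool) :
    openSetoid E (a ⊔ b) = openSetoid E a ⊔ openSetoid E b := by
  refine le_antisymm (openSetoid_le_iff.2 fun e he ho x y hxy => ?_)
    (sup_le (openSetoid_mono le_sup_left) (openSetoid_mono le_sup_right))
  have ho' : a ⟨e, he⟩ = true ∨ b ⟨e, he⟩ = true := by simpa using ho
  rcases ho' with ho | ho
  · exact (le_sup_left : openSetoid E a ≤ _) (openSetoid_le_iff.1 le_rfl e he ho x y hxy)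
  · exact (le_sup_right : openSetoid E b ≤ _) (openSetoid_le_iff.1 le_rfl e he ho x y hxy)

/-- Joining the connections of `a` to the finer setoid (`a ⊓ b` with `ξ`) destroys at least as many
classes as joining them to the coarser one (`b` with `ξ'`). Allowing two boundary conditions lets
one inequality cover every later comparison. -/
theorem numClusters_add_le {E : Finset L.Edge} {ξ ξ' : L.BoundaryCondition E} (hξ : ξ ≤ ξ')
    (a b : E → Bool) : numClusters E ξ a + numClusters E ξ' b ≤
      numClusters E ξ (a ⊓ b) + numClusters E ξ' (a ⊔ b) := by
  have h := Setoid.card_quotient_add_card_quotient_le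
    (s := openSetoid E (a ⊓ b) ⊔ ξ) (t := openSetoid E b ⊔ ξ')
    (sup_le_sup (openSetoid_mono inf_le_right) hξ) (openSetoid E a)
  have h1 : openSetoid E (a ⊓ b) ⊔ ξ ⊔ openSetoid E a = openSetoid E a ⊔ ξ := by
    rw [sup_right_comm, sup_eq_right.2 (openSetoid_mono (inf_le_left : a ⊓ b ≤ a))]
  have h2 : openSetoid E b ⊔ ξ' ⊔ openSetoid E a = openSetoid E (a ⊔ b) ⊔ ξ' := by
    rw [sup_right_comm, openSetoid_sup, sup_comm (openSetoid E a)]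
  rw [h1, h2] at h
  unfold numClusters
  omega

/-! ### The weights -/

theorem numOpen_add_numClosed {E : Finset L.Edge} (η : E → Bool) :
    numOpen E η + numClosed E η = E.card := by
  classical
  have := Finset.card_filter_add_card_filter_not (s := (Finset.univ : Finset E))
    (fun e => η e = true)
  simpa [numOpen, numClosed] using this

theorem pow_numOpen_mul_pow_numClosed (p : ℝ) (E : Finset L.Edge) (η : E → Bool) :
    p ^ numOpen E η * (1 - p) ^ numClosed E η = ∏ e, if η e = true then p else 1 - p := by
  classical
  rw [Finset.prod_ite, Finset.prod_const, Finset.prod_const]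
  simp [numOpen, numClosed]

theorem fvWeight_pos {p q : ℝ} (hp : p ∈ Ioo (0 : ℝ) 1) (hq : 1 ≤ q) (E : Finset L.Edge)
    (ξ : L.BoundaryCondition E) (η : E → Bool) : 0 < fvWeight p q E ξ η := by
  have h1 : 0 < 1 - p := sub_pos.2 hp.2
  have h2 : 0 < p := hp.1
  unfold fvWeight
  positivity

/-- The normalizing constant. -/
noncomputable def partitionFunction (p q : ℝ) (E : Finset L.Edge) (ξ : L.BoundaryCondition E) : ℝ :=
  ∑ η : E → Bool, fvWeight p q E ξ η

theorem partitionFunction_pos {p q : ℝ} (hp : p ∈ Ioo (0 : ℝ) 1) (hq : 1 ≤ q) (E : Finset L.Edge)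
    (ξ : L.BoundaryCondition E) : 0 < partitionFunction p q E ξ :=
  Finset.sum_pos (fun η _ => fvWeight_pos hp hq E ξ η) Finset.univ_nonempty

theorem fvProb_eq (p q : ℝ) (E : Finset L.Edge) (ξ : L.BoundaryCondition E) (η : E → Bool) :
    fvProb p q E ξ η = fvWeight p q E ξ η / partitionFunction p q E ξ := rfl

theorem fvProb_nonneg {p q : ℝ} (hp : p ∈ Ioo (0 : ℝ) 1) (hq : 1 ≤ q) (E : Finset L.Edge)
    (ξ : L.BoundaryCondition E) (η : E → Bool) : 0 ≤ fvProb p q E ξ η :=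
  (div_pos (fvWeight_pos hp hq E ξ η) (partitionFunction_pos hp hq E ξ)).le

theorem sum_fvProb {p q : ℝ} (hp : p ∈ Ioo (0 : ℝ) 1) (hq : 1 ≤ q) (E : Finset L.Edge)
    (ξ : L.BoundaryCondition E) : ∑ η, fvProb p q E ξ η = 1 := by
  simp only [fvProb_eq]
  rw [← Finset.sum_div]
  exact div_self (partitionFunction_pos hp hq E ξ).ne'

/-- This is the hypothesis of Holley's inequality. The edge factors are compared one edge at a time,
and the cluster factor by supermodularity, where `q ≥ 1` enters. -/
theorem fvWeight_mul_le {p p' q : ℝ} (hp : p ∈ Ioo (0 : ℝ) 1) (hp' : p' ∈ Ioo (0 : ℝ) 1)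
    (hpp : p ≤ p') (hq : 1 ≤ q) {E : Finset L.Edge} {ξ ξ' : L.BoundaryCondition E} (hξ : ξ ≤ ξ')
    (a b : E → Bool) : fvWeight p q E ξ a * fvWeight p' q E ξ' b ≤
      fvWeight p q E ξ (a ⊓ b) * fvWeight p' q E ξ' (a ⊔ b) := by
  unfold fvWeight
  simp only [pow_numOpen_mul_pow_numClosed]
  have h0 : 0 < p := hp.1
  have h0' : 0 < p' := hp'.1
  have h1 : 0 < 1 - p := sub_pos.2 hp.2
  have h1' : 0 < 1 - p' := sub_pos.2 hp'.2
  have hnn : ∀ (r : ℝ), 0 < r → 0 < 1 - r → ∀ (c : Bool), 0 ≤ (if c = true then r else 1 - r) := by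
    intro r hr hr' c
    split_ifs <;> linarith
  have hprod : (∏ e, if a e = true then p else 1 - p) * (∏ e, if b e = true then p' else 1 - p') ≤
      (∏ e, if (a ⊓ b) e = true then p else 1 - p) *
        (∏ e, if (a ⊔ b) e = true then p' else 1 - p') := by
    rw [← Finset.prod_mul_distrib, ← Finset.prod_mul_distrib]
    refine Finset.prod_le_prod (fun e _ => mul_nonneg (hnn _ h0 h1 _) (hnn _ h0' h1' _))
      fun e _ => ?_
    rcases ha : a e <;> rcases hb : b e <;> simp [ha, hb]
    -- The case left is an edge open in `a` and closed in `b`: `p (1 - p') ≤ (1 - p) p'`, which is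
    -- `p ≤ p'`.
    nlinarith
  have hpow : q ^ numClusters E ξ a * q ^ numClusters E ξ' b ≤
      q ^ numClusters E ξ (a ⊓ b) * q ^ numClusters E ξ' (a ⊔ b) := by
    rw [← pow_add, ← pow_add]
    exact pow_le_pow_right₀ hq (numClusters_add_le hξ a b)
  calc _ = ((∏ e, if a e = true then p else 1 - p) * (∏ e, if b e = true then p' else 1 - p')) *
        (q ^ numClusters E ξ a * q ^ numClusters E ξ' b) := by ring
    _ ≤ ((∏ e, if (a ⊓ b) e = true then p else 1 - p) *
        (∏ e, if (a ⊔ b) e = true then p' else 1 - p')) *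
        (q ^ numClusters E ξ (a ⊓ b) * q ^ numClusters E ξ' (a ⊔ b)) := by
      refine mul_le_mul hprod hpow (by positivity) ?_
      exact mul_nonneg (Finset.prod_nonneg fun e _ => hnn _ h0 h1 _)
        (Finset.prod_nonneg fun e _ => hnn _ h0' h1' _)
    _ = _ := by ring

/-- Wiring vertices in a set `D` changes the weights by at most a factor `q ^ |D|`. -/
theorem fvWeight_bot_le {p q : ℝ} (hp : p ∈ Ioo (0 : ℝ) 1) (hq : 1 ≤ q) {E : Finset L.Edge}
    {ξ : L.BoundaryCondition E} {D : Set (L.verts E)}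
    (hD : ∀ x y, ξ x y → x = y ∨ (x ∈ D ∧ y ∈ D)) (η : E → Bool) :
    fvWeight p q E ⊥ η ≤ q ^ D.ncard * fvWeight p q E ξ η := by
  have h1 : 0 < 1 - p := sub_pos.2 hp.2
  have h2 : 0 < p := hp.1
  unfold fvWeight
  have h : numClusters E ⊥ η ≤ D.ncard + numClusters E ξ η := by
    unfold numClusters
    rw [sup_bot_eq, add_comm]
    exact Setoid.card_quotient_le_add_ncard _ _ D hD
  calc _ ≤ p ^ numOpen E η * (1 - p) ^ numClosed E η * q ^ (D.ncard + numClusters E ξ η) :=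
        mul_le_mul_of_nonneg_left (pow_le_pow_right₀ hq h) (by positivity)
    _ = _ := by rw [pow_add]; ring

theorem fvWeight_anti {p q : ℝ} (hp : p ∈ Ioo (0 : ℝ) 1) (hq : 1 ≤ q) {E : Finset L.Edge}
    {ξ ξ' : L.BoundaryCondition E} (hξ : ξ ≤ ξ') (η : E → Bool) :
    fvWeight p q E ξ' η ≤ fvWeight p q E ξ η := by
  have h1 : 0 < 1 - p := sub_pos.2 hp.2
  have h2 : 0 < p := hp.1
  exact mul_le_mul_of_nonneg_left (pow_le_pow_right₀ hq
    (Setoid.card_quotient_anti (sup_le_sup le_rfl hξ))) (by positivity)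

theorem ncard_mem_sym2_le {α : Type*} (e : Sym2 α) : {x | x ∈ e}.ncard ≤ 2 := by
  classical
  induction e using Sym2.ind with | _ a b => ?_
  have : {x | x ∈ s(a, b)} = {a, b} := by ext x; simp
  rw [this]
  exact (Set.ncard_insert_le _ _).trans (by simp)

theorem ncard_verts_le (E : Finset L.Edge) : (L.verts E).ncard ≤ 2 * E.card := by
  classical
  induction E using Finset.induction_on with
  | empty => simp [verts]
  | insert e E he ih =>
    have : L.verts (insert e E) ⊆ {x | x ∈ (e : Sym2 L.V)} ∪ L.verts E := by
      rintro x ⟨f, hf, hx⟩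
      rcases Finset.mem_insert.1 hf with rfl | hf
      · exact Or.inl hx
      · exact Or.inr ⟨f, hf, hx⟩
    have hfin : ({x | x ∈ (e : Sym2 L.V)} ∪ L.verts E).Finite :=
      Set.Finite.union (Set.Finite.subset (e : Sym2 L.V).toFinset.finite_toSet
        fun x hx => by simpa using hx) (finite_verts E)
    rw [Finset.card_insert_of_notMem he]
    have h1 := Set.ncard_le_ncard this hfin
    have h2 := Set.ncard_union_le {x | x ∈ (e : Sym2 L.V)} (L.verts E)
    have h3 := ncard_mem_sym2_le (e : Sym2 L.V)
    omega

open Classical in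
/-- The configuration on `E` in which precisely the edges in `F` are open. -/
noncomputable def openOn (E F : Finset L.Edge) : E → Bool := fun e => decide (e.1 ∈ F)

/-- Opening `F` directly wires only end-points of edges of `F`, of which there are at most two per
edge. -/
theorem numClusters_le_sup_openOn (E F : Finset L.Edge) (ξ : L.BoundaryCondition E) (η : E → Bool) :
    numClusters E ξ η ≤ numClusters E ξ (η ⊔ openOn E F) + 2 * F.card := by
  have key := Setoid.card_quotient_le_add_ncard (openSetoid E η ⊔ ξ) (openSetoid E (openOn E F))
    {x | x.1 ∈ L.verts F} ?_
  · have h1 : openSetoid E η ⊔ ξ ⊔ openSetoid E (openOn E F) =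
        openSetoid E (η ⊔ openOn E F) ⊔ ξ := by rw [sup_right_comm, openSetoid_sup]
    rw [h1] at key
    refine key.trans (Nat.add_le_add_left ?_ _)
    refine le_trans ?_ (ncard_verts_le F)
    exact Set.ncard_le_ncard_of_injOn (fun x => x.1) (fun x hx => hx)
      (Subtype.val_injective.injOn) (finite_verts F)
  · let r : Setoid (L.verts E) :=
      { r := fun x y => x = y ∨ (x.1 ∈ L.verts F ∧ y.1 ∈ L.verts F)
        iseqv := ⟨fun x => Or.inl rfl, fun h => h.imp Eq.symm And.symm, by
          rintro x y z (rfl | h) (rfl | h')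
          · exact Or.inl rfl
          · exact Or.inr h'
          · exact Or.inr h
          · exact Or.inr ⟨h.1, h'.2⟩⟩ }
    have : openSetoid E (openOn E F) ≤ r := openSetoid_le_iff.2 fun e he ho x y hxy => by
      have he' : e ∈ F := by simpa [openOn] using ho
      exact Or.inr ⟨⟨e, he', hxy ▸ Sym2.mem_mk_left _ _⟩, ⟨e, he', hxy ▸ Sym2.mem_mk_right _ _⟩⟩
    exact fun x y h => this h

/-- Finite energy at the level of weights: an opened edge replaces a factor `1 - p ≤ 1` by `p`, and
at most `2 |F|` clusters disappear. -/
theorem fvWeight_le_sup_openOn {p q : ℝ} (hp : p ∈ Ioo (0 : ℝ) 1) (hq : 1 ≤ q)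
    (E F : Finset L.Edge) (ξ : L.BoundaryCondition E) (η : E → Bool) :
    p ^ F.card * fvWeight p q E ξ η ≤
      q ^ (2 * F.card) * fvWeight p q E ξ (η ⊔ openOn E F) := by
  classical
  have h1 : 0 < 1 - p := sub_pos.2 hp.2
  have h2 : 0 < p := hp.1
  unfold fvWeight
  simp only [pow_numOpen_mul_pow_numClosed]
  have hF : p ^ F.card ≤ ∏ e : E, if e.1 ∈ F then p else 1 := by
    rw [Finset.prod_ite, Finset.prod_const, Finset.prod_const_one, mul_one]
    refine pow_le_pow_of_le_one h2.le hp.2.le ?_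
    exact Finset.card_le_card_of_injOn (fun e => e.1) (fun e he => by simpa using he)
      Subtype.val_injective.injOn
  have hprod : p ^ F.card * (∏ e, if η e = true then p else 1 - p) ≤
      ∏ e, if (η ⊔ openOn E F) e = true then p else 1 - p := by
    refine (mul_le_mul_of_nonneg_right hF
      (Finset.prod_nonneg fun e _ => by split_ifs <;> linarith)).trans ?_
    rw [← Finset.prod_mul_distrib]
    refine Finset.prod_le_prod (fun e _ => mul_nonneg (by split_ifs <;> linarith)
      (by split_ifs <;> linarith)) fun e _ => ?_
    by_cases he : e.1 ∈ F <;> rcases hη : η e <;> simp [openOn, he, hη] <;> nlinarith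
  have hpow : q ^ numClusters E ξ η ≤
      q ^ (2 * F.card) * q ^ numClusters E ξ (η ⊔ openOn E F) := by
    rw [← pow_add, add_comm]
    exact pow_le_pow_right₀ hq (numClusters_le_sup_openOn E F ξ η)
  calc _ = (p ^ F.card * (∏ e, if η e = true then p else 1 - p)) * q ^ numClusters E ξ η := by ring
    _ ≤ (∏ e, if (η ⊔ openOn E F) e = true then p else 1 - p) *
        (q ^ (2 * F.card) * q ^ numClusters E ξ (η ⊔ openOn E F)) :=
      mul_le_mul hprod hpow (by positivity)
        (Finset.prod_nonneg fun e _ => by split_ifs <;> linarith)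
    _ = _ := by ring

/-! ### Means under finite-volume measures -/

open Classical in
/-- The configuration on the whole lattice that agrees with `η` on `E` and is closed outside. -/
noncomputable def extend (E : Finset L.Edge) (η : E → Bool) : L.Config :=
  fun e => if h : e ∈ E then η ⟨e, h⟩ else false

theorem extend_apply_mem {E : Finset L.Edge} (η : E → Bool) {e : L.Edge} (h : e ∈ E) :
    extend E η e = η ⟨e, h⟩ := by simp [extend, h]

theorem extend_apply_notMem {E : Finset L.Edge} (η : E → Bool) {e : L.Edge} (h : e ∉ E) :
    extend E η e = false := by simp [extend, h]

theorem extend_mono (E : Finset L.Edge) : Monotone (extend E) := by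
  intro a b h e
  by_cases he : e ∈ E
  · rw [extend_apply_mem _ he, extend_apply_mem _ he]; exact h _
  · rw [extend_apply_notMem _ he, extend_apply_notMem _ he]

/-- The mean of a function of the configuration, the edges outside `E` being closed. -/
noncomputable def fvMean (p q : ℝ) (E : Finset L.Edge) (ξ : L.BoundaryCondition E)
    (f : L.Config → ℝ) : ℝ := ∑ η : E → Bool, f (extend E η) * fvProb p q E ξ η

/-- Holley's inequality for probability vectors and functions of arbitrary sign. -/
theorem sum_mul_le_sum_mul_of_holley {ι : Type*} [Fintype ι] [DecidableEq ι]
    {f g μ : (ι → Bool) → ℝ}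
    (hf : 0 ≤ f) (hg : 0 ≤ g) (hμ : Monotone μ) (hf1 : ∑ a, f a = 1) (hg1 : ∑ a, g a = 1)
    (h : ∀ a b, f a * g b ≤ f (a ⊓ b) * g (a ⊔ b)) :
    ∑ a, μ a * f a ≤ ∑ a, μ a * g a := by
  classical
  -- Holley's inequality needs a nonnegative function; as both vectors have total mass one,
  -- subtracting `μ ⊥` shifts both sides equally.
  have key := holley (μ := fun a => μ a - μ ⊥) (f := f) (g := g)
    (fun a => sub_nonneg.2 (hμ bot_le)) hf hg (fun a b hab => sub_le_sub_right (hμ hab) _)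
    (hf1.trans hg1.symm) h
  simp only [sub_mul, Finset.sum_sub_distrib, ← Finset.mul_sum, hf1, hg1] at key
  linarith

/-- The stochastic ordering in the edge-weight and in the boundary condition, from Holley's
inequality; the normalizing constants are the same on both sides of its hypothesis. -/
theorem fvMean_mono {p p' q : ℝ} (hp : p ∈ Ioo (0 : ℝ) 1) (hp' : p' ∈ Ioo (0 : ℝ) 1)
    (hpp : p ≤ p') (hq : 1 ≤ q) {E : Finset L.Edge} {ξ ξ' : L.BoundaryCondition E} (hξ : ξ ≤ ξ')
    {f : L.Config → ℝ} (hf : Monotone f) : fvMean p q E ξ f ≤ fvMean p' q E ξ' f := by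
  refine sum_mul_le_sum_mul_of_holley (μ := fun η => f (extend E η))
    (fun η => fvProb_nonneg hp hq E ξ η)
    (fun η => fvProb_nonneg hp' hq E ξ' η) (hf.comp (extend_mono E)) (sum_fvProb hp hq E ξ)
    (sum_fvProb hp' hq E ξ') fun a b => ?_
  simp only [fvProb_eq, div_mul_div_comm]
  exact div_le_div_of_nonneg_right (fvWeight_mul_le hp hp' hpp hq hξ a b)
    (mul_pos (partitionFunction_pos hp hq E ξ) (partitionFunction_pos hp' hq E ξ')).le

/-- The restriction of a configuration on `E'` to a smaller set of edges. -/
def restrictTo {E E' : Finset L.Edge} (h : E ⊆ E') (η : E' → Bool) : E → Bool :=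
  fun e => η ⟨e.1, h e.2⟩

theorem verts_mono {E E' : Finset L.Edge} (h : E ⊆ E') : L.verts E ⊆ L.verts E' :=
  fun _ ⟨e, he, hx⟩ => ⟨e, h he, hx⟩

/-- When all edges outside `E` are closed, the additional vertices are isolated, so they contribute
a number of clusters independent of `η`. -/
theorem numClusters_restrictTo {E E' : Finset L.Edge} (h : E ⊆ E') {η : E' → Bool}
    (hη : ∀ e : E', e.1 ∉ E → η e = false) : numClusters E' ⊥ η =
      numClusters E ⊥ (restrictTo h η) +
        (range (Set.inclusion (verts_mono h)))ᶜ.ncard := by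
  unfold numClusters
  rw [sup_bot_eq, sup_bot_eq]
  have hset : {e | ∃ h : e ∈ E', η ⟨e, h⟩ = true} =
      {e | ∃ h' : e ∈ E, restrictTo h η ⟨e, h'⟩ = true} := by
    ext e
    constructor
    · rintro ⟨he, ho⟩
      by_cases heE : e ∈ E
      · exact ⟨heE, ho⟩
      · rw [hη ⟨e, he⟩ heE] at ho; exact absurd ho (by simp)
    · rintro ⟨he, ho⟩
      exact ⟨h he, ho⟩
  have hcomap : openSetoid E (restrictTo h η) =
      (openSetoid E' η).comap (Set.inclusion (verts_mono h)) := by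
    unfold openSetoid
    rw [hset]
    rfl
  rw [hcomap]
  refine Setoid.card_quotient_comap_add (Set.inclusion_injective _) _ fun x y hxy hx => ?_
  let r : Setoid (L.verts E') :=
    { r := fun x y => x = y ∨ (x.1 ∈ L.verts E ∧ y.1 ∈ L.verts E)
      iseqv := ⟨fun x => Or.inl rfl, fun h => h.imp Eq.symm And.symm, by
        rintro x y z (rfl | h) (rfl | h')
        · exact Or.inl rfl
        · exact Or.inr h'
        · exact Or.inr h
        · exact Or.inr ⟨h.1, h'.2⟩⟩ }
  have hr : openSetoid E' η ≤ r := openSetoid_le_iff.2 fun e he ho x y hxy => by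
    have he' : e ∈ E := by
      by_contra hc
      rw [hη ⟨e, he⟩ hc] at ho
      exact absurd ho (by simp)
    exact Or.inr ⟨⟨e, he', hxy ▸ Sym2.mem_mk_left _ _⟩, ⟨e, he', hxy ▸ Sym2.mem_mk_right _ _⟩⟩
  rcases hr hxy with h' | h'
  · exact h'
  · exact absurd ⟨⟨x.1, h'.1⟩, rfl⟩ hx

theorem prod_restrictTo {E E' : Finset L.Edge} (h : E ⊆ E') {η : E' → Bool}
    (hη : ∀ e : E', e.1 ∉ E → η e = false) (p : ℝ) :
    (∏ e, if η e = true then p else 1 - p) =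
      (∏ e, if restrictTo h η e = true then p else 1 - p) * (1 - p) ^ (E'.card - E.card) := by
  classical
  have hE : ∀ (F : Finset L.Edge) (g : L.Edge → ℝ), ∏ e : F, g e.1 = ∏ e ∈ F, g e := fun F g =>
    (Finset.prod_coe_sort F g)
  have h1 : (∏ e : E', if η e = true then p else 1 - p) =
      ∏ e ∈ E', if extend E' η e = true then p else 1 - p := by
    rw [← hE]
    exact Finset.prod_congr rfl fun e _ => by rw [extend_apply_mem _ e.2]
  have h2 : (∏ e : E, if restrictTo h η e = true then p else 1 - p) =
      ∏ e ∈ E, if extend E' η e = true then p else 1 - p := by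
    rw [← hE]
    exact Finset.prod_congr rfl fun e _ => by rw [extend_apply_mem _ (h e.2)]; rfl
  rw [h1, h2, ← Finset.prod_sdiff h, mul_comm, ← Finset.card_sdiff_of_subset h]
  congr 1
  rw [← Finset.prod_const]
  refine Finset.prod_congr rfl fun e he => ?_
  rw [Finset.mem_sdiff] at he
  rw [extend_apply_mem _ he.1, hη ⟨e, he.1⟩ he.2]
  simp

/-- In effect, the free measure on `E` is the free measure on `E'` conditioned on the edges outside
`E` being closed. -/
theorem exists_fvWeight_restrictTo {p q : ℝ} (hp : p ∈ Ioo (0 : ℝ) 1) (hq : 1 ≤ q)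
    {E E' : Finset L.Edge} (h : E ⊆ E') : ∃ c : ℝ, 0 < c ∧ ∀ η : E' → Bool,
      (∀ e : E', e.1 ∉ E → η e = false) →
        fvWeight p q E' ⊥ η = c * fvWeight p q E ⊥ (restrictTo h η) := by
  have h1 : 0 < 1 - p := sub_pos.2 hp.2
  refine ⟨(1 - p) ^ (E'.card - E.card) * q ^ (range (Set.inclusion (verts_mono h)))ᶜ.ncard,
    by positivity, fun η hη => ?_⟩
  unfold fvWeight
  rw [pow_numOpen_mul_pow_numClosed, pow_numOpen_mul_pow_numClosed, numClusters_restrictTo h hη,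
    prod_restrictTo h hη, pow_add]
  ring

/-- With free boundary conditions, the finite-volume measures increase with the volume. -/
theorem fvMean_bot_mono {p q : ℝ} (hp : p ∈ Ioo (0 : ℝ) 1) (hq : 1 ≤ q)
    {E E' : Finset L.Edge} (h : E ⊆ E') {f : L.Config → ℝ} (hf : Monotone f) :
    fvMean p q E ⊥ f ≤ fvMean p q E' ⊥ f := by
  classical
  obtain ⟨c, hc, hw⟩ := exists_fvWeight_restrictTo hp hq h
  -- `g` is the law on `E` carried to configurations on `E'` that are closed outside `E`. Both laws
  -- now live on one space and Holley's inequality applies.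
  set g : (E' → Bool) → ℝ := fun η =>
    if ∀ e : E', e.1 ∉ E → η e = false then fvProb p q E ⊥ (restrictTo h η) else 0 with hg
  have hsum : ∀ F : L.Config → ℝ, ∑ η, F (extend E' η) * g η = fvMean p q E ⊥ F := by
    intro F
    have hmul : ∀ η, F (extend E' η) * g η =
        if ∀ e : E', e.1 ∉ E → η e = false then
          F (extend E' η) * fvProb p q E ⊥ (restrictTo h η) else 0 := by
      intro η
      simp only [hg]
      split_ifs <;> simp
    simp only [hmul]
    rw [← Finset.sum_filter]
    unfold fvMean
    refine Finset.sum_bij' (fun η _ => restrictTo h η) (fun η _ => fun e => extend E η e.1)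
      (fun _ _ => Finset.mem_univ _) (fun η _ => ?_) (fun η hη => ?_) (fun η _ => ?_)
      (fun η hη => ?_)
    · simp only [Finset.mem_filter, Finset.mem_univ, true_and]
      exact fun e he => extend_apply_notMem _ he
    · funext e
      by_cases he : e.1 ∈ E
      · rw [extend_apply_mem _ he]; rfl
      · rw [extend_apply_notMem _ he]
        exact ((Finset.mem_filter.1 hη).2 e he).symm
    · funext e
      change extend E η e.1 = _
      rw [extend_apply_mem _ e.2]
    · congr 2
      funext e
      by_cases he : e ∈ E
      · rw [extend_apply_mem _ he, extend_apply_mem _ (h he)]; rfl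
      · rw [extend_apply_notMem _ he]
        by_cases he' : e ∈ E'
        · rw [extend_apply_mem _ he']
          exact (Finset.mem_filter.1 hη).2 ⟨e, he'⟩ he
        · rw [extend_apply_notMem _ he']
  have hg0 : 0 ≤ g := by
    intro η
    simp only [hg, Pi.zero_apply]
    split_ifs
    · exact fvProb_nonneg hp hq E ⊥ _
    · exact le_rfl
  have hg1 : ∑ η, g η = 1 := by
    have := hsum fun _ => 1
    simp only [one_mul, fvMean] at this
    rw [this, sum_fvProb hp hq]
  rw [← hsum f]
  refine sum_mul_le_sum_mul_of_holley (μ := fun η => f (extend E' η)) hg0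
    (fun η => fvProb_nonneg hp hq E' ⊥ η) (hf.comp (extend_mono E')) hg1 (sum_fvProb hp hq E' ⊥)
    fun a b => ?_
  -- If `a` is closed outside `E`, so is `a ⊓ b`, and on such configurations `g` is proportional to
  -- the weight on `E'`. Otherwise `g a = 0`.
  by_cases ha : ∀ e : E', e.1 ∉ E → a e = false
  · have hab : ∀ e : E', e.1 ∉ E → (a ⊓ b) e = false := fun e he => by simp [ha e he]
    have e1 : g a = fvWeight p q E' ⊥ a / (c * partitionFunction p q E ⊥) := by
      simp only [hg, if_pos ha, fvProb_eq, hw a ha]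
      rw [mul_div_mul_left _ _ hc.ne']
    have e2 : g (a ⊓ b) = fvWeight p q E' ⊥ (a ⊓ b) / (c * partitionFunction p q E ⊥) := by
      simp only [hg, if_pos hab, fvProb_eq, hw _ hab]
      rw [mul_div_mul_left _ _ hc.ne']
    rw [e1, e2]
    simp only [fvProb_eq, div_mul_div_comm]
    exact div_le_div_of_nonneg_right (fvWeight_mul_le hp hp le_rfl hq le_rfl a b)
      (mul_pos (mul_pos hc (partitionFunction_pos hp hq E ⊥))
        (partitionFunction_pos hp hq E' ⊥)).le
  · have : g a = 0 := by simp only [hg, if_neg ha]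
    rw [this, zero_mul]
    exact mul_nonneg (hg0 _) (fvProb_nonneg hp hq E' ⊥ _)

end PlanarLattice

instance {W : Type*} [Finite W] : Finite (Setoid W) :=
  Finite.of_injective (fun s : Setoid W => (fun x y => s x y : W → W → Prop)) fun _ _ h =>
    Setoid.ext fun x y => iff_of_eq (congrFun (congrFun h x) y)

namespace PlanarLattice

variable {L : PlanarLattice}

instance : Countable L.V := by
  have h : L.V = ⋃ n : ℕ, L.V ∩ Metric.closedBall (0 : ℂ) n := by
    rw [← inter_iUnion, Metric.iUnion_closedBall_nat, inter_univ]
  have h2 : L.V.Countable := by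
    rw [h]
    exact Set.countable_iUnion fun n => (L.finite_vertices n).countable
  exact h2.to_subtype

instance : Countable (Sym2 L.V) := Quot.mk_surjective.countable

instance : Countable L.Edge := inferInstanceAs (Countable {e // e ∈ L.graph.edgeSet})

instance : TopologicalSpace.MetrizableSpace L.Config :=
  TopologicalSpace.metrizableSpace_of_t3_secondCountable _

/-! ### Local events and connection events -/

/-- The event `A` depends only on the state of the edges in `E`. -/
def IsLocal (E : Finset L.Edge) (A : Set L.Config) : Prop :=
  ∀ ω ω' : L.Config, (∀ e ∈ E, ω e = ω' e) → ω ∈ A → ω' ∈ A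

theorem IsLocal.mono {E E' : Finset L.Edge} (h : E ⊆ E') {A : Set L.Config} (hA : IsLocal E A) :
    IsLocal E' A := fun ω ω' hω => hA ω ω' fun e he => hω e (h he)

theorem IsLocal.isOpen {E : Finset L.Edge} {A : Set L.Config} (hA : IsLocal E A) : IsOpen A := by
  rw [isOpen_iff_mem_nhds]
  intro ω hω
  have h : {ω' : L.Config | ∀ e ∈ E, ω' e = ω e} ∈ 𝓝 ω := by
    have : {ω' : L.Config | ∀ e ∈ E, ω' e = ω e} = (E : Set L.Edge).pi fun e => {ω e} := by
      ext ω'; simp [Set.mem_pi]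
    rw [this]
    exact (isOpen_set_pi E.finite_toSet fun e _ => isOpen_discrete _).mem_nhds
      (fun e _ => rfl)
  exact Filter.mem_of_superset h fun ω' hω' => hA ω ω' (fun e he => (hω' e he).symm) hω

theorem IsLocal.compl {E : Finset L.Edge} {A : Set L.Config} (hA : IsLocal E A) :
    IsLocal E Aᶜ := fun ω ω' h hω hω' => hω (hA ω' ω (fun e he => (h e he).symm) hω')

theorem IsLocal.measurableSet {E : Finset L.Edge} {A : Set L.Config} (hA : IsLocal E A) :
    MeasurableSet A := hA.isOpen.measurableSet

theorem IsLocal.extend_restrict_mem_iff {E : Finset L.Edge} {A : Set L.Config} (hA : IsLocal E A)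
    (ω : L.Config) : extend E (E.restrict ω) ∈ A ↔ ω ∈ A :=
  ⟨hA _ _ fun e he => by rw [extend_apply_mem _ he]; rfl,
    hA _ _ fun e he => by rw [extend_apply_mem _ he]; rfl⟩

/-- A connection uses finitely many edges. -/
theorem exists_finset_of_reachable {S : Set L.Edge} {x y : L.V}
    (h : (L.subgraphOf S).Reachable x y) :
    ∃ F : Finset L.Edge, (F : Set L.Edge) ⊆ S ∧ (L.subgraphOf F).Reachable x y := by
  classical
  obtain ⟨w⟩ := h
  induction w with
  | nil => exact ⟨∅, by simp, SimpleGraph.Reachable.refl _⟩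
  | cons hadj _ ih =>
    obtain ⟨F, hF, hr⟩ := ih
    obtain ⟨e, he, hxy⟩ := subgraphOf_adj.1 hadj
    refine ⟨insert e F, ?_, ?_⟩
    · intro f hf
      rcases Finset.mem_insert.1 (Finset.mem_coe.1 hf) with rfl | hf
      · exact he
      · exact hF hf
    · have h1 : (L.subgraphOf (insert e F : Finset L.Edge)).Adj _ _ :=
        subgraphOf_adj.2 ⟨e, by simp, hxy⟩
      exact h1.reachable.trans (hr.mono (subgraphOf_mono (by simp)))

/-- A connection persists as long as finitely many edges stay open. The set `T` is everything for
clusters, and the complement of a finite set for induced boundary conditions. -/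
theorem isOpen_reachable (T : Set L.Edge) (x y : L.V) :
    IsOpen {ω : L.Config | (L.subgraphOf {e | e ∈ T ∧ ω e = true}).Reachable x y} := by
  rw [isOpen_iff_mem_nhds]
  intro ω hω
  obtain ⟨F, hF, hr⟩ := exists_finset_of_reachable hω
  have h : {ω' : L.Config | ∀ e ∈ F, ω' e = true} ∈ 𝓝 ω := by
    have : {ω' : L.Config | ∀ e ∈ F, ω' e = true} = (F : Set L.Edge).pi fun e => {true} := by
      ext ω'; simp [Set.mem_pi]
    rw [this]
    exact (isOpen_set_pi F.finite_toSet fun e _ => isOpen_discrete _).mem_nhds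
      (fun e he => (hF he).2)
  exact Filter.mem_of_superset h fun ω' hω' =>
    hr.mono (subgraphOf_mono fun e he => ⟨(hF he).1, hω' e he⟩)

theorem measurableSet_reachable (x y : L.V) :
    MeasurableSet {ω : L.Config | (L.subgraphOf {e | ω e = true}).Reachable x y} := by
  have := (isOpen_reachable univ x y).measurableSet
  simpa using this

theorem measurableSet_connectedToInfinity (x : L.V) :
    MeasurableSet {ω : L.Config | ConnectedToInfinity ω x} := by
  have : {ω : L.Config | ConnectedToInfinity ω x} = ⋂ s : Finset L.V, ⋃ y : {y // y ∉ s},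
      {ω | (L.subgraphOf {e | ω e = true}).Reachable x y} := by
    ext ω
    simp only [ConnectedToInfinity, mem_ofPred_eq, mem_iInter, mem_iUnion]
    constructor
    · intro h s
      obtain ⟨y, hy, hys⟩ := h.exists_notMem_finset s
      exact ⟨⟨y, hys⟩, hy⟩
    · intro h hfin
      obtain ⟨y, hy⟩ := h hfin.toFinset
      exact y.2 (hfin.mem_toFinset.2 hy)
  rw [this]
  exact MeasurableSet.iInter fun s => MeasurableSet.iUnion fun y => measurableSet_reachable _ _

/-! ### The wired boundary condition -/

/-- The vertices of a finite subgraph that have an edge outside. -/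
def boundary (E : Finset L.Edge) : Set (L.verts E) :=
  {x | ∃ e : L.Edge, e ∉ E ∧ x.1 ∈ (e : Sym2 L.V)}

/-- The boundary condition that wires all boundary vertices. -/
def wired (E : Finset L.Edge) : L.BoundaryCondition E where
  r x y := x = y ∨ (x ∈ boundary E ∧ y ∈ boundary E)
  iseqv := ⟨fun x => Or.inl rfl, fun h => h.imp Eq.symm And.symm, by
    rintro x y z (rfl | h) (rfl | h')
    · exact Or.inl rfl
    · exact Or.inr h'
    · exact Or.inr h
    · exact Or.inr ⟨h.1, h'.2⟩⟩

/-- A nontrivial path outside `E` starts and ends with edges outside `E`, so both its end-points are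
boundary vertices. -/
theorem inducedBC_le_wired (E : Finset L.Edge) (ω : L.Config) : inducedBC E ω ≤ wired E := by
  have key : ∀ x y : L.verts E,
      (L.subgraphOf {e | e ∉ E ∧ ω e = true}).Reachable x.1 y.1 → x = y ∨ x ∈ boundary E := by
    rintro x y ⟨w⟩
    obtain ⟨x, hx⟩ := x
    obtain ⟨y, hy⟩ := y
    cases w with
    | nil => exact Or.inl rfl
    | cons hadj _ =>
      obtain ⟨e, he, hxy⟩ := subgraphOf_adj.1 hadj
      exact Or.inr ⟨e, he.1, hxy ▸ Sym2.mem_mk_left _ _⟩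
  intro x y h
  rcases key x y h with h1 | h1
  · exact Or.inl h1
  · rcases key y x h.symm with h2 | h2
    · exact Or.inl h2.symm
    · exact Or.inr ⟨h1, h2⟩

theorem measurableSet_inducedBC_eq (E : Finset L.Edge) (ξ : L.BoundaryCondition E) :
    MeasurableSet {ω : L.Config | inducedBC E ω = ξ} := by
  have : {ω : L.Config | inducedBC E ω = ξ} = ⋂ x : L.verts E, ⋂ y : L.verts E,
      {ω | (L.subgraphOf {e | e ∉ E ∧ ω e = true}).Reachable x.1 y.1 ↔ ξ x y} := by
    ext ω
    simp only [mem_ofPred_eq, mem_iInter]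
    exact ⟨fun h x y => h ▸ Iff.rfl, fun h => Setoid.ext h⟩
  rw [this]
  refine MeasurableSet.iInter fun x => MeasurableSet.iInter fun y => ?_
  have h := (isOpen_reachable {e | e ∉ E} x.1 y.1).measurableSet
  by_cases hxy : ξ x y
  · simp only [hxy, iff_true]; exact h
  · simp only [hxy, iff_false]; exact h.compl

theorem measurableSet_restrict_eq (E : Finset L.Edge) (η : E → Bool) :
    MeasurableSet {ω : L.Config | E.restrict ω = η} :=
  IsLocal.measurableSet (E := E) fun ω ω' h (hω : E.restrict ω = η) => by
    change E.restrict ω' = η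
    rw [← hω]
    funext e
    exact (h e.1 e.2).symm

variable {p q : ℝ} {φ : Measure L.Config}

open Classical in
/-- The probability of a local event, conditioned on the induced boundary condition. -/
theorem IsRandomClusterMeasure.real_eq_sum (hφ : IsRandomClusterMeasure p q φ) {E : Finset L.Edge}
    {A : Set L.Config} (hA : IsLocal E A) [Fintype (L.BoundaryCondition E)] :
    φ.real A = ∑ ξ, φ.real {ω | inducedBC E ω = ξ} * fvMean p q E ξ (A.indicator 1) := by
  have := hφ.isProbabilityMeasure
  set f : L.Config → (E → Bool) × L.BoundaryCondition E :=
    fun ω => (E.restrict ω, inducedBC E ω) with hf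
  set s : Finset ((E → Bool) × L.BoundaryCondition E) :=
    Finset.univ.filter fun z => extend E z.1 ∈ A with hs
  have hpre : A = f ⁻¹' s := by
    ext ω
    simp [hf, hs, hA.extend_restrict_mem_iff]
  have hfib : ∀ z, f ⁻¹' {z} = {ω | E.restrict ω = z.1 ∧ inducedBC E ω = z.2} := by
    intro z
    ext ω
    simp [hf, Prod.ext_iff]
  have hm : ∀ z, MeasurableSet (f ⁻¹' {z}) := by
    intro z
    rw [hfib]
    exact (measurableSet_restrict_eq E z.1).inter (measurableSet_inducedBC_eq E z.2)
  conv_lhs => rw [hpre]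
  rw [← sum_measureReal_preimage_singleton s fun z _ => hm z]
  simp only [hfib]
  rw [hs, Finset.sum_filter, Fintype.sum_prod_type_right]
  refine Finset.sum_congr rfl fun ξ _ => ?_
  rw [fvMean, Finset.mul_sum]
  refine Finset.sum_congr rfl fun η _ => ?_
  rw [hφ.conditional E ξ η, Set.indicator_apply]
  split_ifs <;> simp [mul_comm]

theorem IsRandomClusterMeasure.sum_inducedBC (hφ : IsRandomClusterMeasure p q φ)
    (hp : p ∈ Ioo (0 : ℝ) 1) (hq : 1 ≤ q) (E : Finset L.Edge)
    [Fintype (L.BoundaryCondition E)] : ∑ ξ, φ.real {ω | inducedBC E ω = ξ} = 1 := by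
  have := hφ.isProbabilityMeasure
  have h := hφ.real_eq_sum (E := E) (A := univ) fun _ _ _ _ => mem_univ _
  simp only [probReal_univ, fvMean, indicator_univ, Pi.one_apply, one_mul, sum_fvProb hp hq,
    mul_one] at h
  exact h.symm

/-- The wired finite-volume measure dominates every infinite-volume measure. -/
theorem IsRandomClusterMeasure.real_le_fvMean_wired (hφ : IsRandomClusterMeasure p q φ)
    (hp : p ∈ Ioo (0 : ℝ) 1) (hq : 1 ≤ q) {E : Finset L.Edge} {A : Set L.Config}
    (hA : IsLocal E A) (hup : IsUpperSet A) :
    φ.real A ≤ fvMean p q E (wired E) (A.indicator 1) := by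
  classical
  have := Fintype.ofFinite (L.BoundaryCondition E)
  have hmono : Monotone (A.indicator (1 : L.Config → ℝ)) := by
    intro ω ω' h
    by_cases hω : ω ∈ A
    · rw [indicator_of_mem hω, indicator_of_mem (hup h hω)]; rfl
    · rw [indicator_of_notMem hω]; exact indicator_nonneg (fun _ _ => zero_le_one) _
  rw [hφ.real_eq_sum hA, ← one_mul (fvMean p q E (wired E) _), ← hφ.sum_inducedBC hp hq E,
    Finset.sum_mul]
  refine Finset.sum_le_sum fun ξ _ => ?_
  -- Only partitions induced by some configuration need be finer than the wired one; the others have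
  -- probability zero.
  by_cases hξ : ∃ ω, inducedBC E ω = ξ
  · obtain ⟨ω, rfl⟩ := hξ
    exact mul_le_mul_of_nonneg_left
      (fvMean_mono hp hp le_rfl hq (inducedBC_le_wired E ω) hmono) measureReal_nonneg
  · have : {ω | inducedBC E ω = ξ} = ∅ := by
      ext ω; simpa using fun h => hξ ⟨ω, h⟩
    rw [this]
    simp

/-! ### Finite energy -/

open Classical in
/-- Opening all edges of a finite set. -/
noncomputable def openAll (F : Finset L.Edge) (ω : L.Config) : L.Config :=
  fun e => ω e || decide (e ∈ F)

theorem openAll_apply_mem {F : Finset L.Edge} {e : L.Edge} (h : e ∈ F) (ω : L.Config) :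
    openAll F ω e = true := by simp [openAll, h]

theorem openAll_apply_notMem {F : Finset L.Edge} {e : L.Edge} (h : e ∉ F) (ω : L.Config) :
    openAll F ω e = ω e := by simp [openAll, h]

theorem continuous_openAll (F : Finset L.Edge) : Continuous (openAll (L := L) F) := by
  refine continuous_pi fun e => ?_
  by_cases h : e ∈ F
  · simp only [openAll_apply_mem h]; exact continuous_const
  · simp only [openAll_apply_notMem h]; exact continuous_apply e

theorem extend_sup_openOn {E F : Finset L.Edge} (h : F ⊆ E) (η : E → Bool) :
    extend E (η ⊔ openOn E F) = openAll F (extend E η) := by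
  funext e
  by_cases he : e ∈ E
  · simp [extend_apply_mem _ he, openAll, openOn]
  · rw [extend_apply_notMem _ he, openAll_apply_notMem (fun h' => he (h h')),
      extend_apply_notMem _ he]

/-- A configuration is recovered from its image and its states on `F`. This gives the factor `2 ^ n`
in `openingCost`. -/
theorem card_sup_openOn_fiber_le (E F : Finset L.Edge) (η' : E → Bool) :
    (Finset.univ.filter fun η : E → Bool => η ⊔ openOn E F = η').card ≤ 2 ^ F.card := by
  classical
  have : (2 : ℕ) ^ F.card = (Finset.univ : Finset (F → Bool)).card := by simp
  rw [this]
  refine Finset.card_le_card_of_injOn (fun η e => extend E η e.1) (fun _ _ => Finset.mem_univ _) ?_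
  intro η hη ξ hξ h
  have h1 : η ⊔ openOn E F = ξ ⊔ openOn E F := by
    rw [(Finset.mem_filter.1 hη).2, (Finset.mem_filter.1 hξ).2]
  funext e
  by_cases he : e.1 ∈ F
  · have := congrFun h ⟨e.1, he⟩
    simpa [extend_apply_mem _ e.2] using this
  · have := congrFun h1 e
    simpa [openOn, he] using this

/-- The constant in the finite energy property. -/
noncomputable def openingCost (p q : ℝ) (n : ℕ) : ℝ := q ^ (2 * n) / p ^ n * 2 ^ n

theorem openingCost_pos (hp : p ∈ Ioo (0 : ℝ) 1) (hq : 1 ≤ q) (n : ℕ) : 0 < openingCost p q n := by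
  have : 0 < p := hp.1
  unfold openingCost
  positivity

theorem fvMean_openAll_le (hp : p ∈ Ioo (0 : ℝ) 1) (hq : 1 ≤ q) {E F : Finset L.Edge}
    (h : F ⊆ E) (ξ : L.BoundaryCondition E) {f : L.Config → ℝ} (hf : 0 ≤ f) :
    fvMean p q E ξ (f ∘ openAll F) ≤ openingCost p q F.card * fvMean p q E ξ f := by
  classical
  have hp0 : 0 < p := hp.1
  set K : ℝ := q ^ (2 * F.card) / p ^ F.card with hK
  have hK0 : 0 ≤ K := by positivity
  have hw : ∀ η, fvProb p q E ξ η ≤ K * fvProb p q E ξ (η ⊔ openOn E F) := by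
    intro η
    rw [fvProb_eq, fvProb_eq, ← mul_div_assoc]
    refine div_le_div_of_nonneg_right ?_ (partitionFunction_pos hp hq E ξ).le
    rw [hK, div_mul_eq_mul_div, le_div_iff₀ (by positivity), mul_comm]
    exact fvWeight_le_sup_openOn hp hq E F ξ η
  set g : (E → Bool) → ℝ := fun η => f (extend E η) * fvProb p q E ξ η with hg
  have hg0 : ∀ η, 0 ≤ g η := fun η => mul_nonneg (hf _) (fvProb_nonneg hp hq E ξ η)
  calc fvMean p q E ξ (f ∘ openAll F) ≤ ∑ η, K * g (η ⊔ openOn E F) := by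
        refine Finset.sum_le_sum fun η _ => ?_
        rw [Function.comp_apply, ← extend_sup_openOn h]
        calc _ ≤ f (extend E (η ⊔ openOn E F)) * (K * fvProb p q E ξ (η ⊔ openOn E F)) :=
              mul_le_mul_of_nonneg_left (hw η) (hf _)
          _ = _ := by rw [hg]; ring
    _ = K * ∑ η, g (η ⊔ openOn E F) := by rw [Finset.mul_sum]
    _ ≤ K * (2 ^ F.card * ∑ η, g η) := by
        refine mul_le_mul_of_nonneg_left ?_ hK0
        rw [Finset.sum_comp g (fun η : E → Bool => η ⊔ openOn E F), Finset.mul_sum]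
        refine (Finset.sum_le_sum_of_subset_of_nonneg (Finset.subset_univ _)
          fun b _ _ => nsmul_nonneg (hg0 b) _).trans (Finset.sum_le_sum fun b _ => ?_)
        rw [nsmul_eq_mul]
        refine mul_le_mul_of_nonneg_right ?_ (hg0 b)
        exact_mod_cast card_sup_openOn_fiber_le E F b
    _ = _ := by simp only [openingCost, hK, fvMean, hg]; ring

theorem IsRandomClusterMeasure.real_preimage_openAll_le (hφ : IsRandomClusterMeasure p q φ)
    (hp : p ∈ Ioo (0 : ℝ) 1) (hq : 1 ≤ q) {E F : Finset L.Edge} (h : F ⊆ E) {A : Set L.Config}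
    (hA : IsLocal E A) : φ.real (openAll F ⁻¹' A) ≤ openingCost p q F.card * φ.real A := by
  classical
  have := Fintype.ofFinite (L.BoundaryCondition E)
  have hA' : IsLocal E (openAll F ⁻¹' A) := fun ω ω' hω =>
    hA _ _ fun e he => by simp [openAll, hω e he]
  rw [hφ.real_eq_sum hA', hφ.real_eq_sum hA, Finset.mul_sum]
  refine Finset.sum_le_sum fun ξ _ => ?_
  have := fvMean_openAll_le hp hq h ξ (f := A.indicator 1) (indicator_nonneg fun _ _ => zero_le_one)
  calc _ ≤ φ.real {ω | inducedBC E ω = ξ} *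
        (openingCost p q F.card * fvMean p q E ξ (A.indicator 1)) :=
        mul_le_mul_of_nonneg_left this measureReal_nonneg
    _ = _ := by ring

/-- **Finite energy**: opening the edges of a finite set increases probabilities by at most a
constant factor. -/
theorem IsRandomClusterMeasure.preimage_openAll_le (hφ : IsRandomClusterMeasure p q φ)
    (hp : p ∈ Ioo (0 : ℝ) 1) (hq : 1 ≤ q) (F : Finset L.Edge) (A : Set L.Config) :
    φ (openAll F ⁻¹' A) ≤ ENNReal.ofReal (openingCost p q F.card) * φ A := by
  classical
  have := hφ.isProbabilityMeasure
  set C := ENNReal.ofReal (openingCost p q F.card) with hC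
  have hC0 : C ≠ 0 := by
    rw [hC, ne_eq, ENNReal.ofReal_eq_zero, not_le]; exact openingCost_pos hp hq _
  have hlocal : ∀ {E : Finset L.Edge} {B : Set L.Config}, F ⊆ E → IsLocal E B →
      φ (openAll F ⁻¹' B) ≤ C * φ B := by
    intro E B h hB
    have := hφ.real_preimage_openAll_le hp hq h hB
    rw [← ofReal_measureReal (μ := φ) (s := B), ← ofReal_measureReal (μ := φ), hC,
      ← ENNReal.ofReal_mul (openingCost_pos hp hq _).le]
    exact ENNReal.ofReal_le_ofReal this
  have hopen : ∀ U : Set L.Config, IsOpen U → φ (openAll F ⁻¹' U) ≤ C * φ U := by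
    intro U hU
    -- `B E` is the largest part of `U` that depends only on `F ∪ E`. These local events increase to
    -- the open set `U`, so the bound passes to the limit.
    set B : Finset L.Edge → Set L.Config :=
      fun E => {ω | ∀ ω' : L.Config, (∀ e ∈ F ∪ E, ω e = ω' e) → ω' ∈ U} with hB
    have hBl : ∀ E, IsLocal (F ∪ E) (B E) := fun E ω ω' h hω ω'' h' =>
      hω ω'' fun e he => (h e he).trans (h' e he)
    have hBm : Monotone B := fun E E' h ω hω ω' h' =>
      hω ω' fun e he => h' e (Finset.union_subset_union_right h he)
    have hBU : U = ⋃ E, B E := by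
      ext ω
      rw [mem_iUnion]
      constructor
      · intro hω
        obtain ⟨E, u, hu, hsub⟩ := isOpen_pi_iff.1 hU ω hω
        refine ⟨E, fun ω' h => hsub fun e he => ?_⟩
        rw [← h e (Finset.mem_union_right _ he)]
        exact (hu e he).2
      · rintro ⟨E, hE⟩
        exact hE ω fun _ _ => rfl
    rw [hBU, preimage_iUnion, (Monotone.directed_le (f := fun E => openAll F ⁻¹' B E)
      fun E E' h => preimage_mono (hBm h)).measure_iUnion]
    refine iSup_le fun E => (hlocal Finset.subset_union_left (hBl E)).trans ?_
    gcongr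
    exact subset_iUnion B E
  -- Outer regularity on the metrizable space of configurations extends the bound from open sets to
  -- all sets.
  rw [A.measure_eq_iInf_isOpen φ]
  simp only [ENNReal.mul_iInf_of_ne hC0 ENNReal.ofReal_ne_top]
  refine le_iInf fun U => le_iInf fun hAU => le_iInf fun hU => ?_
  exact (measure_mono (preimage_mono hAU)).trans (hopen U hU)

end PlanarLattice

/-! ### Existence of the free infinite-volume measure and comparison with finite volume -/

namespace PlanarLattice

variable {L : PlanarLattice} {p q : ℝ}

theorem _root_.IsUpperSet.monotone_indicator_one {α : Type*} [Preorder α] {A : Set α}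
    (hA : IsUpperSet A) : Monotone (A.indicator (1 : α → ℝ)) := by
  intro ω ω' h
  by_cases hω : ω ∈ A
  · rw [indicator_of_mem hω, indicator_of_mem (hA h hω)]; rfl
  · rw [indicator_of_notMem hω]; exact indicator_nonneg (fun _ _ => zero_le_one) _

theorem fvMean_sub (E : Finset L.Edge) (ξ : L.BoundaryCondition E) (f g : L.Config → ℝ) :
    fvMean p q E ξ (f - g) = fvMean p q E ξ f - fvMean p q E ξ g := by
  simp only [fvMean, Pi.sub_apply, sub_mul, Finset.sum_sub_distrib]

theorem fvMean_sum {ι : Type*} (s : Finset ι) (E : Finset L.Edge) (ξ : L.BoundaryCondition E)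
    (f : ι → L.Config → ℝ) :
    fvMean p q E ξ (fun ω => ∑ i ∈ s, f i ω) = ∑ i ∈ s, fvMean p q E ξ (f i) := by
  simp only [fvMean, Finset.sum_mul]
  rw [Finset.sum_comm]

theorem fvMean_indicator_le_one (hp : p ∈ Ioo (0 : ℝ) 1) (hq : 1 ≤ q) (E : Finset L.Edge)
    (ξ : L.BoundaryCondition E) (A : Set L.Config) : fvMean p q E ξ (A.indicator 1) ≤ 1 := by
  rw [← sum_fvProb hp hq E ξ]
  refine Finset.sum_le_sum fun η _ => mul_le_of_le_one_left (fvProb_nonneg hp hq E ξ η) ?_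
  exact indicator_le_self' (fun _ _ => zero_le_one) _

/-- A finite-volume measure, as a measure on the configurations of the whole lattice. -/
noncomputable def fvMeasure (p q : ℝ) (E : Finset L.Edge) (ξ : L.BoundaryCondition E) :
    Measure L.Config :=
  ∑ η : E → Bool, ENNReal.ofReal (fvProb p q E ξ η) • Measure.dirac (extend E η)

theorem fvMeasure_apply (hp : p ∈ Ioo (0 : ℝ) 1) (hq : 1 ≤ q) (E : Finset L.Edge)
    (ξ : L.BoundaryCondition E) {A : Set L.Config} (hA : MeasurableSet A) :
    fvMeasure p q E ξ A = ENNReal.ofReal (fvMean p q E ξ (A.indicator 1)) := by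
  unfold fvMean
  have h0 : ∀ ω, 0 ≤ A.indicator (1 : L.Config → ℝ) ω := indicator_nonneg fun _ _ => zero_le_one
  rw [ENNReal.ofReal_sum_of_nonneg fun η _ => mul_nonneg (h0 _) (fvProb_nonneg hp hq E ξ η)]
  simp only [fvMeasure, Measure.coe_finsetSum, Finset.sum_apply, Measure.smul_apply,
    Measure.dirac_apply' _ hA, smul_eq_mul]
  refine Finset.sum_congr rfl fun η _ => ?_
  by_cases h : extend E η ∈ A <;> simp [h]

theorem isProbabilityMeasure_fvMeasure (hp : p ∈ Ioo (0 : ℝ) 1) (hq : 1 ≤ q) (E : Finset L.Edge)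
    (ξ : L.BoundaryCondition E) : IsProbabilityMeasure (fvMeasure p q E ξ) := by
  refine ⟨?_⟩
  rw [fvMeasure_apply hp hq E ξ MeasurableSet.univ]
  simp [fvMean, sum_fvProb hp hq]

theorem isLocal_restrict_eq (F : Finset L.Edge) (ζ : F → Bool) :
    IsLocal F {ω : L.Config | F.restrict ω = ζ} := fun ω ω' h (hω : F.restrict ω = ζ) => by
  change F.restrict ω' = ζ
  rw [← hω]
  funext e
  exact (h e.1 e.2).symm

theorem fvEventProb_eq_fvMean {E F : Finset L.Edge} (h : F ⊆ E) (ξ : L.BoundaryCondition E)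
    (ζ : F → Bool) : fvEventProb p q E ξ
      {η | ∀ (e : L.Edge) (hE : e ∈ E) (hF : e ∈ F), η ⟨e, hE⟩ = ζ ⟨e, hF⟩} =
      fvMean p q E ξ ({ω | F.restrict ω = ζ}.indicator 1) := by
  classical
  refine Finset.sum_congr rfl fun η _ => ?_
  have : (η ∈ {η : E → Bool | ∀ (e : L.Edge) (hE : e ∈ E) (hF : e ∈ F), η ⟨e, hE⟩ = ζ ⟨e, hF⟩}) ↔
      extend E η ∈ {ω : L.Config | F.restrict ω = ζ} := by
    constructor
    · intro H
      funext e
      exact (extend_apply_mem _ (h e.2)).trans (H e.1 (h e.2) e.2)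
    · intro H e hE he
      rw [← extend_apply_mem η hE]
      exact congrFun H ⟨e, he⟩
  simp only [indicator_apply, this, Pi.one_apply]
  split_ifs <;> simp

theorem tendsto_fvMean_bot_of_isUpperSet (hp : p ∈ Ioo (0 : ℝ) 1) (hq : 1 ≤ q)
    {A : Set L.Config} (hA : IsUpperSet A) :
    ∃ l, Tendsto (fun E : Finset L.Edge => fvMean p q E ⊥ (A.indicator 1)) atTop (𝓝 l) :=
  ⟨_, tendsto_atTop_ciSup (fun _ _ h => fvMean_bot_mono hp hq h hA.monotone_indicator_one)
    ⟨1, by rintro _ ⟨E, rfl⟩; exact fvMean_indicator_le_one hp hq E ⊥ A⟩⟩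

/-- A cylinder is the difference of two increasing events: the prescribed edges are open, and in
addition some edge prescribed closed is open. For increasing events the free means converge by
monotonicity in the volume. -/
theorem tendsto_fvMean_bot_restrict_eq (hp : p ∈ Ioo (0 : ℝ) 1) (hq : 1 ≤ q) (F : Finset L.Edge)
    (ζ : F → Bool) : ∃ l, Tendsto (fun E : Finset L.Edge =>
      fvMean p q E ⊥ ({ω | F.restrict ω = ζ}.indicator 1)) atTop (𝓝 l) := by
  classical
  set A : Set L.Config := {ω | ∀ e : F, ζ e = true → ω e = true} with hA
  set B : Set L.Config := {ω | ω ∈ A ∧ ∃ e : F, ζ e = false ∧ ω e = true} with hB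
  have hAu : IsUpperSet A := fun ω ω' h hω e he =>
    Bool.eq_true_of_true_le (by rw [← hω e he]; exact h e)
  have hBu : IsUpperSet B := fun ω ω' h hω => ⟨hAu h hω.1, by
    obtain ⟨e, he, ho⟩ := hω.2
    exact ⟨e, he, Bool.eq_true_of_true_le (by rw [← ho]; exact h e)⟩⟩
  have hind : ({ω : L.Config | F.restrict ω = ζ}.indicator (1 : L.Config → ℝ)) =
      A.indicator 1 - B.indicator 1 := by
    have hset : {ω : L.Config | F.restrict ω = ζ} = A \ B := by
      ext ω
      constructor
      · intro h
        have h' : ∀ e : F, ω e = ζ e := fun e => congrFun h e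
        refine ⟨fun e he => (h' e).trans he, ?_⟩
        rintro ⟨-, e, he, ho⟩
        rw [h' e, he] at ho
        exact absurd ho (by simp)
      · rintro ⟨h1, h2⟩
        funext e
        change ω e = ζ e
        rcases hz : ζ e with _ | _
        · by_contra hc
          exact h2 ⟨h1, e, hz, by simpa using hc⟩
        · exact h1 e hz
    have hBA : B ⊆ A := fun ω hω => hω.1
    rw [hset]
    funext ω
    by_cases h1 : ω ∈ B
    · simp [h1, hBA h1]
    · by_cases h2 : ω ∈ A <;> simp [h1, h2]
  obtain ⟨l, hl⟩ := tendsto_fvMean_bot_of_isUpperSet hp hq hAu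
  obtain ⟨m, hm⟩ := tendsto_fvMean_bot_of_isUpperSet hp hq hBu
  refine ⟨l - m, (hl.sub hm).congr fun E => ?_⟩
  rw [hind, fvMean_sub]

/-- The infinite-volume measure with free boundary conditions exists. -/
theorem exists_isFreeMeasure (hp : p ∈ Ioo (0 : ℝ) 1) (hq : 1 ≤ q) :
    ∃ φ : Measure L.Config, IsFreeMeasure p q φ := by
  classical
  set μ : Finset L.Edge → ProbabilityMeasure L.Config :=
    fun E => ⟨fvMeasure p q E ⊥, isProbabilityMeasure_fvMeasure hp hq E ⊥⟩ with hμ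
  set U : Ultrafilter (Finset L.Edge) := Ultrafilter.of atTop with hU
  have hUle : (U : Filter (Finset L.Edge)) ≤ atTop := Ultrafilter.of_le _
  -- Probability measures on the compact space of configurations form a compact space, so the
  -- finite-volume measures converge along an ultrafilter.
  obtain ⟨ν, -, hν⟩ := isCompact_univ.ultrafilter_le_nhds (U.map μ) (by simp)
  have hν' : Tendsto μ U (𝓝 ν) := hν
  refine ⟨ν, ⟨ν.2, fun F ζ => ?_⟩⟩
  obtain ⟨l, hl⟩ := tendsto_fvMean_bot_restrict_eq hp hq F ζ
  have hloc := isLocal_restrict_eq F ζ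
  -- Cylinders are clopen, so weak convergence gives convergence of their probabilities along the
  -- ultrafilter. The full limit exists and must agree with it.
  have hfr : (ν : Measure L.Config) (frontier {ω : L.Config | F.restrict ω = ζ}) = 0 := by
    have : IsClopen {ω : L.Config | F.restrict ω = ζ} :=
      ⟨isOpen_compl_iff.1 hloc.compl.isOpen, hloc.isOpen⟩
    rw [this.frontier_eq, measure_empty]
  have h1 := ProbabilityMeasure.tendsto_measure_of_null_frontier_of_tendsto' hν' hfr
  have h2 : Tendsto (fun E => fvMean p q E ⊥ ({ω | F.restrict ω = ζ}.indicator 1)) U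
      (𝓝 ((ν : Measure L.Config).real {ω | F.restrict ω = ζ})) := by
    refine ((ENNReal.tendsto_toReal (measure_ne_top _ _)).comp h1).congr fun E => ?_
    simp only [Function.comp_apply, hμ, ProbabilityMeasure.coe_mk]
    rw [fvMeasure_apply hp hq E ⊥ hloc.measurableSet, ENNReal.toReal_ofReal]
    exact Finset.sum_nonneg fun η _ => mul_nonneg
      (indicator_nonneg (fun _ _ => zero_le_one) _) (fvProb_nonneg hp hq E ⊥ η)
  rw [tendsto_nhds_unique h2 (hl.mono_left hUle)]
  refine hl.congr' ?_
  filter_upwards [eventually_ge_atTop F] with E hE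
  exact (fvEventProb_eq_fvMean hE ⊥ ζ).symm

theorem IsFreeMeasure.tendsto_fvMean {φ : Measure L.Config} (hφ : IsFreeMeasure p q φ)
    {F : Finset L.Edge} {A : Set L.Config} (hA : IsLocal F A) :
    Tendsto (fun E : Finset L.Edge => fvMean p q E ⊥ (A.indicator 1)) atTop (𝓝 (φ.real A)) := by
  classical
  have := hφ.isProbabilityMeasure
  set s : Finset (F → Bool) := Finset.univ.filter fun ζ => extend F ζ ∈ A with hs
  have hpre : A = F.restrict ⁻¹' s := by
    ext ω
    simp [hs, hA.extend_restrict_mem_iff]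
  have hsum : φ.real A = ∑ ζ ∈ s, φ.real {ω | F.restrict ω = ζ} := by
    conv_lhs => rw [hpre]
    rw [← sum_measureReal_preimage_singleton s fun z _ => measurableSet_restrict_eq F z]
    rfl
  have hind : A.indicator (1 : L.Config → ℝ) =
      fun ω => ∑ ζ ∈ s, ({ω | F.restrict ω = ζ} : Set L.Config).indicator 1 ω := by
    funext ω
    simp only [indicator_apply, mem_ofPred_eq, Pi.one_apply]
    rw [Finset.sum_ite_eq]
    simp [hs, hA.extend_restrict_mem_iff]
  rw [hsum, hind]
  simp only [fvMean_sum]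
  refine tendsto_finsetSum s fun ζ _ => (hφ.tendsto F ζ).congr' ?_
  filter_upwards [eventually_ge_atTop F] with E hE
  exact fvEventProb_eq_fvMean hE ⊥ ζ

/-- The free measure dominates the finite-volume measures with free boundary conditions. -/
theorem IsFreeMeasure.fvMean_le {φ : Measure L.Config} (hφ : IsFreeMeasure p q φ)
    (hp : p ∈ Ioo (0 : ℝ) 1) (hq : 1 ≤ q) {F : Finset L.Edge} {A : Set L.Config}
    (hA : IsLocal F A) (hup : IsUpperSet A) (E : Finset L.Edge) :
    fvMean p q E ⊥ (A.indicator 1) ≤ φ.real A := by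
  refine ge_of_tendsto (hφ.tendsto_fvMean hA) ?_
  filter_upwards [eventually_ge_atTop E] with E' hE'
  exact fvMean_bot_mono hp hq hE' hup.monotone_indicator_one

end PlanarLattice

namespace PlanarLattice

variable {L : PlanarLattice} {p q : ℝ}

/-! ### Automorphisms -/

theorem subgraphOf_reachable_image (σ : L.graph ≃g L.graph) {S : Set L.Edge} {x y : L.V}
    (h : (L.subgraphOf S).Reachable x y) :
    (L.subgraphOf (σ.mapEdgeSet '' S)).Reachable (σ x) (σ y) := by
  obtain ⟨w⟩ := h
  induction w with
  | nil => exact SimpleGraph.Reachable.refl _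
  | cons hadj _ ih =>
    obtain ⟨e, he, hxy⟩ := subgraphOf_adj.1 hadj
    refine SimpleGraph.Reachable.trans (SimpleGraph.Adj.reachable ?_) ih
    refine subgraphOf_adj.2 ⟨σ.mapEdgeSet e, mem_image_of_mem _ he, ?_⟩
    change Sym2.map σ (e : Sym2 L.V) = _
    rw [hxy]
    rfl

theorem subgraphOf_reachable_image_iff (σ : L.graph ≃g L.graph) {S : Set L.Edge} {x y : L.V} :
    (L.subgraphOf (σ.mapEdgeSet '' S)).Reachable (σ x) (σ y) ↔ (L.subgraphOf S).Reachable x y := by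
  refine ⟨fun h => ?_, subgraphOf_reachable_image σ⟩
  have h' := subgraphOf_reachable_image σ.symm h
  rw [σ.symm_apply_apply, σ.symm_apply_apply] at h'
  convert h' using 2
  have : ⇑(σ.symm.mapEdgeSet) = ⇑(σ.mapEdgeSet.symm) := rfl
  rw [this, Equiv.symm_image_image]

/-- The configuration seen through an automorphism of the lattice. -/
def pull (σ : L.graph ≃g L.graph) (ω : L.Config) : L.Config := fun e => ω (σ.mapEdgeSet e)

theorem pull_mono (σ : L.graph ≃g L.graph) : Monotone (pull σ) := fun _ _ h _ => h _

theorem reachable_pull_iff (σ : L.graph ≃g L.graph) {ω : L.Config} {x y : L.V} :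
    (L.subgraphOf {e | pull σ ω e = true}).Reachable x y ↔
      (L.subgraphOf {e | ω e = true}).Reachable (σ x) (σ y) := by
  rw [← subgraphOf_reachable_image_iff σ]
  have : σ.mapEdgeSet '' {e | pull σ ω e = true} = {e | ω e = true} := by
    rw [Equiv.image_eq_preimage_symm]
    ext e
    exact iff_of_eq (congrArg (fun f => ω f = true) (σ.mapEdgeSet.apply_symm_apply e))
  rw [this]

/-- The image of a finite set of edges under an automorphism. -/
def shift (σ : L.graph ≃g L.graph) (E : Finset L.Edge) : Finset L.Edge :=
  E.map σ.mapEdgeSet.toEmbedding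

theorem mem_shift {σ : L.graph ≃g L.graph} {E : Finset L.Edge} {e : L.Edge} :
    e ∈ shift σ E ↔ ∃ f ∈ E, σ.mapEdgeSet f = e := Finset.mem_map

theorem mapEdgeSet_mem_shift {σ : L.graph ≃g L.graph} {E : Finset L.Edge} {e : L.Edge} :
    σ.mapEdgeSet e ∈ shift σ E ↔ e ∈ E :=
  Finset.mem_map' σ.mapEdgeSet.toEmbedding

/-- The bijection between a finite set of edges and its image. -/
noncomputable def shiftEquiv (σ : L.graph ≃g L.graph) (E : Finset L.Edge) : E ≃ shift σ E :=
  σ.mapEdgeSet.subtypeEquiv fun _ => mapEdgeSet_mem_shift.symm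

theorem mem_mapEdgeSet_iff (σ : L.graph ≃g L.graph) (e : L.Edge) (x : L.V) :
    σ x ∈ (σ.mapEdgeSet e : Sym2 L.V) ↔ x ∈ (e : Sym2 L.V) := by
  change σ x ∈ Sym2.map σ (e : Sym2 L.V) ↔ _
  rw [Sym2.mem_map]
  exact ⟨fun ⟨_, hy, hxy⟩ => σ.injective hxy ▸ hy, fun h => ⟨x, h, rfl⟩⟩

theorem mem_verts_shift {σ : L.graph ≃g L.graph} {E : Finset L.Edge} {x : L.V} :
    σ x ∈ L.verts (shift σ E) ↔ x ∈ L.verts E := by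
  constructor
  · rintro ⟨e, he, hx⟩
    obtain ⟨f, hf, rfl⟩ := mem_shift.1 he
    exact ⟨f, hf, (mem_mapEdgeSet_iff σ f x).1 hx⟩
  · rintro ⟨e, he, hx⟩
    exact ⟨_, mapEdgeSet_mem_shift.2 he, (mem_mapEdgeSet_iff σ e x).2 hx⟩

theorem numClusters_shift (σ : L.graph ≃g L.graph) (E : Finset L.Edge) (η : shift σ E → Bool) :
    numClusters (shift σ E) ⊥ η = numClusters E ⊥ (η ∘ shiftEquiv σ E) := by
  unfold numClusters
  rw [sup_bot_eq, sup_bot_eq]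
  symm
  refine Nat.card_congr (Quotient.congr
    (σ.toEquiv.subtypeEquiv fun x => mem_verts_shift.symm) fun x y => ?_)
  have hset : {e | ∃ h : e ∈ shift σ E, η ⟨e, h⟩ = true} =
      σ.mapEdgeSet '' {e | ∃ h : e ∈ E, (η ∘ shiftEquiv σ E) ⟨e, h⟩ = true} := by
    ext e
    constructor
    · rintro ⟨he, ho⟩
      obtain ⟨f, hf, rfl⟩ := mem_shift.1 he
      exact ⟨f, ⟨hf, ho⟩, rfl⟩
    · rintro ⟨f, ⟨hf, ho⟩, rfl⟩
      exact ⟨mapEdgeSet_mem_shift.2 hf, ho⟩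
  change (L.subgraphOf _).Reachable x.1 y.1 ↔ (L.subgraphOf _).Reachable (σ x.1) (σ y.1)
  rw [hset, subgraphOf_reachable_image_iff]

theorem fvWeight_shift (σ : L.graph ≃g L.graph) (E : Finset L.Edge) (η : shift σ E → Bool) :
    fvWeight p q (shift σ E) ⊥ η = fvWeight p q E ⊥ (η ∘ shiftEquiv σ E) := by
  unfold fvWeight
  rw [pow_numOpen_mul_pow_numClosed, pow_numOpen_mul_pow_numClosed, numClusters_shift]
  congr 1
  exact (Fintype.prod_equiv (shiftEquiv σ E) _ _ fun e => rfl).symm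

/-- Finite-volume measures with free boundary conditions are covariant. -/
theorem fvMean_shift (σ : L.graph ≃g L.graph) (E : Finset L.Edge) (f : L.Config → ℝ) :
    fvMean p q (shift σ E) ⊥ (f ∘ pull σ) = fvMean p q E ⊥ f := by
  have hsum : ∀ g : (E → Bool) → ℝ,
      ∑ η : shift σ E → Bool, g (η ∘ shiftEquiv σ E) = ∑ η, g η := by
    intro g
    exact Fintype.sum_equiv (Equiv.arrowCongr (shiftEquiv σ E).symm (Equiv.refl Bool)) _ _
      fun η => rfl
  have hZ : partitionFunction p q (shift σ E) ⊥ = partitionFunction p q E ⊥ := by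
    unfold partitionFunction
    rw [← hsum]
    exact Finset.sum_congr rfl fun η _ => fvWeight_shift σ E η
  unfold fvMean
  rw [← hsum]
  refine Finset.sum_congr rfl fun η _ => ?_
  rw [fvProb_eq, fvProb_eq, hZ, fvWeight_shift, Function.comp_apply]
  congr 2
  funext e
  by_cases he : e ∈ E
  · rw [extend_apply_mem _ he]
    exact extend_apply_mem _ (mapEdgeSet_mem_shift.2 he)
  · rw [extend_apply_notMem _ he]
    exact extend_apply_notMem _ fun h => he (mapEdgeSet_mem_shift.1 h)

theorem IsLocal.preimage_pull {F : Finset L.Edge} {A : Set L.Config} (hA : IsLocal F A)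
    (σ : L.graph ≃g L.graph) : IsLocal (shift σ F) (pull σ ⁻¹' A) :=
  fun _ _ h => hA _ _ fun _ he => h _ (mapEdgeSet_mem_shift.2 he)

/-! ### Periods -/

/-- The translation by `w` is an automorphism of the lattice. -/
def IsPeriod (L : PlanarLattice) (w : ℂ) : Prop := IsEmbeddedAut L.graph fun z => z + w

theorem IsPeriod.zero : L.IsPeriod 0 := ⟨SimpleGraph.Iso.refl, fun x => by simp⟩

theorem IsPeriod.add {w z : ℂ} (hw : L.IsPeriod w) (hz : L.IsPeriod z) : L.IsPeriod (w + z) := by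
  obtain ⟨σ, hσ⟩ := hw
  obtain ⟨τ, hτ⟩ := hz
  refine ⟨σ.trans τ, fun x => ?_⟩
  change (τ (σ x) : ℂ) = _
  rw [hτ, hσ]
  exact add_assoc _ _ _

theorem IsPeriod.neg {w : ℂ} (hw : L.IsPeriod w) : L.IsPeriod (-w) := by
  obtain ⟨σ, hσ⟩ := hw
  refine ⟨σ.symm, fun x => ?_⟩
  have h : ((σ (σ.symm x) : L.V) : ℂ) = σ.symm x + w := hσ (σ.symm x)
  rw [σ.apply_symm_apply] at h
  change ((σ.symm x : L.V) : ℂ) = x + -w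
  rw [h]
  ring

theorem IsPeriod.nsmul {w : ℂ} (hw : L.IsPeriod w) (n : ℕ) : L.IsPeriod (n • w) := by
  induction n with
  | zero => simpa using IsPeriod.zero
  | succ n ih => rw [succ_nsmul]; exact ih.add hw

theorem IsPeriod.zsmul {w : ℂ} (hw : L.IsPeriod w) (n : ℤ) : L.IsPeriod (n • w) := by
  cases n with
  | ofNat n => simpa using hw.nsmul n
  | negSucc n => rw [negSucc_zsmul]; exact (hw.nsmul (n + 1)).neg

theorem IsPeriod.lattice {u v : ℂ} (hu : L.IsPeriod u) (hv : L.IsPeriod v) (m n : ℤ) :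
    L.IsPeriod (m • u + n • v) := (hu.zsmul m).add (hv.zsmul n)

/-- The automorphism given by a period. -/
noncomputable def IsPeriod.iso {w : ℂ} (hw : L.IsPeriod w) : L.graph ≃g L.graph := hw.choose

theorem IsPeriod.coe_iso {w : ℂ} (hw : L.IsPeriod w) (x : L.V) : (hw.iso x : ℂ) = x + w :=
  hw.choose_spec x

theorem IsPeriod.edgeSegment {w : ℂ} (hw : L.IsPeriod w) (e : L.Edge) :
    edgeSegment (hw.iso.mapEdgeSet e : Sym2 L.V) =
      (fun z => z + w) '' edgeSegment (e : Sym2 L.V) := by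
  obtain ⟨e, he⟩ := e
  change _root_.edgeSegment (Sym2.map hw.iso e) = _ '' _root_.edgeSegment e
  induction e using Sym2.ind with | _ x y => ?_
  change segment ℝ (hw.iso x : ℂ) (hw.iso y) = _ '' segment ℝ (x : ℂ) y
  rw [hw.coe_iso, hw.coe_iso]
  simp only [add_comm _ w]
  exact (segment_translate_image ℝ w (x : ℂ) y).symm

/-- Even if the two images match with end-points exchanged, comparing midpoints gives equal
translations. Hence the translates of one edge over a box are counted without repetition. -/
theorem IsPeriod.mapEdgeSet_inj {w z : ℂ} (hw : L.IsPeriod w) (hz : L.IsPeriod z) {e : L.Edge}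
    (h : hw.iso.mapEdgeSet e = hz.iso.mapEdgeSet e) : w = z := by
  have h' : Sym2.map hw.iso (e : Sym2 L.V) = Sym2.map hz.iso (e : Sym2 L.V) :=
    congrArg Subtype.val h
  obtain ⟨e, he⟩ := e
  clear h
  change Sym2.map hw.iso e = Sym2.map hz.iso e at h'
  induction e using Sym2.ind with | _ x y => ?_
  rw [Sym2.map_mk, Sym2.map_mk, Sym2.eq_iff] at h'
  rcases h' with ⟨h, -⟩ | ⟨h1, h2⟩
  · have := congrArg Subtype.val h
    rw [hw.coe_iso, hz.coe_iso] at this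
    exact add_left_cancel this
  · have h1 := congrArg Subtype.val h1
    have h2 := congrArg Subtype.val h2
    rw [hw.coe_iso, hz.coe_iso] at h1 h2
    linear_combination (h1 + h2) / 2

/-- Coordinates with respect to two non-collinear vectors. -/
theorem exists_coordinates {u v : ℂ} (h : LinearIndependent ℝ ![u, v]) :
    ∃ a b : ℂ →L[ℝ] ℝ, (∀ z, z = a z • u + b z • v) ∧ a u = 1 ∧ a v = 0 ∧ b u = 0 ∧ b v = 1 := by
  set B := basisOfLinearIndependentOfCardEqFinrank h (by simp [Complex.finrank_real_complex])
    with hB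
  have h0 : B 0 = u := by simp [hB]
  have h1 : B 1 = v := by simp [hB]
  refine ⟨LinearMap.toContinuousLinearMap (B.coord 0), LinearMap.toContinuousLinearMap (B.coord 1),
    fun z => ?_, ?_, ?_, ?_, ?_⟩
  · have := B.sum_repr z
    rw [Fin.sum_univ_two, h0, h1] at this
    exact this.symm
  · rw [← h0]; simp
  · rw [← h1]; simp
  · rw [← h0]; simp
  · rw [← h1]; simp

theorem exists_lattice_near {u v : ℂ} (h : LinearIndependent ℝ ![u, v]) (z : ℂ) :
    ∃ m n : ℤ, ‖z - (m • u + n • v)‖ ≤ ‖u‖ + ‖v‖ := by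
  obtain ⟨a, b, hab, -⟩ := exists_coordinates h
  refine ⟨⌊a z⌋, ⌊b z⌋, ?_⟩
  have h1 : z - (⌊a z⌋ • u + ⌊b z⌋ • v) = Int.fract (a z) • u + Int.fract (b z) • v := by
    nth_rewrite 1 [hab z]
    rw [← Int.cast_smul_eq_zsmul ℝ, ← Int.cast_smul_eq_zsmul ℝ, Int.fract, Int.fract, sub_smul,
      sub_smul]
    abel_nf
  rw [h1]
  refine (norm_add_le _ _).trans (add_le_add ?_ ?_) <;>
  · rw [norm_smul, Real.norm_eq_abs, abs_of_nonneg (Int.fract_nonneg _)]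
    exact mul_le_of_le_one_left (norm_nonneg _) (Int.fract_lt_one _).le

/-- Every vertex is a translate of a vertex close to the origin. -/
theorem exists_vertex_near {u v : ℂ} (h : LinearIndependent ℝ ![u, v]) (hu : L.IsPeriod u)
    (hv : L.IsPeriod v) (x : L.V) :
    ∃ (w : L.V) (m n : ℤ), ‖(w : ℂ)‖ ≤ ‖u‖ + ‖v‖ ∧ (hu.lattice hv m n).iso w = x := by
  obtain ⟨m, n, hmn⟩ := exists_lattice_near h (x : ℂ)
  have hsub := (hu.lattice hv m n).neg
  refine ⟨hsub.iso x, m, n, ?_, ?_⟩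
  · rw [hsub.coe_iso, ← sub_eq_add_neg]; exact hmn
  · apply Subtype.ext
    rw [(hu.lattice hv m n).coe_iso, hsub.coe_iso]
    ring

theorem finite_vertices_norm_le (L : PlanarLattice) (r : ℝ) : {x : L.V | ‖(x : ℂ)‖ ≤ r}.Finite := by
  refine Set.Finite.of_finite_image (f := fun x : L.V => (x : ℂ)) ?_ Subtype.val_injective.injOn
  refine (L.finite_vertices r).subset ?_
  rintro _ ⟨x, hx, rfl⟩
  exact ⟨x.2, by simpa using hx⟩

theorem finite_edges_at (x : L.V) : {e : L.Edge | x ∈ (e : Sym2 L.V)}.Finite := by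
  refine Set.Finite.of_finite_image (f := fun e : L.Edge => (e : Sym2 L.V)) ?_
    Subtype.val_injective.injOn
  refine ((L.finite_neighbors x).image fun y => s(x, y)).subset ?_
  rintro _ ⟨⟨e, he⟩, hx, rfl⟩
  obtain ⟨y, rfl⟩ := Sym2.mem_iff_exists.1 hx
  exact ⟨y, he, rfl⟩

theorem finite_edges_of_finite {s : Set L.V} (hs : s.Finite) :
    {e : L.Edge | ∃ x ∈ s, x ∈ (e : Sym2 L.V)}.Finite := by
  have : {e : L.Edge | ∃ x ∈ s, x ∈ (e : Sym2 L.V)} =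
      ⋃ x ∈ s, {e : L.Edge | x ∈ (e : Sym2 L.V)} := by ext; simp
  rw [this]
  exact hs.biUnion fun x _ => finite_edges_at x

/-! ### Boxes -/

open Classical in
/-- The union of the translates of a finite set of edges over a box. -/
noncomputable def box {u v : ℂ} (hu : L.IsPeriod u) (hv : L.IsPeriod v) (F : Finset L.Edge)
    (N : ℕ) : Finset L.Edge :=
  (Finset.range N ×ˢ Finset.range N).biUnion fun m =>
    shift (hu.lattice hv (m.1 : ℤ) (m.2 : ℤ)).iso F

theorem mem_box {u v : ℂ} {hu : L.IsPeriod u} {hv : L.IsPeriod v} {F : Finset L.Edge} {N : ℕ}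
    {e : L.Edge} : e ∈ box hu hv F N ↔ ∃ m < N, ∃ n < N,
      e ∈ shift (hu.lattice hv (m : ℤ) (n : ℤ)).iso F := by
  simp only [box, Finset.mem_biUnion, Finset.mem_product, Finset.mem_range, Prod.exists]
  exact ⟨fun ⟨m, n, h, he⟩ => ⟨m, h.1, n, h.2, he⟩, fun ⟨m, hm, n, hn, he⟩ => ⟨m, n, ⟨hm, hn⟩, he⟩⟩

/-- Large boxes have a small boundary. -/
theorem exists_box_boundary_le {u v : ℂ} (h : LinearIndependent ℝ ![u, v]) (hu : L.IsPeriod u)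
    (hv : L.IsPeriod v) (F₀ : Finset L.Edge) : ∃ F : Finset L.Edge, F₀ ⊆ F ∧ ∃ C : ℕ, ∀ N : ℕ,
      (boundary (box hu hv F N)).ncard ≤ C * N := by
  classical
  set W : Set L.V := {x | ‖(x : ℂ)‖ ≤ ‖u‖ + ‖v‖} with hW
  have hWe := finite_edges_of_finite (finite_vertices_norm_le L (‖u‖ + ‖v‖))
  -- Adding all edges at vertices of a bounded region whose translates cover the vertex set ensures
  -- that a translate of `F` contains every edge at the corresponding translated vertices.
  set F : Finset L.Edge := F₀ ∪ hWe.toFinset with hF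
  choose w a b hw hab using exists_vertex_near h hu hv
  -- `(a z, b z)` is the cell of `z`; `M` bounds the offset between the index of a translate of `F`
  -- and the cells of its vertices.
  obtain ⟨M, hM⟩ : ∃ M : ℕ, ∀ z ∈ L.verts F, (a z).natAbs ≤ M ∧ (b z).natAbs ≤ M := by
    obtain ⟨M, hM⟩ := ((finite_verts F).image fun z => max (a z).natAbs (b z).natAbs).bddAbove
    exact ⟨M, fun z hz => ⟨(le_max_left _ _).trans (hM (mem_image_of_mem _ hz)),
      (le_max_right _ _).trans (hM (mem_image_of_mem _ hz))⟩⟩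
  refine ⟨F, Finset.subset_union_left, 4 * M * (L.verts F).ncard, fun N => ?_⟩
  set S : Finset (ℕ × ℕ) := (Finset.range M ×ˢ Finset.range N) ∪
    (Finset.Ico (N - M) N ×ˢ Finset.range N) ∪ (Finset.range N ×ˢ Finset.range M) ∪
    (Finset.range N ×ˢ Finset.Ico (N - M) N) with hS
  have hScard : S.card ≤ 4 * M * N := by
    have h1 : (Finset.range M ×ˢ Finset.range N).card ≤ M * N := by simp
    have h2 : (Finset.Ico (N - M) N ×ˢ Finset.range N).card ≤ M * N := by
      rw [Finset.card_product, Nat.card_Ico, Finset.card_range]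
      exact Nat.mul_le_mul_right _ (by omega)
    have h3 : (Finset.range N ×ˢ Finset.range M).card ≤ M * N := by simp [mul_comm]
    have h4 : (Finset.range N ×ˢ Finset.Ico (N - M) N).card ≤ M * N := by
      rw [Finset.card_product, Nat.card_Ico, Finset.card_range, mul_comm]
      exact Nat.mul_le_mul_right _ (by omega)
    have h5 := Finset.card_union_le ((Finset.range M ×ˢ Finset.range N) ∪
      (Finset.Ico (N - M) N ×ˢ Finset.range N) ∪ (Finset.range N ×ˢ Finset.range M))
      (Finset.range N ×ˢ Finset.Ico (N - M) N)
    have h6 := Finset.card_union_le ((Finset.range M ×ˢ Finset.range N) ∪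
      (Finset.Ico (N - M) N ×ˢ Finset.range N)) (Finset.range N ×ˢ Finset.range M)
    have h7 := Finset.card_union_le (Finset.range M ×ˢ Finset.range N)
      (Finset.Ico (N - M) N ×ˢ Finset.range N)
    have h8 : 4 * M * N = M * N + M * N + M * N + M * N := by ring
    rw [h8, hS]
    omega
  have hsub : (fun x : L.verts (box hu hv F N) => x.1) '' boundary (box hu hv F N) ⊆
      image2 (fun (m : ℕ × ℕ) (z : L.V) => (hu.lattice hv (m.1 : ℤ) (m.2 : ℤ)).iso z)
        S (L.verts F) := by
    rintro _ ⟨⟨x, hx⟩, ⟨f, hf, hxf⟩, rfl⟩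
    obtain ⟨e, he, hxe⟩ := hx
    obtain ⟨m, hm, n, hn, he⟩ := mem_box.1 he
    obtain ⟨z, hz⟩ := (hu.lattice hv (m : ℤ) (n : ℤ)).iso.surjective x
    subst hz
    have hzF : z ∈ L.verts F := mem_verts_shift.1 ⟨e, he, hxe⟩
    refine ⟨(m, n), ?_, z, hzF, rfl⟩
    by_contra hmn
    obtain ⟨ha, hb⟩ := hM z hzF
    simp only [hS, Finset.coe_union, Finset.coe_product, mem_union, mem_prod, Finset.coe_range,
      Finset.coe_Ico, mem_Iio, mem_Ico, not_or, not_and, not_lt] at hmn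
    have h1 : M ≤ m := by by_contra hc; exact absurd (hmn.1.1.1 (by omega)) (by omega)
    have h2 : m + M < N := by
      by_contra hc; exact absurd (hmn.1.1.2 ⟨by omega, hm⟩) (by omega)
    have h3 : M ≤ n := hmn.1.2 hm
    have h4 : n + M < N := by
      by_contra hc; exact absurd (hmn.2 hm) (by omega)
    -- At index distance `M` from the sides of the box, the vertex is a translate of `w z` by an
    -- index inside the box. So all its edges are in the box, against the choice of `f`.
    have h5 : ((m : ℤ) + a z).toNat < N := by omega
    have h6 : ((n : ℤ) + b z).toNat < N := by omega
    have e1 : (((m : ℤ) + a z).toNat : ℤ) = m + a z := Int.toNat_of_nonneg (by omega)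
    have e2 : (((n : ℤ) + b z).toNat : ℤ) = n + b z := Int.toNat_of_nonneg (by omega)
    set σ := (hu.lattice hv (((m : ℤ) + a z).toNat : ℤ) (((n : ℤ) + b z).toNat : ℤ)).iso with hσ
    have hx : σ (w z) = (hu.lattice hv (m : ℤ) (n : ℤ)).iso z := by
      apply Subtype.ext
      have := congrArg Subtype.val (hab z)
      rw [IsPeriod.coe_iso] at this
      rw [hσ, IsPeriod.coe_iso, IsPeriod.coe_iso, e1, e2, ← this, add_smul, add_smul]
      ring
    apply hf
    refine mem_box.2 ⟨_, h5, _, h6, ?_⟩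
    obtain ⟨g, hg⟩ := σ.mapEdgeSet.surjective f
    rw [← hg]
    refine mapEdgeSet_mem_shift.2 (Finset.mem_union_right _ ?_)
    rw [Set.Finite.mem_toFinset]
    refine ⟨w z, hw z, ?_⟩
    rw [← mem_mapEdgeSet_iff σ, hg]
    rw [hx]
    exact hxf
  have hfin : (image2 (fun (m : ℕ × ℕ) (z : L.V) =>
      (hu.lattice hv (m.1 : ℤ) (m.2 : ℤ)).iso z) S (L.verts F)).Finite :=
    Set.Finite.image2 _ S.finite_toSet (finite_verts F)
  calc (boundary (box hu hv F N)).ncard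
      = ((fun x : L.verts (box hu hv F N) => x.1) '' boundary (box hu hv F N)).ncard :=
        (Set.ncard_image_of_injective _ Subtype.val_injective).symm
    _ ≤ _ := Set.ncard_le_ncard hsub hfin
    _ ≤ ((S : Set (ℕ × ℕ)) ×ˢ L.verts F).ncard := by
        rw [← Set.image_prod]
        exact Set.ncard_image_le (S.finite_toSet.prod (finite_verts F))
    _ = S.card * (L.verts F).ncard := by rw [Set.ncard_prod, Set.ncard_coe_finset]
    _ ≤ 4 * M * N * (L.verts F).ncard := Nat.mul_le_mul_right _ hScard
    _ = _ := by ring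

end PlanarLattice

namespace PlanarLattice

variable {L : PlanarLattice} {p q : ℝ}

/-! ### The density of open edges and the normalizing constants -/

/-- The indicator function of the event that an edge is open. -/
noncomputable def edgeIndicator (e : L.Edge) : L.Config → ℝ :=
  ({ω | ω e = true} : Set L.Config).indicator 1

theorem isUpperSet_edge_open (e : L.Edge) : IsUpperSet {ω : L.Config | ω e = true} :=
  fun _ _ h hω => Bool.eq_true_of_true_le (by rw [← show _ = true from hω]; exact h e)

theorem monotone_edgeIndicator (e : L.Edge) : Monotone (edgeIndicator e) :=
  (isUpperSet_edge_open e).monotone_indicator_one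

theorem sum_edgeIndicator_extend (E : Finset L.Edge) (η : E → Bool) :
    ∑ e ∈ E, edgeIndicator e (extend E η) = numOpen E η := by
  classical
  rw [← Finset.sum_coe_sort E, numOpen, Finset.card_filter]
  push_cast
  refine Finset.sum_congr rfl fun e _ => ?_
  rw [edgeIndicator, indicator_apply]
  simp only [mem_ofPred_eq, extend_apply_mem _ e.2, Pi.one_apply]

theorem hasDerivAt_fvWeight {s : ℝ} (hs : s ∈ Ioo (0 : ℝ) 1) (q : ℝ) (E : Finset L.Edge)
    (ξ : L.BoundaryCondition E) (η : E → Bool) :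
    HasDerivAt (fun t => fvWeight t q E ξ η)
      (fvWeight s q E ξ η * ((numOpen E η - s * E.card) / (s * (1 - s)))) s := by
  have h0 : s ≠ 0 := hs.1.ne'
  have h1 : 1 - s ≠ 0 := (sub_pos.2 hs.2).ne'
  have hpow : ∀ (r : ℝ) (n : ℕ), r ≠ 0 → (n : ℝ) * r ^ (n - 1) = n / r * r ^ n := by
    intro r n hr
    cases n with
    | zero => simp
    | succ n => rw [Nat.add_sub_cancel, pow_succ]; field_simp
  have hd := ((hasDerivAt_pow (numOpen E η) s).mul
    (((hasDerivAt_id s).const_sub 1).pow (numClosed E η))).mul_const (q ^ numClusters E ξ η)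
  refine hd.congr_deriv ?_
  have hc : (E.card : ℝ) = numOpen E η + numClosed E η := by
    rw [← numOpen_add_numClosed η]; push_cast; rfl
  simp only [id_eq, Pi.pow_apply]
  rw [hpow s _ h0, hpow (1 - s) _ h1, hc, fvWeight]
  field_simp
  ring

/-- Only the edge factors depend on the edge-weight, so the logarithmic derivative is an affine
function of the mean number of open edges. Its additive term is the same for all boundary conditions
and cancels in differences. -/
theorem hasDerivAt_log_partitionFunction {s : ℝ} (hs : s ∈ Ioo (0 : ℝ) 1) (hq : 1 ≤ q)
    (E : Finset L.Edge) (ξ : L.BoundaryCondition E) :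
    HasDerivAt (fun t => Real.log (partitionFunction t q E ξ))
      ((∑ e ∈ E, fvMean s q E ξ (edgeIndicator e) - s * E.card) / (s * (1 - s))) s := by
  have hZ := partitionFunction_pos hs hq E ξ
  have hd : HasDerivAt (fun t => partitionFunction t q E ξ)
      (∑ η, fvWeight s q E ξ η * ((numOpen E η - s * E.card) / (s * (1 - s)))) s :=
    HasDerivAt.fun_sum fun η _ => hasDerivAt_fvWeight hs q E ξ η
  refine (hd.log hZ.ne').congr_deriv ?_
  rw [← fvMean_sum]
  have h1 : fvMean s q E ξ (fun ω => ∑ e ∈ E, edgeIndicator e ω) =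
      (∑ η, fvWeight s q E ξ η * numOpen E η) / partitionFunction s q E ξ := by
    unfold fvMean
    rw [Finset.sum_div]
    refine Finset.sum_congr rfl fun η _ => ?_
    rw [fvProb_eq]
    beta_reduce
    rw [sum_edgeIndicator_extend]
    ring
  have h2 : ∑ η, fvWeight s q E ξ η * ((numOpen E η - s * E.card) / (s * (1 - s))) =
      ((∑ η, fvWeight s q E ξ η * numOpen E η) - s * E.card * partitionFunction s q E ξ) /
        (s * (1 - s)) := by
    rw [partitionFunction, Finset.mul_sum, ← Finset.sum_sub_distrib, Finset.sum_div]
    exact Finset.sum_congr rfl fun η _ => by ring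
  rw [h1, h2]
  field_simp

theorem partitionFunction_anti {s : ℝ} (hs : s ∈ Ioo (0 : ℝ) 1) (hq : 1 ≤ q)
    {E : Finset L.Edge} {ξ ξ' : L.BoundaryCondition E} (h : ξ ≤ ξ') :
    partitionFunction s q E ξ' ≤ partitionFunction s q E ξ :=
  Finset.sum_le_sum fun η _ => fvWeight_anti hs hq h η

theorem partitionFunction_bot_le {s : ℝ} (hs : s ∈ Ioo (0 : ℝ) 1) (hq : 1 ≤ q)
    (E : Finset L.Edge) : partitionFunction s q E ⊥ ≤
      q ^ (boundary E).ncard * partitionFunction s q E (wired E) := by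
  unfold partitionFunction
  rw [Finset.mul_sum]
  exact Finset.sum_le_sum fun η _ => fvWeight_bot_le hs hq (fun x y h => h) η

/-- Between any two edge-weights there is one at which the wired and the free measures have nearly
the same density of open edges. -/
theorem exists_sum_fvMean_wired_sub_le {p' : ℝ} (hp : p ∈ Ioo (0 : ℝ) 1) (hp' : p' ∈ Ioo (0 : ℝ) 1)
    (hpp : p < p') (hq : 1 ≤ q) (E : Finset L.Edge) : ∃ s ∈ Ioo p p',
      ∑ e ∈ E, (fvMean s q E (wired E) (edgeIndicator e) - fvMean s q E ⊥ (edgeIndicator e)) ≤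
        (boundary E).ncard * Real.log q / (p' - p) := by
  have hsub : ∀ s ∈ Icc p p', s ∈ Ioo (0 : ℝ) 1 :=
    fun s hs => ⟨hp.1.trans_le hs.1, hs.2.trans_lt hp'.2⟩
  -- Wiring lowers each weight by at most `q ^ |∂E|`, so `h` takes values in `[-|∂E| log q, 0]`. Its
  -- mean slope is at most the range divided by `p' - p`, and `s (1 - s) ≤ 1` removes the remaining
  -- factor.
  set h : ℝ → ℝ := fun t => Real.log (partitionFunction t q E (wired E)) -
    Real.log (partitionFunction t q E ⊥) with hh
  have hderiv : ∀ s ∈ Icc p p', HasDerivAt h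
      ((∑ e ∈ E, (fvMean s q E (wired E) (edgeIndicator e) - fvMean s q E ⊥ (edgeIndicator e))) /
        (s * (1 - s))) s := by
    intro s hs
    refine ((hasDerivAt_log_partitionFunction (hsub s hs) hq E (wired E)).sub
      (hasDerivAt_log_partitionFunction (hsub s hs) hq E ⊥)).congr_deriv ?_
    rw [Finset.sum_sub_distrib]
    ring
  obtain ⟨s, hs, hmv⟩ := exists_hasDerivAt_eq_slope h _ hpp
    (fun s hs => (hderiv s hs).continuousAt.continuousWithinAt)
    fun s hs => hderiv s (Ioo_subset_Icc_self hs)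
  refine ⟨s, hs, ?_⟩
  have hs1 := hsub s (Ioo_subset_Icc_self hs)
  have hup : h p' ≤ 0 := by
    rw [hh]
    exact sub_nonpos.2 (Real.log_le_log (partitionFunction_pos hp' hq E _)
      (partitionFunction_anti hp' hq bot_le))
  have hlow : -((boundary E).ncard * Real.log q) ≤ h p := by
    have := Real.log_le_log (partitionFunction_pos hp hq E ⊥) (partitionFunction_bot_le hp hq E)
    rw [Real.log_mul (by positivity) (partitionFunction_pos hp hq E _).ne', Real.log_pow] at this
    rw [hh]
    dsimp only
    linarith
  have hpos : 0 < s * (1 - s) := mul_pos hs1.1 (sub_pos.2 hs1.2)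
  have hle1 : s * (1 - s) ≤ 1 := by nlinarith [hs1.1, hs1.2]
  rw [div_eq_iff hpos.ne'] at hmv
  rw [hmv]
  have hB : 0 ≤ (boundary E).ncard * Real.log q / (p' - p) := by
    have := Real.log_nonneg hq
    have := sub_pos.2 hpp
    positivity
  have h3 : (h p' - h p) / (p' - p) ≤ (boundary E).ncard * Real.log q / (p' - p) :=
    div_le_div_of_nonneg_right (by linarith) (sub_pos.2 hpp).le
  exact (mul_le_mul_of_nonneg_right h3 hpos.le).trans (mul_le_of_le_one_right hB hle1)

/-- The effect of the boundary condition on an local event is at most the sum of its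
effects on the edges. -/
theorem fvMean_indicator_sub_le (hp : p ∈ Ioo (0 : ℝ) 1) (hq : 1 ≤ q) {E F : Finset L.Edge}
    {ξ ξ' : L.BoundaryCondition E} (h : ξ ≤ ξ') {A : Set L.Config} (hA : IsLocal F A) :
    fvMean p q E ξ' (A.indicator 1) - fvMean p q E ξ (A.indicator 1) ≤
      ∑ e ∈ F, (fvMean p q E ξ' (edgeIndicator e) - fvMean p q E ξ (edgeIndicator e)) := by
  classical
  -- An increase on `F` raises the number of open edges there by at least one, while the indicator
  -- changes by at most one. So this difference is increasing even if `A` is not.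
  have hmono : Monotone ((fun ω : L.Config => ∑ e ∈ F, edgeIndicator e ω) - A.indicator 1) := by
    intro ω ω' hω
    have hsum : ∀ e ∈ F, edgeIndicator e ω ≤ edgeIndicator e ω' :=
      fun e _ => monotone_edgeIndicator e hω
    rw [Pi.sub_apply, Pi.sub_apply]
    by_cases hag : ∀ e ∈ F, ω e = ω' e
    · have h1 : ω ∈ A ↔ ω' ∈ A := ⟨hA _ _ hag, hA _ _ fun e he => (hag e he).symm⟩
      have h2 : A.indicator (1 : L.Config → ℝ) ω = A.indicator 1 ω' := by
        simp only [indicator_apply, h1, Pi.one_apply]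
      rw [h2]
      exact sub_le_sub_right (Finset.sum_le_sum hsum) _
    · push Not at hag
      obtain ⟨e, he, hne⟩ := hag
      have ho : ω e = false ∧ ω' e = true := by
        have := hω e
        revert hne this
        cases ω e <;> cases ω' e <;> simp
      have hsum' : ∑ f ∈ F, edgeIndicator f ω + 1 ≤ ∑ f ∈ F, edgeIndicator f ω' := by
        rw [← Finset.add_sum_erase F _ he,
          ← Finset.add_sum_erase F (fun f => edgeIndicator f ω') he]
        have h1 : edgeIndicator e ω = 0 := indicator_of_notMem (by simp [ho.1]) _
        have h2 : edgeIndicator e ω' = 1 := indicator_of_mem (by simp [ho.2]) _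
        have h3 : ∑ f ∈ F.erase e, edgeIndicator f ω ≤ ∑ f ∈ F.erase e, edgeIndicator f ω' :=
          Finset.sum_le_sum fun f hf => hsum f (Finset.mem_of_mem_erase hf)
        rw [h1, h2]
        linarith
      have h4 : (0 : ℝ) ≤ A.indicator 1 ω := indicator_nonneg (fun _ _ => zero_le_one) _
      have h5 : A.indicator (1 : L.Config → ℝ) ω' ≤ 1 :=
        indicator_le_self' (fun _ _ => zero_le_one) _
      linarith
  have key := fvMean_mono hp hp le_rfl hq h hmono
  rw [fvMean_sub, fvMean_sub, fvMean_sum, fvMean_sum] at key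
  rw [Finset.sum_sub_distrib]
  linarith

theorem shift_symm_shift (σ : L.graph ≃g L.graph) (E : Finset L.Edge) :
    shift σ (shift σ.symm E) = E := by
  ext e
  obtain ⟨f, rfl⟩ := σ.mapEdgeSet.surjective e
  rw [mapEdgeSet_mem_shift, mem_shift]
  constructor
  · rintro ⟨g, hg, rfl⟩
    have : σ.mapEdgeSet (σ.symm.mapEdgeSet g) = g := σ.mapEdgeSet.apply_symm_apply g
    rwa [this]
  · intro h
    exact ⟨_, h, σ.mapEdgeSet.symm_apply_apply f⟩

theorem monotone_indicator_comp_pull {A : Set L.Config} (σ : L.graph ≃g L.graph) :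
    A.indicator (1 : L.Config → ℝ) ∘ pull σ = (pull σ ⁻¹' A).indicator 1 := rfl

/-- Free measures at a larger edge-weight dominate, on average over translations, all infinite-volume
measures. -/
theorem le_real_of_isFreeMeasure {p' : ℝ} (hp : p ∈ Ioo (0 : ℝ) 1) (hp' : p' ∈ Ioo (0 : ℝ) 1)
    (hpp : p < p') (hq : 1 ≤ q) {φ φ' : Measure L.Config} (hφ : IsRandomClusterMeasure p q φ)
    (hφ' : IsFreeMeasure p' q φ') {u v : ℂ} (h : LinearIndependent ℝ ![u, v])
    (hu : L.IsPeriod u) (hv : L.IsPeriod v) {F₀ : Finset L.Edge} {A : Set L.Config}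
    (hA : IsLocal F₀ A) (hup : IsUpperSet A) {c : ℝ}
    (hc : ∀ m n : ℤ, c ≤ φ.real (pull (hu.lattice hv m n).iso ⁻¹' A)) : c ≤ φ'.real A := by
  classical
  obtain ⟨F, hF, C, hC⟩ := exists_box_boundary_le h hu hv F₀
  set K : ℝ := F₀.card * (C * Real.log q / (p' - p)) with hK
  obtain ⟨a, b, hab, hau, hav, hbu, hbv⟩ := exists_coordinates h
  have hinj : ∀ m n m' n' : ℕ, (m : ℤ) • u + (n : ℤ) • v = (m' : ℤ) • u + (n' : ℤ) • v →
      m = m' ∧ n = n' := by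
    intro m n m' n' heq
    have h1 := congrArg a heq
    have h2 := congrArg b heq
    simp only [← Int.cast_smul_eq_zsmul ℝ, map_add, map_smul, hau, hav, hbu, hbv, smul_eq_mul,
      mul_zero, add_zero, zero_add, mul_one, Int.cast_natCast] at h1 h2
    exact ⟨by exact_mod_cast h1, by exact_mod_cast h2⟩
  -- There are `N²` translates, while the total defect in the box has order of its boundary, `N`.
  -- The intermediate weight `s` depends on `N`, but neither side of the bound does.
  have key : ∀ N : ℕ, 0 < N → c - φ'.real A ≤ K / N := by
    intro N hN
    set E := box hu hv F N with hE
    obtain ⟨s, hs, hsum⟩ := exists_sum_fvMean_wired_sub_le hp hp' hpp hq E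
    have hs1 : s ∈ Ioo (0 : ℝ) 1 := ⟨hp.1.trans hs.1, hs.2.trans hp'.2⟩
    set d : L.Edge → ℝ := fun e =>
      fvMean s q E (wired E) (edgeIndicator e) - fvMean s q E ⊥ (edgeIndicator e) with hd
    have hd0 : ∀ e, 0 ≤ d e := fun e =>
      sub_nonneg.2 (fvMean_mono hs1 hs1 le_rfl hq bot_le (monotone_edgeIndicator e))
    set τ : ℕ × ℕ → (L.graph ≃g L.graph) :=
      fun m => (hu.lattice hv (m.1 : ℤ) (m.2 : ℤ)).iso with hτ
    set R := Finset.range N ×ˢ Finset.range N with hR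
    have hmem : ∀ m ∈ R, ∀ f ∈ F₀, (τ m).mapEdgeSet f ∈ E := by
      intro m hm f hf
      rw [hR, Finset.mem_product, Finset.mem_range, Finset.mem_range] at hm
      exact mem_box.2 ⟨m.1, hm.1, m.2, hm.2, mapEdgeSet_mem_shift.2 (hF hf)⟩
    have hone : ∀ m ∈ R, c - φ'.real A ≤ ∑ f ∈ F₀, d ((τ m).mapEdgeSet f) := by
      intro m hm
      have hloc := hA.preimage_pull (τ m)
      have hup' : IsUpperSet (pull (τ m) ⁻¹' A) := fun ω ω' hω => hup (pull_mono _ hω)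
      have hsubE : shift (τ m) F₀ ⊆ E := by
        intro e he
        obtain ⟨f, hf, rfl⟩ := mem_shift.1 he
        exact hmem m hm f hf
      have h1 := fvMean_indicator_sub_le hs1 hq (bot_le : ⊥ ≤ wired E) hloc
      have h2 : ∑ e ∈ shift (τ m) F₀, d e = ∑ f ∈ F₀, d ((τ m).mapEdgeSet f) := by
        rw [shift, Finset.sum_map]; rfl
      -- `φ` is dominated by the wired measure at `p`, and this by the wired measure at `s > p`.
      have h3 : c ≤ fvMean s q E (wired E) ((pull (τ m) ⁻¹' A).indicator 1) :=
        (hc m.1 m.2).trans ((hφ.real_le_fvMean_wired hp hq (hloc.mono hsubE) hup').trans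
          (fvMean_mono hp hs1 hs.1.le hq le_rfl hup'.monotone_indicator_one))
      -- The free measure at `s` is dominated by the one at `p'`. Translating the box back turns the
      -- event into `A`, and the free measures increase with the volume.
      have h4 : fvMean s q E ⊥ ((pull (τ m) ⁻¹' A).indicator 1) ≤ φ'.real A := by
        refine (fvMean_mono hs1 hp' hs.2.le hq le_rfl hup'.monotone_indicator_one).trans ?_
        rw [← monotone_indicator_comp_pull, ← shift_symm_shift (τ m) E, fvMean_shift]
        exact hφ'.fvMean_le hp' hq hA hup _
      rw [← h2]
      linarith
    -- For fixed `f` the translates are distinct edges of the box, and all defects are nonnegative.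
    have htot : ∑ m ∈ R, ∑ f ∈ F₀, d ((τ m).mapEdgeSet f) ≤ F₀.card * ∑ e ∈ E, d e := by
      rw [Finset.sum_comm, ← nsmul_eq_mul]
      refine Finset.sum_le_card_nsmul _ _ _ fun f hf => ?_
      have hinj' : Set.InjOn (fun m => (τ m).mapEdgeSet f) R := by
        intro m _ m' _ heq
        have := IsPeriod.mapEdgeSet_inj _ _ heq
        exact Prod.ext (hinj _ _ _ _ this).1 (hinj _ _ _ _ this).2
      rw [← Finset.sum_image (g := fun m => (τ m).mapEdgeSet f) (f := d) hinj']
      refine Finset.sum_le_sum_of_subset_of_nonneg ?_ fun e _ _ => hd0 e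
      intro e he
      obtain ⟨m, hm, rfl⟩ := Finset.mem_image.1 he
      exact hmem m hm f hf
    have hlow : (N : ℝ) * N * (c - φ'.real A) ≤
        ∑ m ∈ R, ∑ f ∈ F₀, d ((τ m).mapEdgeSet f) := by
      have := Finset.card_nsmul_le_sum R _ _ hone
      rw [nsmul_eq_mul, hR, Finset.card_product, Finset.card_range] at this
      push_cast at this
      exact this
    have hup2 : ∑ e ∈ E, d e ≤ C * N * Real.log q / (p' - p) := by
      refine hsum.trans (div_le_div_of_nonneg_right ?_ (sub_pos.2 hpp).le)
      refine mul_le_mul_of_nonneg_right ?_ (Real.log_nonneg hq)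
      exact_mod_cast hC N
    have hN' : (0 : ℝ) < N := by exact_mod_cast hN
    rw [le_div_iff₀ hN']
    have h5 : (N : ℝ) * N * (c - φ'.real A) ≤ N * K := by
      refine (hlow.trans htot).trans ((mul_le_mul_of_nonneg_left hup2 (Nat.cast_nonneg _)).trans
        (le_of_eq ?_))
      rw [hK]
      ring
    have h6 : (N : ℝ) * ((c - φ'.real A) * N) ≤ N * K := by linarith
    exact le_of_mul_le_mul_left h6 hN'
  have hlim : Tendsto (fun N : ℕ => K / (N : ℝ)) atTop (𝓝 0) :=
    tendsto_const_div_atTop_nhds_zero_nat K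
  have := ge_of_tendsto hlim (by filter_upwards [eventually_gt_atTop 0] with N hN using key N hN)
  linarith

/-! ### Escaping from finite sets -/

/-- The event that the origin is connected to a vertex outside the finite set `s`. -/
def escape (L : PlanarLattice) (s : Finset L.V) : Set L.Config :=
  {ω | ∃ y, y ∉ s ∧ (L.subgraphOf {e | ω e = true}).Reachable L.origin y}

theorem isUpperSet_escape (s : Finset L.V) : IsUpperSet (L.escape s) := by
  rintro ω ω' h ⟨y, hy, hr⟩
  exact ⟨y, hy, hr.mono (subgraphOf_mono fun e he =>
    Bool.eq_true_of_true_le (by rw [← show ω e = true from he]; exact h e))⟩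

/-- Up to its first exit from `s`, a path uses only edges with an end-point in `s`, of which there
are finitely many. -/
theorem isLocal_escape {s : Finset L.V} (hs : L.origin ∈ s) :
    ∃ F : Finset L.Edge, IsLocal F (L.escape s) := by
  refine ⟨(finite_edges_of_finite s.finite_toSet).toFinset, ?_⟩
  rintro ω ω' h ⟨y, hy, ⟨w⟩⟩
  have key : ∀ (x y : L.V) (w : (L.subgraphOf {e | ω e = true}).Walk x y), x ∈ s → y ∉ s →
      ∃ z, z ∉ s ∧ (L.subgraphOf {e | ω' e = true}).Reachable x z := by
    intro x y w
    induction w with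
    | nil => intro h1 h2; exact absurd h1 h2
    | @cons x z y hadj _ ih =>
      intro h1 h2
      obtain ⟨e, he, hxz⟩ := subgraphOf_adj.1 hadj
      have heF : ω e = ω' e := h e ((Set.Finite.mem_toFinset _).2
        ⟨x, h1, hxz ▸ Sym2.mem_mk_left _ _⟩)
      have hadj' : (L.subgraphOf {e | ω' e = true}).Adj x z :=
        subgraphOf_adj.2 ⟨e, heF.symm.trans he, hxz⟩
      by_cases hz : z ∈ s
      · obtain ⟨t, ht, hr⟩ := ih hz h2
        exact ⟨t, ht, hadj'.reachable.trans hr⟩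
      · exact ⟨z, hz, hadj'.reachable⟩
  exact key _ _ w hs hy

/-- This writes an infinite cluster as a directed intersection of local increasing events, to which
finite-volume comparisons apply. -/
theorem connectedToInfinity_iff (ω : L.Config) :
    ConnectedToInfinity ω L.origin ↔ ∀ s : Finset L.V, ω ∈ L.escape (insert L.origin s) := by
  constructor
  · intro h s
    obtain ⟨y, hy, hys⟩ := h.exists_notMem_finset (insert L.origin s)
    exact ⟨y, hys, hy⟩
  · intro h hfin
    obtain ⟨y, hy, hr⟩ := h hfin.toFinset
    exact hy (Finset.mem_insert_of_mem (hfin.mem_toFinset.2 hr))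

theorem mem_escape_of_connectedToInfinity (σ : L.graph ≃g L.graph) {ω : L.Config}
    (h : ConnectedToInfinity ω (σ L.origin)) (s : Finset L.V) : pull σ ω ∈ L.escape s := by
  obtain ⟨y, hy, hys⟩ := h.exists_notMem_finset (s.map σ.toEquiv.toEmbedding)
  obtain ⟨z, rfl⟩ := σ.surjective y
  exact ⟨z, fun hz => hys (Finset.mem_map_of_mem _ hz), (reachable_pull_iff σ).2 hy⟩

/-- If, under some infinite-volume measure, the translates of the origin are in an infinite cluster
with probability bounded below, then the edge-weight is at least the critical point. -/
theorem criticalPoint_le_of_connectedToInfinity (hp : p ∈ Ioo (0 : ℝ) 1) (hq : 1 ≤ q)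
    {φ : Measure L.Config} (hφ : IsRandomClusterMeasure p q φ) {u v : ℂ}
    (h : LinearIndependent ℝ ![u, v]) (hu : L.IsPeriod u) (hv : L.IsPeriod v) {c : ℝ} (hc0 : 0 < c)
    (hc : ∀ m n : ℤ, c ≤ φ.real
      {ω | ConnectedToInfinity ω ((hu.lattice hv m n).iso L.origin)}) :
    L.criticalPoint q ≤ p := by
  classical
  have := hφ.isProbabilityMeasure
  -- It suffices that every `p' > p` bounds `p_c` from above; for `p' < 1` its free measure is shown
  -- to percolate with probability at least `c`.
  refine le_of_forall_gt_imp_ge_of_dense fun p' hpp => ?_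
  have hbdd : BddBelow (insert 1 {p : ℝ | p ∈ Ioo (0 : ℝ) 1 ∧ ∃ φ : Measure L.Config,
      IsFreeMeasure p q φ ∧ 0 < φ {ω | ConnectedToInfinity ω L.origin}}) := by
    refine ⟨0, ?_⟩
    rintro x (rfl | hx)
    · exact zero_le_one
    · exact hx.1.1.le
  rcases le_or_gt 1 p' with h1 | h1
  · exact (csInf_le hbdd (mem_insert _ _)).trans h1
  have hp' : p' ∈ Ioo (0 : ℝ) 1 := ⟨hp.1.trans hpp, h1⟩
  refine csInf_le hbdd (mem_insert_of_mem _ ⟨hp', ?_⟩)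
  obtain ⟨φ', hφ'⟩ := exists_isFreeMeasure (L := L) hp' hq
  have := hφ'.isProbabilityMeasure
  refine ⟨φ', hφ', ?_⟩
  have hesc : ∀ s : Finset L.V, L.origin ∈ s → c ≤ φ'.real (L.escape s) := by
    intro s hs
    obtain ⟨F, hF⟩ := isLocal_escape hs
    refine le_real_of_isFreeMeasure hp hp' hpp hq hφ hφ' h hu hv hF (isUpperSet_escape s)
      fun m n => (hc m n).trans (measureReal_mono fun ω hω => ?_)
    exact mem_escape_of_connectedToInfinity _ hω s
  have hset : {ω : L.Config | ConnectedToInfinity ω L.origin} =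
      ⋂ s : Finset L.V, L.escape (insert L.origin s) := by
    ext ω
    rw [mem_iInter]
    exact connectedToInfinity_iff ω
  have hanti : ∀ s t : Finset L.V, s ⊆ t → L.escape (insert L.origin t) ⊆
      L.escape (insert L.origin s) := by
    rintro s t hst ω ⟨y, hy, hr⟩
    exact ⟨y, fun hy' => hy (Finset.insert_subset_insert _ hst hy'), hr⟩
  have hlow : ENNReal.ofReal c ≤ φ' {ω | ConnectedToInfinity ω L.origin} := by
    rw [hset, Directed.measure_iInter]
    · refine le_iInf fun s => ?_
      rw [← ofReal_measureReal (μ := φ')]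
      exact ENNReal.ofReal_le_ofReal (hesc _ (Finset.mem_insert_self _ _))
    · intro s
      obtain ⟨F, hF⟩ := isLocal_escape (Finset.mem_insert_self L.origin s)
      exact hF.measurableSet.nullMeasurableSet
    · exact fun s t => ⟨s ∪ t, hanti _ _ Finset.subset_union_left,
        hanti _ _ Finset.subset_union_right⟩
    · exact ⟨∅, measure_ne_top _ _⟩
  exact (ENNReal.ofReal_pos.2 hc0).trans_le hlow

end PlanarLattice

/-! ### Plane topology -/

/-- A real function that is integer-valued on the intersection of two closed sets covering the plane
is, up to integers, the restriction of a function that is integer-valued on the second set. -/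
theorem exists_continuous_integer_gluing {X₁ X₂ : Set ℂ} (h₁ : IsClosed X₁) (h₂ : IsClosed X₂)
    (hX : X₁ ∪ X₂ = univ) {H : ℂ → ℝ} (hH : Continuous H)
    (hint : ∀ z ∈ X₁ ∩ X₂, ∃ k : ℤ, H z = k) :
    ∃ G : ℂ → ℝ, Continuous G ∧ (∀ z ∈ X₁, ∃ k : ℤ, G z - H z = k) ∧
      ∀ z ∈ X₂, ∃ k : ℤ, G z = k := by
  classical
  have hcoe : ∀ x : ℝ, (x : AddCircle (1 : ℝ)) = 0 ↔ ∃ k : ℤ, x = k := by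
    intro x
    rw [AddCircle.coe_eq_zero_iff]
    simp [eq_comm]
  -- Modulo integers, `H` on `X₁` and `0` on `X₂` agree on the overlap, so they form one continuous
  -- map to the circle. It lifts to the line since the plane is simply connected.
  set g : ℂ → AddCircle (1 : ℝ) := fun z => if z ∈ X₁ then (H z : AddCircle (1 : ℝ)) else 0 with hg
  have hg1 : ∀ z ∈ X₁, g z = (H z : AddCircle (1 : ℝ)) := fun z hz => if_pos hz
  have hg2 : ∀ z ∈ X₂, g z = 0 := by
    intro z hz
    by_cases hz1 : z ∈ X₁
    · rw [hg1 z hz1, hcoe]; exact hint z ⟨hz1, hz⟩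
    · exact if_neg hz1
  have hgc : Continuous g := by
    rw [← continuousOn_univ, ← hX]
    refine ContinuousOn.union_of_isClosed ?_ ?_ h₁ h₂
    · exact (((AddCircle.continuous_mk' 1).comp hH).continuousOn).congr hg1
    · exact continuousOn_const.congr hg2
  obtain ⟨e₀, he₀⟩ := QuotientAddGroup.mk_surjective (g 0)
  obtain ⟨G, ⟨-, hG⟩, -⟩ := (AddCircle.isCoveringMap_coe (1 : ℝ)).existsUnique_continuousMap_lifts
    ⟨g, hgc⟩ 0 e₀ he₀
  have hG' : ∀ z, ((G z : ℝ) : AddCircle (1 : ℝ)) = g z := fun z => congrFun hG z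
  refine ⟨G, G.continuous, fun z hz => ?_, fun z hz => ?_⟩
  · rw [← hcoe, AddCircle.coe_sub, hG', hg1 z hz, sub_self]
  · rw [← hcoe, hG', hg2 z hz]

theorem Continuous.mem_Ioo_of_ne {f : ℝ → ℝ} (hf : Continuous f) {a b t₀ : ℝ}
    (h₀ : f t₀ ∈ Ioo a b) (hne : ∀ t, f t ≠ a ∧ f t ≠ b) (t : ℝ) : f t ∈ Ioo a b := by
  constructor
  · by_contra hc
    obtain ⟨s, hs⟩ := mem_range_of_exists_le_of_exists_ge hf ⟨t, not_lt.1 hc⟩ ⟨t₀, h₀.1.le⟩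
    exact (hne s).1 hs
  · by_contra hc
    obtain ⟨s, hs⟩ := mem_range_of_exists_le_of_exists_ge hf ⟨t₀, h₀.2.le⟩ ⟨t, not_lt.1 hc⟩
    exact (hne s).2 hs

/-- A nonvanishing map of the square cannot turn around the origin along the boundary. -/
theorem false_of_boundary_winding {f : ℝ × ℝ → ℂ} (hf : Continuous f) (hf0 : ∀ z, f z ≠ 0)
    (h1 : ∀ t, 0 < (f (0, t)).im) (h2 : ∀ s, (f (s, 1)).re < 0) (h3 : ∀ t, (f (1, t)).im < 0)
    (h4 : ∀ s, 0 < (f (s, 0)).re) : False := by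
  have hc : Continuous fun z => (Complex.arg (f z) : Real.Angle) :=
    continuous_iff_continuousAt.2 fun z =>
      (Complex.continuousAt_arg_coe_angle (hf0 z)).comp hf.continuousAt
  -- `Θ` is a continuous argument of `f`. Signs of the sine and cosine confine it to a half-turn on
  -- each side of the square. Passing from side to side adds a full turn by the return to `(0, 0)`.
  obtain ⟨Θ, ⟨hΘ0, hΘ⟩, -⟩ :=
    (AddCircle.isCoveringMap_coe (2 * Real.pi)).existsUnique_continuousMap_lifts
      (A := ℝ × ℝ) ⟨_, hc⟩ (0, 0) (Complex.arg (f (0, 0))) rfl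
  have hΘ' : ∀ z, ((Θ z : ℝ) : Real.Angle) = (Complex.arg (f z) : Real.Angle) :=
    fun z => congrFun hΘ z
  have hcos : ∀ z, Real.cos (Θ z) = (f z).re / ‖f z‖ := by
    intro z
    rw [← Complex.cos_arg (hf0 z), ← Real.Angle.cos_coe, hΘ', Real.Angle.cos_coe]
  have hsin : ∀ z, Real.sin (Θ z) = (f z).im / ‖f z‖ := by
    intro z
    rw [← Complex.sin_arg, ← Real.Angle.sin_coe, hΘ', Real.Angle.sin_coe]
  have hn : ∀ z, 0 < ‖f z‖ := fun z => norm_pos_iff.2 (hf0 z)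
  have s1 : ∀ t, 0 < Real.sin (Θ (0, t)) := fun t => by rw [hsin]; exact div_pos (h1 t) (hn _)
  have s3 : ∀ t, Real.sin (Θ (1, t)) < 0 := fun t => by
    rw [hsin]; exact div_neg_of_neg_of_pos (h3 t) (hn _)
  have c2 : ∀ s, Real.cos (Θ (s, 1)) < 0 := fun t => by
    rw [hcos]; exact div_neg_of_neg_of_pos (h2 t) (hn _)
  have c4 : ∀ s, 0 < Real.cos (Θ (s, 0)) := fun t => by rw [hcos]; exact div_pos (h4 t) (hn _)
  have hπ := Real.pi_pos
  have hcos32 : Real.cos (3 * Real.pi / 2) = 0 := by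
    rw [show 3 * Real.pi / 2 = Real.pi / 2 + Real.pi by ring, Real.cos_add_pi, Real.cos_pi_div_two,
      neg_zero]
  have hcos52 : Real.cos (5 * Real.pi / 2) = 0 := by
    rw [show 5 * Real.pi / 2 = Real.pi / 2 + 2 * Real.pi by ring, Real.cos_add_two_pi,
      Real.cos_pi_div_two]
  have a00 : Θ (0, 0) ∈ Ioo 0 (Real.pi / 2) := by
    have harg := Complex.abs_arg_lt_pi_div_two_iff.2 (Or.inl (h4 0))
    rw [abs_lt] at harg
    have h0 : 0 ≤ Complex.arg (f (0, 0)) := Complex.arg_nonneg_iff.2 (h1 0).le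
    rw [hΘ0]
    refine ⟨lt_of_le_of_ne h0 fun h => ?_, harg.2⟩
    have := s1 0
    rw [hΘ0, ← h, Real.sin_zero] at this
    exact lt_irrefl _ this
  have a0 : ∀ t, Θ (0, t) ∈ Ioo 0 Real.pi := by
    refine Continuous.mem_Ioo_of_ne (f := fun t => Θ (0, t)) (by fun_prop) (t₀ := 0)
      ⟨a00.1, by linarith [a00.2]⟩ fun t => ⟨fun h => ?_, fun h => ?_⟩
    · have := s1 t; rw [h, Real.sin_zero] at this; exact lt_irrefl _ this
    · have := s1 t; rw [h, Real.sin_pi] at this; exact lt_irrefl _ this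
  have a01 : Real.pi / 2 < Θ (0, 1) := by
    by_contra hc
    have := Real.cos_nonneg_of_neg_pi_div_two_le_of_le (by linarith [(a0 1).1]) (not_lt.1 hc)
    linarith [c2 0]
  have a1 : ∀ s, Θ (s, 1) ∈ Ioo (Real.pi / 2) (3 * Real.pi / 2) := by
    refine Continuous.mem_Ioo_of_ne (f := fun s => Θ (s, 1)) (by fun_prop) (t₀ := 0)
      ⟨a01, by linarith [(a0 1).2]⟩ fun t => ⟨fun h => ?_, fun h => ?_⟩
    · have := c2 t; rw [h, Real.cos_pi_div_two] at this; exact lt_irrefl _ this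
    · have := c2 t; rw [h, hcos32] at this; exact lt_irrefl _ this
  have a11 : Real.pi < Θ (1, 1) := by
    by_contra hc
    have := Real.sin_nonneg_of_nonneg_of_le_pi (by linarith [(a1 1).1]) (not_lt.1 hc)
    linarith [s3 1]
  have a2 : ∀ t, Θ (1, t) ∈ Ioo Real.pi (2 * Real.pi) := by
    refine Continuous.mem_Ioo_of_ne (f := fun t => Θ (1, t)) (by fun_prop) (t₀ := 1)
      ⟨a11, by linarith [(a1 1).2]⟩ fun t => ⟨fun h => ?_, fun h => ?_⟩
    · have := s3 t; rw [h, Real.sin_pi] at this; exact lt_irrefl _ this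
    · have := s3 t; rw [h, Real.sin_two_pi] at this; exact lt_irrefl _ this
  have a10 : 3 * Real.pi / 2 < Θ (1, 0) := by
    by_contra hc
    have := Real.cos_nonpos_of_pi_div_two_le_of_le (x := Θ (1, 0)) (by linarith [(a2 0).1])
      (by linarith [not_lt.1 hc])
    linarith [c4 1]
  have a3 : ∀ s, Θ (s, 0) ∈ Ioo (3 * Real.pi / 2) (5 * Real.pi / 2) := by
    refine Continuous.mem_Ioo_of_ne (f := fun s => Θ (s, 0)) (by fun_prop) (t₀ := 1)
      ⟨a10, by linarith [(a2 0).2]⟩ fun t => ⟨fun h => ?_, fun h => ?_⟩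
    · have := c4 t; rw [h, hcos32] at this; exact lt_irrefl _ this
    · have := c4 t; rw [h, hcos52] at this; exact lt_irrefl _ this
  linarith [(a3 0).1, a00.2]

/-- Two paths joining opposite sides of a parallelogram meet. -/
theorem not_disjoint_of_crossing {a b : ℂ →L[ℝ] ℝ} (hab : ∀ z, a z = 0 → b z = 0 → z = 0)
    {A B : Set ℂ} {z w z' w' : ℂ} (hA : JoinedIn A z w) (hB : JoinedIn B z' w')
    (h1 : ∀ y ∈ B, b y < b z) (h2 : ∀ y ∈ B, b w < b y)
    (h3 : ∀ s ∈ A ∩ range (hA.somePath), a z' < a s)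
    (h4 : ∀ s ∈ A ∩ range (hA.somePath), a s < a w') : ¬Disjoint A B := by
  intro hdisj
  set P := hA.somePath.extend with hP
  set Q := hB.somePath.extend with hQ
  have hPA : ∀ s, P s ∈ A ∩ range hA.somePath := by
    intro s
    have hr : P s ∈ range hA.somePath := by rw [← Path.extend_range]; exact mem_range_self s
    obtain ⟨t, ht⟩ := hr
    exact ⟨ht ▸ hA.somePath_mem t, t, ht⟩
  have hQB : ∀ s, Q s ∈ B := by
    intro s
    have hr : Q s ∈ range hB.somePath := by rw [← Path.extend_range]; exact mem_range_self s
    obtain ⟨t, ht⟩ := hr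
    exact ht ▸ hB.somePath_mem t
  have hP0 : P 0 = z := Path.extend_zero _
  have hP1 : P 1 = w := Path.extend_one _
  have hQ0 : Q 0 = z' := Path.extend_zero _
  have hQ1 : Q 1 = w' := Path.extend_one _
  have hPc : Continuous P := Path.continuous_extend _
  have hQc : Continuous Q := Path.continuous_extend _
  -- In the coordinates `(a, b)`, the vector from a point of one path to a point of the other would
  -- never vanish, yet turn once. The paths are extended by constants, so the sign conditions hold
  -- for all real parameters.
  refine false_of_boundary_winding
    (f := fun x => (a (P x.1 - Q x.2) : ℂ) + b (P x.1 - Q x.2) * Complex.I) ?_ ?_ ?_ ?_ ?_ ?_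
  · fun_prop
  · intro x hx
    have hre := congrArg Complex.re hx
    have him := congrArg Complex.im hx
    simp at hre him
    have := hab (P x.1 - Q x.2) (by simpa using hre) (by simpa using him)
    rw [sub_eq_zero] at this
    exact Set.disjoint_left.1 hdisj (hPA x.1).1 (this ▸ hQB x.2)
  · intro t
    have := h1 _ (hQB t)
    simp [hP0]
    linarith
  · intro s
    have := h4 _ (hPA s)
    simp [hQ1]
    linarith
  · intro t
    have := h2 _ (hQB t)
    simp [hP1]
    linarith
  · intro s
    have := h3 _ (hPA s)
    simp [hQ0]
    linarith

theorem isPreconnected_setOf_lt_norm {R : ℝ} (hR : 0 ≤ R) : IsPreconnected {z : ℂ | R < ‖z‖} := by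
  have : {z : ℂ | R < ‖z‖} =
      (fun x : ℝ × ℝ => (x.1 : ℂ) * Complex.exp (x.2 * Complex.I)) '' (Ioi R ×ˢ univ) := by
    ext z
    constructor
    · intro hz
      exact ⟨(‖z‖, Complex.arg z), ⟨hz, mem_univ _⟩, Complex.norm_mul_exp_arg_mul_I z⟩
    · rintro ⟨x, hx, rfl⟩
      have : 0 < x.1 := hR.trans_lt hx.1
      change R < ‖_‖
      rw [norm_mul, Complex.norm_exp_ofReal_mul_I, mul_one, Complex.norm_real, Real.norm_eq_abs,
        abs_of_pos this]
      exact hx.1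
  rw [this]
  exact (isPreconnected_Ioi.prod isPreconnected_univ).image _ (by fun_prop)

/-- A continuous function that is integer-valued on a preconnected set is constant there. -/
theorem IsPreconnected.eq_of_integer_valued {s : Set ℂ} (hs : IsPreconnected s) {f : ℂ → ℝ}
    (hf : ContinuousOn f s) (hint : ∀ z ∈ s, ∃ k : ℤ, f z = k) {x y : ℂ} (hx : x ∈ s)
    (hy : y ∈ s) : f x = f y := by
  have himg := hs.image f hf
  by_contra hne
  wlog hlt : f x < f y generalizing x y
  · exact this hy hx (Ne.symm hne) (lt_of_le_of_ne (not_lt.1 hlt) (Ne.symm hne))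
  obtain ⟨k, hk⟩ := hint x hx
  obtain ⟨l, hl⟩ := hint y hy
  have hkl : k + 1 ≤ l := by
    rw [hk, hl] at hlt
    exact_mod_cast hlt
  have hmem : (k : ℝ) + 1 / 2 ∈ f '' s := by
    refine himg.ordConnected.out (mem_image_of_mem f hx) (mem_image_of_mem f hy) ⟨?_, ?_⟩
    · rw [hk]; linarith
    · rw [hl]
      have : (k : ℝ) + 1 ≤ l := by exact_mod_cast hkl
      linarith
  obtain ⟨z, hz, hfz⟩ := hmem
  obtain ⟨m, hm⟩ := hint z hz
  rw [hm] at hfz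
  have h2 : (2 * m : ℝ) = 2 * k + 1 := by linarith
  have h3 : 2 * m = 2 * k + 1 := by exact_mod_cast h2
  omega

namespace PlanarLattice

variable {L : PlanarLattice}

/-! ### The drawing of the lattice -/

theorem exists_endpoints (e : L.Edge) : ∃ x y : L.V, (e : Sym2 L.V) = s(x, y) ∧ x ≠ y ∧
    edgeSegment (e : Sym2 L.V) = segment ℝ (x : ℂ) y := by
  obtain ⟨e, he⟩ := e
  induction e using Sym2.ind with | _ x y => ?_
  exact ⟨x, y, rfl, (L.graph.mem_edgeSet.1 he).ne, rfl⟩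

theorem exists_isPeriod (L : PlanarLattice) :
    ∃ u v : ℂ, LinearIndependent ℝ ![u, v] ∧ L.IsPeriod u ∧ L.IsPeriod v := L.periodic

/-- A path to a different translate of the vertex must leave it through some edge. -/
theorem exists_edge_at (x : L.V) : ∃ e : L.Edge, x ∈ (e : Sym2 L.V) := by
  obtain ⟨u, v, h, hu, -⟩ := L.exists_isPeriod
  have hu0 : u ≠ 0 := h.ne_zero 0
  have hne : x ≠ hu.iso x := by
    intro heq
    have := congrArg Subtype.val heq
    rw [hu.coe_iso] at this
    exact hu0 (by simpa using this)
  obtain ⟨w⟩ := L.connected.preconnected x (hu.iso x)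
  generalize hu.iso x = y at hne w
  cases w with
  | nil => exact absurd rfl hne
  | cons hadj _ => exact ⟨⟨s(x, _), hadj⟩, Sym2.mem_mk_left _ _⟩

theorem coe_mem_edgeSegment {e : L.Edge} {x : L.V} (h : x ∈ (e : Sym2 L.V)) :
    (x : ℂ) ∈ edgeSegment (e : Sym2 L.V) := by
  obtain ⟨a, b, hab, -, hs⟩ := exists_endpoints e
  rw [hs]
  rw [hab] at h
  rcases Sym2.mem_iff.1 h with rfl | rfl
  · exact left_mem_segment ℝ _ _
  · exact right_mem_segment ℝ _ _

theorem mem_of_mem_edgeSegment_inter {e f : L.Edge} (hne : e ≠ f) {z : ℂ}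
    (he : z ∈ edgeSegment (e : Sym2 L.V)) (hf : z ∈ edgeSegment (f : Sym2 L.V)) :
    ∃ x : L.V, (x : ℂ) = z ∧ x ∈ (e : Sym2 L.V) ∧ x ∈ (f : Sym2 L.V) :=
  L.planar e e.2 f f.2 (fun h => hne (Subtype.ext h)) z ⟨he, hf⟩

/-- A vertex on the drawing of an edge is an end-point of the edge. -/
theorem mem_of_coe_mem_edgeSegment {e : L.Edge} {x : L.V}
    (h : (x : ℂ) ∈ edgeSegment (e : Sym2 L.V)) : x ∈ (e : Sym2 L.V) := by
  obtain ⟨f, hf⟩ := exists_edge_at x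
  by_cases hne : e = f
  · rw [hne]; exact hf
  · obtain ⟨y, hy, hye, -⟩ := mem_of_mem_edgeSegment_inter hne h (coe_mem_edgeSegment hf)
    rwa [← Subtype.ext hy]

theorem isCompact_edgeSegment (e : L.Edge) : IsCompact (edgeSegment (e : Sym2 L.V)) := by
  obtain ⟨x, y, -, -, hs⟩ := exists_endpoints e
  rw [hs, segment_eq_image]
  exact isCompact_Icc.image (by fun_prop)

theorem isPreconnected_edgeSegment (e : L.Edge) :
    IsPreconnected (edgeSegment (e : Sym2 L.V)) := by
  obtain ⟨x, y, -, -, hs⟩ := exists_endpoints e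
  rw [hs]
  exact (convex_segment _ _).isPreconnected

/-- The lengths of the edges are bounded. -/
theorem exists_edge_length_le (L : PlanarLattice) : ∃ ℓ : ℝ, ∀ (e : L.Edge),
    ∀ z ∈ edgeSegment (e : Sym2 L.V), ∀ w ∈ edgeSegment (e : Sym2 L.V), dist z w ≤ ℓ := by
  obtain ⟨u, v, h, hu, hv⟩ := L.exists_isPeriod
  have hfin := finite_edges_of_finite (finite_vertices_norm_le L (‖u‖ + ‖v‖))
  obtain ⟨ℓ, hℓ⟩ := (hfin.image fun e : L.Edge => Metric.diam (edgeSegment (e : Sym2 L.V))).bddAbove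
  refine ⟨ℓ, fun e => ?_⟩
  obtain ⟨x, y, hxy, -⟩ := exists_endpoints e
  obtain ⟨w, m, n, hw, hx⟩ := exists_vertex_near h hu hv x
  set τ := hu.lattice hv m n
  obtain ⟨f, rfl⟩ := τ.iso.mapEdgeSet.surjective e
  have hwf : w ∈ (f : Sym2 L.V) := by
    rw [← mem_mapEdgeSet_iff τ.iso, hx, hxy]
    exact Sym2.mem_mk_left _ _
  rw [τ.edgeSegment]
  rintro _ ⟨z, hz, rfl⟩ _ ⟨z', hz', rfl⟩
  rw [dist_add_right]
  exact (Metric.dist_le_diam_of_mem (isCompact_edgeSegment f).isBounded hz hz').trans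
    (hℓ (mem_image_of_mem _ ⟨w, hw, hwf⟩))

theorem finite_edges_meeting_ball (L : PlanarLattice) (r : ℝ) :
    {e : L.Edge | (edgeSegment (e : Sym2 L.V) ∩ Metric.closedBall 0 r).Nonempty}.Finite := by
  obtain ⟨ℓ, hℓ⟩ := L.exists_edge_length_le
  refine (finite_edges_of_finite (finite_vertices_norm_le L (ℓ + r))).subset ?_
  rintro e ⟨z, hz, hzr⟩
  obtain ⟨x, y, hxy, -⟩ := exists_endpoints e
  have hx : x ∈ (e : Sym2 L.V) := hxy ▸ Sym2.mem_mk_left _ _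
  refine ⟨x, ?_, hx⟩
  have h1 := hℓ e _ (coe_mem_edgeSegment hx) z hz
  have h2 : dist z 0 ≤ r := hzr
  have h3 := dist_triangle (x : ℂ) z 0
  rw [dist_zero_right] at h3
  change ‖(x : ℂ)‖ ≤ ℓ + r
  linarith

theorem locallyFinite_edgeSegment (L : PlanarLattice) :
    LocallyFinite fun e : L.Edge => edgeSegment (e : Sym2 L.V) := by
  intro z
  refine ⟨Metric.ball z 1, Metric.ball_mem_nhds z one_pos, ?_⟩
  refine (L.finite_edges_meeting_ball (‖z‖ + 1)).subset ?_
  rintro e ⟨w, hw, hwz⟩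
  refine ⟨w, hw, ?_⟩
  have h1 : dist w z < 1 := hwz
  have h2 := dist_triangle w z 0
  rw [dist_zero_right z] at h2
  exact Metric.mem_closedBall.2 (by linarith)

theorem drawing_eq (L : PlanarLattice) :
    L.drawing = ⋃ e : L.Edge, edgeSegment (e : Sym2 L.V) := by
  ext z
  simp only [drawing, mem_union, mem_iUnion]
  constructor
  · rintro (hz | ⟨e, he, hz⟩)
    · obtain ⟨e, he⟩ := exists_edge_at (⟨z, hz⟩ : L.V)
      exact ⟨e, coe_mem_edgeSegment he⟩
    · exact ⟨⟨e, he⟩, hz⟩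
  · rintro ⟨e, hz⟩
    exact Or.inr ⟨e, e.2, hz⟩

theorem edgeSegment_subset_drawing (e : L.Edge) : edgeSegment (e : Sym2 L.V) ⊆ L.drawing := by
  rw [drawing_eq]
  exact subset_iUnion (fun e : L.Edge => edgeSegment (e : Sym2 L.V)) e

theorem isClosed_iUnion_edgeSegment (s : Set L.Edge) :
    IsClosed (⋃ e ∈ s, edgeSegment (e : Sym2 L.V)) := by
  rw [biUnion_eq_iUnion]
  exact (L.locallyFinite_edgeSegment.comp_injective Subtype.val_injective).isClosed_iUnion
    fun e => (isCompact_edgeSegment e.1).isClosed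

theorem isClosed_drawing (L : PlanarLattice) : IsClosed L.drawing := by
  rw [drawing_eq]
  exact L.locallyFinite_edgeSegment.isClosed_iUnion fun e => (isCompact_edgeSegment e).isClosed

/-! ### Faces -/

/-- The face that contains a point. -/
def faceOf (z : ℂ) (hz : z ∉ L.drawing) : L.Face := ⟨connectedComponentIn L.drawingᶜ z, z, hz, rfl⟩

theorem mem_faceOf {z : ℂ} (hz : z ∉ L.drawing) : z ∈ (faceOf z hz).1 := mem_connectedComponentIn hz

theorem Face.eq_of_mem {F F' : L.Face} {z : ℂ} (h : z ∈ F.1) (h' : z ∈ F'.1) : F = F' := by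
  obtain ⟨F, a, ha, rfl⟩ := F
  obtain ⟨F', b, hb, rfl⟩ := F'
  apply Subtype.ext
  change connectedComponentIn _ a = connectedComponentIn _ b
  rw [connectedComponentIn_eq h, connectedComponentIn_eq h']

theorem Face.notMem_drawing {F : L.Face} {z : ℂ} (h : z ∈ F.1) : z ∉ L.drawing := by
  obtain ⟨F, a, ha, rfl⟩ := F
  exact connectedComponentIn_subset _ _ h

theorem Face.isOpen (F : L.Face) : IsOpen F.1 := by
  obtain ⟨F, a, ha, rfl⟩ := F
  exact (isOpen_compl_iff.2 L.isClosed_drawing).connectedComponentIn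

theorem Face.isConnected (F : L.Face) : IsConnected F.1 := by
  obtain ⟨F, a, ha, rfl⟩ := F
  exact isConnected_connectedComponentIn_iff.2 ha

theorem subset_faceOf {s : Set ℂ} (hs : IsPreconnected s) (hd : ∀ w ∈ s, w ∉ L.drawing) {z : ℂ}
    (hz : z ∈ s) : s ⊆ (faceOf z (hd z hz)).1 := hs.subset_connectedComponentIn hz hd

/-- Near a relative interior point of an edge there are only the edge and (at most) two faces. -/
theorem exists_local_faces {e : L.Edge} {x y : L.V} (hxy : (e : Sym2 L.V) = s(x, y)) {z : ℂ}
    (hz : z ∈ openSegment ℝ (x : ℂ) y) : ∃ r > 0, ∃ F₁ F₂ : L.Face,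
      (∀ w ∈ Metric.ball z r, w ∈ F₁.1 ∨ w ∈ F₂.1 ∨ w ∈ edgeSegment (e : Sym2 L.V)) ∧
      ∀ w ∈ Metric.ball z r, w ∈ edgeSegment (e : Sym2 L.V) → w ∈ closure F₁.1 ∧ w ∈ closure F₂.1 := by
  have hs : edgeSegment (e : Sym2 L.V) = segment ℝ (x : ℂ) y := by rw [hxy]; rfl
  have hne : (y : ℂ) - x ≠ 0 := by
    have he := e.2
    rw [hxy] at he
    exact sub_ne_zero.2 fun h => (L.graph.mem_edgeSet.1 he).ne (Subtype.ext h.symm)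
  set c : ℂ := ((y : ℂ) - x)⁻¹ with hc
  have hcy : ((y : ℂ) - x) * c = 1 := mul_inv_cancel₀ hne
  -- This similarity sends `x` to 0 and `y` to 1. The edge becomes a real interval, and its two
  -- sides are told apart by the sign of the imaginary part.
  set κ : ℂ → ℂ := fun w => (w - x) * c with hκ
  have hκinv : ∀ w, w = x + κ w * (y - x) := by
    intro w
    rw [hκ]
    linear_combination -(w - x) * hcy
  have hκc : Continuous κ := by fun_prop
  have hκseg : ∀ t : ℝ, κ ((1 - t) • (x : ℂ) + t • (y : ℂ)) = t := by
    intro t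
    simp only [hκ, Complex.real_smul]
    push_cast
    linear_combination (t : ℂ) * hcy
  have him : ∀ w ∈ segment ℝ (x : ℂ) y, (κ w).im = 0 := by
    rw [segment_eq_image]
    rintro _ ⟨t, -, rfl⟩
    rw [hκseg, Complex.ofReal_im]
  -- The other edges form a closed set by local finiteness, and planarity keeps it off the relative
  -- interior of `e`. A small disc then meets `e` alone.
  set D : Set ℂ := ⋃ f ∈ {f : L.Edge | f ≠ e}, edgeSegment (f : Sym2 L.V) with hD
  have hzD : z ∉ D := by
    intro hzD
    simp only [hD, mem_iUnion] at hzD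
    obtain ⟨f, hf, hzf⟩ := hzD
    obtain ⟨w, hw, hwe, -⟩ := mem_of_mem_edgeSegment_inter (Ne.symm hf)
      (hs ▸ openSegment_subset_segment ℝ _ _ hz) hzf
    rw [openSegment_eq_image] at hz
    obtain ⟨t, ht, rfl⟩ := hz
    rw [hxy] at hwe
    have hk := hκseg t
    have hk' := congrArg κ hw
    dsimp only at hk'
    rw [hk] at hk'
    rcases Sym2.mem_iff.1 hwe with rfl | rfl
    · have : κ (w : ℂ) = 0 := by simp [hκ]
      rw [this] at hk'
      have : t = 0 := by exact_mod_cast hk'.symm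
      exact ht.1.ne' this
    · have : κ (w : ℂ) = 1 := by simpa [hκ] using hcy
      rw [this] at hk'
      have : t = 1 := by exact_mod_cast hk'.symm
      exact ht.2.ne this
  have hzre : 0 < (κ z).re ∧ (κ z).re < 1 := by
    rw [openSegment_eq_image] at hz
    obtain ⟨t, ht, rfl⟩ := hz
    dsimp only
    rw [hκseg, Complex.ofReal_re]
    exact ht
  have hU : Dᶜ ∩ {w | 0 < (κ w).re ∧ (κ w).re < 1} ∈ 𝓝 z := by
    refine Filter.inter_mem ((isOpen_compl_iff.2
      (isClosed_iUnion_edgeSegment _)).mem_nhds hzD) ?_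
    refine IsOpen.mem_nhds ?_ hzre
    exact (isOpen_lt continuous_const (Complex.continuous_re.comp hκc)).inter
      (isOpen_lt (Complex.continuous_re.comp hκc) continuous_const)
  obtain ⟨r, hr, hball⟩ := Metric.mem_nhds_iff.1 hU
  have hdraw : ∀ w ∈ Metric.ball z r, (κ w).im ≠ 0 → w ∉ L.drawing := by
    intro w hw hwim hwd
    rw [drawing_eq, mem_iUnion] at hwd
    obtain ⟨f, hf⟩ := hwd
    by_cases hfe : f = e
    · rw [hfe, hs] at hf
      exact hwim (him w hf)
    · refine (hball hw).1 ?_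
      simp only [hD, mem_iUnion]
      exact ⟨f, hfe, hf⟩
  have hlin : IsLinearMap ℝ fun w : ℂ => (w * c).im :=
    ⟨fun a b => by simp [add_mul], fun a b => by simp [mul_assoc]⟩
  have hκim : ∀ w, (κ w).im = (w * c).im - ((x : ℂ) * c).im := fun w => by
    simp [hκ, sub_mul]
  have hside : ∀ δ : ℝ, δ ≠ 0 → ∃ F : L.Face,
      (∀ w ∈ Metric.ball z r, 0 < δ * (κ w).im → w ∈ F.1) ∧
      ∀ w ∈ Metric.ball z r, (κ w).im = 0 → w ∈ closure F.1 := by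
    intro δ hδ
    set P : Set ℂ := Metric.ball z r ∩ {w | 0 < δ * (κ w).im} with hP
    have hPc : IsPreconnected P := by
      refine ((convex_ball z r).inter ?_).isPreconnected
      have : {w | 0 < δ * (κ w).im} = {w | δ * ((x : ℂ) * c).im < δ * (w * c).im} := by
        ext w
        simp only [mem_ofPred_eq, hκim, mul_sub, sub_pos]
      rw [this]
      exact convex_halfSpace_gt (IsLinearMap.isLinearMap_smul δ |>.mk' _ |>.comp
        (hlin.mk' _)).isLinear _
    -- Points of the line are reached from the chosen half-disc along the normal direction `δ i (y -
    -- x)`.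
    have hcl : ∀ w ∈ Metric.ball z r, (κ w).im = 0 → w ∈ closure P := by
      intro w hw hwim
      have ht : Tendsto (fun t : ℝ => w + t * (δ * Complex.I * ((y : ℂ) - x))) (𝓝[>] 0) (𝓝 w) := by
        have : Continuous fun t : ℝ => w + t * (δ * Complex.I * ((y : ℂ) - x)) := by fun_prop
        have h0 := this.tendsto 0
        simp only [Complex.ofReal_zero, zero_mul, add_zero] at h0
        exact h0.mono_left nhdsWithin_le_nhds
      refine mem_closure_of_tendsto ht ?_
      filter_upwards [ht (Metric.isOpen_ball.mem_nhds hw), self_mem_nhdsWithin] with t ht1 ht2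
      refine ⟨ht1, ?_⟩
      have hk : κ (w + t * (δ * Complex.I * ((y : ℂ) - x))) = κ w + (t * δ : ℝ) * Complex.I := by
        simp only [hκ]
        push_cast
        linear_combination (t : ℂ) * δ * Complex.I * hcy
      change 0 < δ * (κ _).im
      rw [hk]
      simp only [Complex.add_im, hwim, Complex.mul_im, Complex.ofReal_re, Complex.I_im,
        Complex.ofReal_im, Complex.I_re, mul_one, mul_zero, add_zero, zero_add]
      have : 0 < t := ht2
      have : 0 < δ * δ := mul_self_pos.2 hδ
      calc 0 < t * (δ * δ) := by positivity
        _ = _ := by ring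
    have hzim : (κ z).im = 0 := him z (openSegment_subset_segment ℝ _ _ hz)
    obtain ⟨w₀, hw₀⟩ : P.Nonempty :=
      closure_nonempty_iff.1 ⟨z, hcl z (Metric.mem_ball_self hr) hzim⟩
    have hPd : ∀ w ∈ P, w ∉ L.drawing := by
      rintro w ⟨hw, hw'⟩
      refine hdraw w hw fun h => ?_
      rw [mem_ofPred_eq, h, mul_zero] at hw'
      exact lt_irrefl _ hw'
    have hsub := subset_faceOf hPc hPd hw₀
    exact ⟨_, fun w hw hw' => hsub ⟨hw, hw'⟩, fun w hw hw' => closure_mono hsub (hcl w hw hw')⟩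
  obtain ⟨F₁, h1, h1'⟩ := hside 1 one_ne_zero
  obtain ⟨F₂, h2, h2'⟩ := hside (-1) (by norm_num)
  refine ⟨r, hr, F₁, F₂, fun w hw => ?_, fun w hw hwe => ?_⟩
  · rcases lt_trichotomy (κ w).im 0 with h | h | h
    · exact Or.inr (Or.inl (h2 w hw (by linarith)))
    · refine Or.inr (Or.inr ?_)
      obtain ⟨-, hre⟩ := hball hw
      rw [hs, segment_eq_image]
      refine ⟨(κ w).re, ⟨hre.1.le, hre.2.le⟩, ?_⟩
      have hkw : κ w = (κ w).re := Complex.ext rfl (by simpa using h)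
      conv_rhs => rw [hκinv w, hkw]
      simp only [Complex.real_smul]
      push_cast
      ring
    · exact Or.inl (h1 w hw (by linarith))
  · rw [hs] at hwe
    exact ⟨h1' w hw (him w hwe), h2' w hw (him w hwe)⟩

theorem frontier_face (F : L.Face) : frontier F.1 = closure F.1 \ F.1 := F.isOpen.frontier_eq

/-- A face that touches the relative interior of an edge has the whole edge on its boundary. -/
theorem edgeSegment_subset_frontier {e : L.Edge} {x y : L.V} (hxy : (e : Sym2 L.V) = s(x, y))
    {z : ℂ}
    (hz : z ∈ openSegment ℝ (x : ℂ) y) {F : L.Face} (hF : z ∈ closure F.1) :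
    edgeSegment (e : Sym2 L.V) ⊆ frontier F.1 := by
  have hs : edgeSegment (e : Sym2 L.V) = segment ℝ (x : ℂ) y := by rw [hxy]; rfl
  have hopen : openSegment ℝ (x : ℂ) y ⊆ closure F.1 := by
    by_contra hnot
    obtain ⟨w₀, hw₀, hw₀F⟩ := not_subset.1 hnot
    -- Along the open edge, lying in the closure of `F` is a closed condition, and an open one
    -- because only the two local faces occur nearby. The open segment is connected.
    set U : Set ℂ := {w | ∃ z ∈ openSegment ℝ (x : ℂ) y, ∃ r > 0, w ∈ Metric.ball z r ∧
      ∀ w' ∈ Metric.ball z r, w' ∈ edgeSegment (e : Sym2 L.V) → w' ∈ closure F.1} with hU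
    have hUo : IsOpen U := by
      rw [isOpen_iff_mem_nhds]
      rintro w ⟨z, hz, r, hr, hw, h⟩
      exact Filter.mem_of_superset (Metric.isOpen_ball.mem_nhds hw)
        fun w' hw' => ⟨z, hz, r, hr, hw', h⟩
    have hUF : ∀ w ∈ openSegment ℝ (x : ℂ) y, w ∈ closure F.1 → w ∈ U := by
      intro w hw hwF
      obtain ⟨r, hr, F₁, F₂, h1, h2⟩ := exists_local_faces hxy hw
      refine ⟨w, hw, r, hr, Metric.mem_ball_self hr, fun w' hw' hwe => ?_⟩
      obtain ⟨t, ht, htF⟩ := mem_closure_iff.1 hwF _ Metric.isOpen_ball (Metric.mem_ball_self hr)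
      rcases h1 t ht with h | h | h
      · rw [Face.eq_of_mem htF h]; exact (h2 w' hw' hwe).1
      · rw [Face.eq_of_mem htF h]; exact (h2 w' hw' hwe).2
      · exact absurd (edgeSegment_subset_drawing e h) (Face.notMem_drawing htF)
    obtain ⟨w, hw, hwU, hwF⟩ := (convex_openSegment (x : ℂ) y).isPreconnected U (closure F.1)ᶜ hUo
      isClosed_closure.isOpen_compl
      (fun w hw => by
        by_cases h : w ∈ closure F.1
        · exact Or.inl (hUF w hw h)
        · exact Or.inr h)
      ⟨z, hz, hUF z hz hF⟩ ⟨w₀, hw₀, hw₀F⟩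
    obtain ⟨z', -, r, -, hwb, h⟩ := hwU
    exact hwF (h w hwb (hs ▸ openSegment_subset_segment ℝ _ _ hw))
  rw [frontier_face]
  intro w hw
  refine ⟨?_, fun h => Face.notMem_drawing h (edgeSegment_subset_drawing e hw)⟩
  rw [hs, ← closure_openSegment] at hw
  exact closure_minimal hopen isClosed_closure hw

theorem exists_mem_openSegment (e : L.Edge) : ∃ x y : L.V, (e : Sym2 L.V) = s(x, y) ∧
    ∃ z, z ∈ openSegment ℝ (x : ℂ) y := by
  obtain ⟨x, y, hxy, -⟩ := exists_endpoints e
  exact ⟨x, y, hxy, midpoint ℝ (x : ℂ) y, midpoint_mem_openSegment _ _⟩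

theorem exists_adjacent_face (e : L.Edge) :
    ∃ F : L.Face, edgeSegment (e : Sym2 L.V) ⊆ frontier F.1 := by
  obtain ⟨x, y, hxy, z, hz⟩ := exists_mem_openSegment e
  obtain ⟨r, hr, F₁, F₂, -, h⟩ := exists_local_faces hxy hz
  have hze : z ∈ edgeSegment (e : Sym2 L.V) := by
    rw [hxy]; exact openSegment_subset_segment ℝ _ _ hz
  exact ⟨F₁, edgeSegment_subset_frontier hxy hz (h z (Metric.mem_ball_self hr) hze).1⟩

/-- The closure of the union of a set of faces. -/
def region (S : Set L.Face) : Set ℂ := closure (⋃ F ∈ S, F.1)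

/-- Near a relative interior point of an edge only two faces occur, so a face of `S` accumulating
there is one of them. A closure of infinitely many faces thus causes no trouble. -/
theorem exists_face_of_mem_region {S : Set L.Face} {e : L.Edge} {x y : L.V}
    (hxy : (e : Sym2 L.V) = s(x, y)) {z : ℂ} (hz : z ∈ openSegment ℝ (x : ℂ) y)
    (hS : z ∈ region S) : ∃ F ∈ S, edgeSegment (e : Sym2 L.V) ⊆ frontier F.1 := by
  obtain ⟨r, hr, F₁, F₂, h1, h2⟩ := exists_local_faces hxy hz
  obtain ⟨t, ht, htS⟩ := mem_closure_iff.1 hS _ Metric.isOpen_ball (Metric.mem_ball_self hr)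
  simp only [mem_iUnion] at htS
  obtain ⟨F, hF, htF⟩ := htS
  have hze : z ∈ edgeSegment (e : Sym2 L.V) := by
    rw [hxy]; exact openSegment_subset_segment ℝ _ _ hz
  have h2' := h2 z (Metric.mem_ball_self hr) hze
  refine ⟨F, hF, edgeSegment_subset_frontier hxy hz ?_⟩
  rcases h1 t ht with h | h | h
  · rw [Face.eq_of_mem htF h]; exact h2'.1
  · rw [Face.eq_of_mem htF h]; exact h2'.2
  · exact absurd (edgeSegment_subset_drawing e h) (Face.notMem_drawing htF)

theorem edgeSegment_subset_region {S : Set L.Face} {e : L.Edge} {F : L.Face} (hF : F ∈ S)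
    (h : edgeSegment (e : Sym2 L.V) ⊆ frontier F.1) : edgeSegment (e : Sym2 L.V) ⊆ region S :=
  h.trans (frontier_subset_closure.trans
    (closure_mono (subset_biUnion_of_mem (u := fun F : L.Face => F.1) hF)))

theorem region_union_region_compl (S : Set L.Face) : region S ∪ region Sᶜ = univ := by
  have hcl : region S ∪ region Sᶜ = closure (⋃ F : L.Face, F.1) := by
    rw [region, region, ← closure_union, ← biUnion_union, union_compl_self, biUnion_univ]
  rw [hcl, eq_univ_iff_forall]
  intro z
  by_cases hz : z ∈ L.drawing
  · rw [drawing_eq, mem_iUnion] at hz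
    obtain ⟨e, he⟩ := hz
    obtain ⟨F, hF⟩ := exists_adjacent_face e
    exact closure_mono (subset_iUnion (fun F : L.Face => F.1) F) (frontier_subset_closure (hF he))
  · exact subset_closure (mem_iUnion.2 ⟨faceOf z hz, mem_faceOf hz⟩)

end PlanarLattice

namespace PlanarLattice

variable {L : PlanarLattice}

/-! ### The faces are bounded -/

theorem coe_mem_drawing (x : L.V) : (x : ℂ) ∈ L.drawing := Or.inl x.2

theorem joinedIn_drawing (x y : L.V) : JoinedIn L.drawing (x : ℂ) y := by
  obtain ⟨w⟩ := L.connected.preconnected x y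
  induction w with
  | nil => exact JoinedIn.refl (coe_mem_drawing _)
  | cons hadj _ ih =>
    exact (JoinedIn.of_segment_subset (edgeSegment_subset_drawing ⟨s(_, _), hadj⟩)).trans ih

theorem IsPeriod.add_mem_drawing {w : ℂ} (hw : L.IsPeriod w) {z : ℂ} (hz : z ∈ L.drawing) :
    z + w ∈ L.drawing := by
  rw [drawing_eq, mem_iUnion] at hz
  obtain ⟨e, he⟩ := hz
  apply edgeSegment_subset_drawing (hw.iso.mapEdgeSet e)
  rw [hw.edgeSegment]
  exact mem_image_of_mem _ he

/-- The lattice contains paths along the translates of the first period. -/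
theorem exists_joinedIn_strip {u v : ℂ} (hu : L.IsPeriod u) (hv : L.IsPeriod v) {b : ℂ →L[ℝ] ℝ}
    (hbu : b u = 0) (hbv : b v = 1) : ∃ M : ℝ, ∀ (n k : ℤ) (N : ℕ),
      JoinedIn (L.drawing ∩ {z | |b z - n| ≤ M}) (k • u + n • v) ((k + N) • u + n • v) := by
  set γ := (joinedIn_drawing L.origin (hu.iso L.origin)).somePath with hγ
  have hγd : ∀ t, γ t ∈ L.drawing := fun t => (joinedIn_drawing _ _).somePath_mem t
  obtain ⟨M, hM⟩ := (isCompact_range (f := fun t => |b (γ t)|) (by fun_prop)).bddAbove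
  have hM' : ∀ t, |b (γ t)| ≤ M := fun t => hM (mem_range_self t)
  have h0 : (L.origin : ℂ) = 0 := rfl
  have h1 : (hu.iso L.origin : ℂ) = u := by rw [hu.coe_iso, h0, zero_add]
  have hbk : ∀ k n : ℤ, b (k • u + n • v) = n := by
    intro k n
    rw [← Int.cast_smul_eq_zsmul ℝ, ← Int.cast_smul_eq_zsmul ℝ]
    simp only [map_add, map_smul, hbu, hbv, smul_eq_mul, mul_zero, mul_one, zero_add]
  have step : ∀ n k : ℤ, JoinedIn (L.drawing ∩ {z | |b z - n| ≤ M}) (k • u + n • v)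
      ((k + 1) • u + n • v) := by
    intro n k
    refine ⟨(γ.map (f := fun z => z + (k • u + n • v)) (by fun_prop)).cast ?_ ?_, fun t => ?_⟩
    · rw [h0, zero_add]
    · rw [h1, add_smul, one_smul]; ring
    · change γ t + (k • u + n • v) ∈ _
      refine ⟨(hu.lattice hv k n).add_mem_drawing (hγd t), ?_⟩
      rw [mem_ofPred_eq, map_add, hbk, add_sub_cancel_right]
      exact hM' t
  refine ⟨M, fun n k N => ?_⟩
  induction N with
  | zero =>
    rw [Nat.cast_zero, add_zero]
    exact JoinedIn.refl (step n k).source_mem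
  | succ N ih =>
    rw [Nat.cast_succ, ← add_assoc]
    exact ih.trans (step n (k + N))

/-- A face is path-connected and avoids the drawing, so it cannot cross a strip containing a long
periodic path of the lattice. Exchanging the two periods bounds the other coordinate. -/
theorem exists_face_coordinate_le {u v : ℂ} (hu : L.IsPeriod u) (hv : L.IsPeriod v)
    {a b : ℂ →L[ℝ] ℝ} (hab : ∀ z, a z = 0 → b z = 0 → z = 0) (hau : a u = 1) (hav : a v = 0)
    (hbu : b u = 0) (hbv : b v = 1) :
    ∃ K : ℝ, ∀ F : L.Face, ∀ z ∈ F.1, ∀ w ∈ F.1, b z - b w ≤ K := by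
  obtain ⟨M, hM⟩ := exists_joinedIn_strip hu hv hbu hbv
  refine ⟨2 * M + 1, fun F z hz w hw => ?_⟩
  by_contra hcon
  push Not at hcon
  have hF : JoinedIn F.1 z w :=
    (F.isOpen.isConnected_iff_isPathConnected.1 F.isConnected).joinedIn z hz w hw
  obtain ⟨A, hA⟩ := (isCompact_range (f := fun t => |a (hF.somePath t)|) (by fun_prop)).bddAbove
  obtain ⟨N, hN⟩ := exists_nat_gt A
  have hA' : ∀ s ∈ range hF.somePath, |a s| < N := by
    rintro _ ⟨t, rfl⟩
    exact (hA (mem_range_self t)).trans_lt hN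
  -- The strip of half-width `M` around level `n` then lies strictly between the levels of `w` and
  -- `z`. `N` makes the lattice path overhang the face path on both sides.
  set n : ℤ := ⌊b w + M⌋ + 1 with hn
  have hn1 : b w + M < n := by rw [hn]; push_cast; exact Int.lt_floor_add_one _
  have hn2 : (n : ℝ) ≤ b w + M + 1 := by
    rw [hn]; push_cast; linarith [Int.floor_le (b w + M)]
  have hak : ∀ k : ℤ, a (k • u + n • v) = k := by
    intro k
    rw [← Int.cast_smul_eq_zsmul ℝ, ← Int.cast_smul_eq_zsmul ℝ]
    simp only [map_add, map_smul, hau, hav, smul_eq_mul, mul_zero, mul_one, add_zero]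
  have hB := hM n (-N) (2 * N)
  refine not_disjoint_of_crossing hab hF hB (fun y hy => ?_) (fun y hy => ?_) (fun s hs => ?_)
    (fun s hs => ?_) ?_
  · have hyn : |b y - n| ≤ M := hy.2
    have := (abs_le.1 hyn).2
    linarith
  · have hyn : |b y - n| ≤ M := hy.2
    have := (abs_le.1 hyn).1
    linarith
  · rw [hak]
    have := (abs_lt.1 (hA' s hs.2)).1
    push_cast
    exact this
  · rw [hak]
    have := (abs_lt.1 (hA' s hs.2)).2
    push_cast
    linarith
  · exact Set.disjoint_left.2 fun y hy hy' => Face.notMem_drawing hy hy'.1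

/-- The faces have uniformly bounded diameter. -/
theorem exists_face_dist_le (L : PlanarLattice) :
    ∃ D : ℝ, ∀ F : L.Face, ∀ z ∈ closure F.1, ∀ w ∈ closure F.1, dist z w ≤ D := by
  obtain ⟨u, v, h, hu, hv⟩ := L.exists_isPeriod
  obtain ⟨a, b, hab, hau, hav, hbu, hbv⟩ := exists_coordinates h
  have h0 : ∀ z, a z = 0 → b z = 0 → z = 0 := fun z h1 h2 => by rw [hab z, h1, h2]; simp
  obtain ⟨K, hK⟩ := exists_face_coordinate_le hu hv h0 hau hav hbu hbv
  obtain ⟨K', hK'⟩ := exists_face_coordinate_le hv hu (fun z h1 h2 => h0 z h2 h1) hbv hbu hav hau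
  refine ⟨K' * ‖u‖ + K * ‖v‖, fun F => ?_⟩
  have key : ∀ z ∈ F.1, ∀ w ∈ F.1, dist z w ≤ K' * ‖u‖ + K * ‖v‖ := by
    intro z hz w hw
    have ha : |a (z - w)| ≤ K' := by
      rw [map_sub, abs_le]
      exact ⟨by linarith [hK' F w hw z hz], hK' F z hz w hw⟩
    have hb : |b (z - w)| ≤ K := by
      rw [map_sub, abs_le]
      exact ⟨by linarith [hK F w hw z hz], hK F z hz w hw⟩
    rw [dist_eq_norm, hab (z - w)]
    refine (norm_add_le _ _).trans (add_le_add ?_ ?_) <;> rw [norm_smul, Real.norm_eq_abs]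
    · exact mul_le_mul_of_nonneg_right ha (norm_nonneg _)
    · exact mul_le_mul_of_nonneg_right hb (norm_nonneg _)
  have hclosed : IsClosed {x : ℂ × ℂ | dist x.1 x.2 ≤ K' * ‖u‖ + K * ‖v‖} :=
    isClosed_le (by fun_prop) continuous_const
  have hsub : closure (F.1 ×ˢ F.1) ⊆ {x : ℂ × ℂ | dist x.1 x.2 ≤ K' * ‖u‖ + K * ‖v‖} :=
    closure_minimal (fun x hx => key _ hx.1 _ hx.2) hclosed
  rw [closure_prod_eq] at hsub
  exact fun z hz w hw => hsub (mk_mem_prod hz hw)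

/-! ### Finite clusters are surrounded by dual paths -/

/-- The edge `e` joins the set of vertices `C` to its complement. -/
def IsCut (C : Set L.V) (e : L.Edge) : Prop := ∃ x y, (e : Sym2 L.V) = s(x, y) ∧ x ∈ C ∧ y ∉ C

theorem isClosed_coe_image (s : Set L.V) : IsClosed ((fun x : L.V => (x : ℂ)) '' s) := by
  have hlf : LocallyFinite fun x : s => ({((x : L.V) : ℂ)} : Set ℂ) := by
    intro z
    refine ⟨Metric.ball z 1, Metric.ball_mem_nhds z one_pos, ?_⟩
    refine Set.Finite.of_finite_image (f := fun x : s => (x : L.V)) ?_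
      Subtype.val_injective.injOn
    refine (finite_vertices_norm_le L (‖z‖ + 1)).subset ?_
    rintro _ ⟨x, ⟨w, rfl, hw⟩, rfl⟩
    have h1 : dist ((x : L.V) : ℂ) z < 1 := hw
    have h2 := dist_triangle ((x : L.V) : ℂ) z 0
    rw [dist_zero_right z, dist_zero_right] at h2
    change ‖((x : L.V) : ℂ)‖ ≤ _
    linarith
  have : (fun x : L.V => (x : ℂ)) '' s = ⋃ x : s, {((x : L.V) : ℂ)} := by
    ext z; simp [eq_comm]
  rw [this]
  exact hlf.isClosed_iUnion fun _ => isClosed_singleton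

/-- The drawing of the subgraph induced by a set of vertices. -/
def inducedDrawing (s : Set L.V) : Set ℂ :=
  (fun x : L.V => (x : ℂ)) '' s ∪ ⋃ e ∈ {e : L.Edge | ∀ x ∈ (e : Sym2 L.V), x ∈ s},
    edgeSegment (e : Sym2 L.V)

theorem isClosed_inducedDrawing (s : Set L.V) : IsClosed (inducedDrawing s) :=
  (isClosed_coe_image s).union (isClosed_iUnion_edgeSegment _)

theorem isCompact_inducedDrawing {s : Set L.V} (hs : s.Finite) : IsCompact (inducedDrawing s) := by
  refine (hs.image _).isCompact.union (Set.Finite.isCompact_biUnion ?_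
    fun e _ => isCompact_edgeSegment e)
  refine (finite_edges_of_finite hs).subset fun e he => ?_
  obtain ⟨x, y, hxy, -⟩ := exists_endpoints e
  have hx : x ∈ (e : Sym2 L.V) := hxy ▸ Sym2.mem_mk_left _ _
  exact ⟨x, he x hx, hx⟩

theorem coe_mem_inducedDrawing {s : Set L.V} {x : L.V} (hx : x ∈ s) :
    (x : ℂ) ∈ inducedDrawing s := Or.inl (mem_image_of_mem _ hx)

theorem edgeSegment_subset_inducedDrawing {s : Set L.V} {e : L.Edge}
    (he : ∀ x ∈ (e : Sym2 L.V), x ∈ s) : edgeSegment (e : Sym2 L.V) ⊆ inducedDrawing s :=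
  fun _ hz => Or.inr (mem_biUnion (t := fun e : L.Edge => edgeSegment (e : Sym2 L.V)) he hz)

/-- By planarity a common point would be a vertex both in `s` and outside it. This allows a Urysohn
function separating a cluster from the rest of the graph. -/
theorem disjoint_inducedDrawing (s : Set L.V) :
    Disjoint (inducedDrawing s) (inducedDrawing sᶜ) := by
  rw [Set.disjoint_left]
  rintro z hz hz'
  simp only [inducedDrawing, mem_union, mem_iUnion, mem_image] at hz hz'
  rcases hz with ⟨x, hx, rfl⟩ | ⟨e, he, hze⟩
  · rcases hz' with ⟨y, hy, hxy⟩ | ⟨f, hf, hzf⟩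
    · exact hy ((Subtype.ext hxy : y = x) ▸ hx)
    · exact hf x (mem_of_coe_mem_edgeSegment hzf) hx
  · rcases hz' with ⟨y, hy, rfl⟩ | ⟨f, hf, hzf⟩
    · exact hy (he y (mem_of_coe_mem_edgeSegment hze))
    · obtain ⟨x, y, hxy, -⟩ := exists_endpoints e
      have hx : x ∈ (e : Sym2 L.V) := hxy ▸ Sym2.mem_mk_left _ _
      have hne : e ≠ f := fun h => hf x (h ▸ hx) (he x hx)
      obtain ⟨w, -, hwe, hwf⟩ := mem_of_mem_edgeSegment_inter hne hze hzf
      exact hf w hwf (he w hwe)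

theorem edge_trichotomy (C : Set L.V) (e : L.Edge) : IsCut C e ∨
    (∀ x ∈ (e : Sym2 L.V), x ∈ C) ∨ ∀ x ∈ (e : Sym2 L.V), x ∈ Cᶜ := by
  obtain ⟨x, y, hxy, -⟩ := exists_endpoints e
  by_cases hx : x ∈ C <;> by_cases hy : y ∈ C
  · refine Or.inr (Or.inl fun z hz => ?_)
    rw [hxy] at hz
    rcases Sym2.mem_iff.1 hz with rfl | rfl <;> assumption
  · exact Or.inl ⟨x, y, hxy, hx, hy⟩
  · exact Or.inl ⟨y, x, hxy.trans Sym2.eq_swap, hy, hx⟩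
  · refine Or.inr (Or.inr fun z hz => ?_)
    rw [hxy] at hz
    rcases Sym2.mem_iff.1 hz with rfl | rfl <;> assumption

/-- Faces are open and disjoint, so a point of a face lies in a region only if its face is one of
those generating the region. -/
theorem notMem_region_inter {S : Set L.Face} {z : ℂ} (hz : z ∉ L.drawing)
    (h : z ∈ region S ∩ region Sᶜ) : False := by
  have key : ∀ T : Set L.Face, z ∈ region T → faceOf z hz ∈ T := by
    intro T hT
    obtain ⟨t, ht, htT⟩ := mem_closure_iff.1 hT _ (faceOf z hz).isOpen (mem_faceOf hz)
    simp only [mem_iUnion] at htT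
    obtain ⟨F, hF, htF⟩ := htT
    rwa [Face.eq_of_mem ht htF]
  exact key _ h.2 (key _ h.1)

theorem reachable_induction {P : Set L.Edge} {α : Type*} {f : L.V → α}
    (h : ∀ e ∈ P, ∀ x y, (e : Sym2 L.V) = s(x, y) → f x = f y) {x y : L.V}
    (hr : (L.subgraphOf P).Reachable x y) : f x = f y := by
  obtain ⟨w⟩ := hr
  induction w with
  | nil => rfl
  | cons hadj _ ih =>
    obtain ⟨e, he, hxy⟩ := subgraphOf_adj.1 hadj
    exact (h e he _ _ hxy).trans ih

/-- If the edges that leave a finite set of vertices are closed, then any two unbounded connected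
sets of edges that start in the set cross its boundary at edges that are dual-connected. -/
theorem exists_dualConnected_of_finite {ω : L.Config} {C : Set L.V} (hC : C.Finite) {o : L.V}
    (ho : o ∈ C) (hclosed : ∀ e, IsCut C e → ω e = false) {P Q : Set L.Edge}
    (hP : ∀ r : ℝ, ∃ y : L.V, r < ‖(y : ℂ)‖ ∧ (L.subgraphOf P).Reachable o y)
    (hQ : ∀ r : ℝ, ∃ y : L.V, r < ‖(y : ℂ)‖ ∧ (L.subgraphOf Q).Reachable o y) :
    ∃ e ∈ P, ∃ f ∈ Q, IsCut C e ∧ IsCut C f ∧ ∃ F F' : L.Face,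
      edgeSegment (e : Sym2 L.V) ⊆ frontier F.1 ∧ edgeSegment (f : Sym2 L.V) ⊆ frontier F'.1 ∧
        DualConnected ω F F' := by
  by_contra hno
  obtain ⟨R, hR0, hR⟩ : ∃ R : ℝ, 0 ≤ R ∧ inducedDrawing C ⊆ Metric.closedBall 0 R := by
    obtain ⟨R, hR⟩ := (isCompact_inducedDrawing hC).isBounded.subset_closedBall 0
    exact ⟨max R 0, le_max_right _ _,
      hR.trans (Metric.closedBall_subset_closedBall (le_max_left _ _))⟩
  have hfarclosed : IsClosed {z : ℂ | R + 1 ≤ ‖z‖} := isClosed_le continuous_const continuous_norm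
  -- `H` is 1 on the part of the graph inside `C`, and 0 on the part outside `C` and far away; it
  -- takes noninteger values on the drawing only along cut edges.
  obtain ⟨H, hH0, hH1, -⟩ := exists_continuous_zero_one_of_isClosed
    ((isClosed_inducedDrawing Cᶜ).union hfarclosed) (isClosed_inducedDrawing C) (by
      rw [Set.disjoint_union_left]
      refine ⟨(disjoint_inducedDrawing C).symm, Set.disjoint_left.2 fun z hz hz' => ?_⟩
      have h1 : ‖z‖ ≤ R := by simpa using hR hz'
      have h2 : R + 1 ≤ ‖z‖ := hz
      linarith)
  -- `S` consists of the faces dual-connected to the cut edges of `P`. Cut edges are closed, so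
  -- crossing one never leaves `S`, and no cut edge has faces of `S` and of its complement on its
  -- two sides.
  set S : Set L.Face := {F' | ∃ e ∈ P, IsCut C e ∧ ∃ F : L.Face,
    edgeSegment (e : Sym2 L.V) ⊆ frontier F.1 ∧ DualConnected ω F F'} with hS
  have hSclosed : ∀ {e : L.Edge} {F F' : L.Face}, IsCut C e →
      edgeSegment (e : Sym2 L.V) ⊆ frontier F.1 → edgeSegment (e : Sym2 L.V) ⊆ frontier F'.1 →
      F ∈ S → F' ∈ S := by
    rintro e F F' he hF hF' ⟨f, hf, hfC, F₀, hF₀, hc⟩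
    exact ⟨f, hf, hfC, F₀, hF₀, hc.tail ⟨e, hclosed e he, hF, hF'⟩⟩
  have hint : ∀ z ∈ region S ∩ region Sᶜ, ∃ k : ℤ, H z = k := by
    intro z hz
    by_cases hzd : z ∈ L.drawing
    · rw [drawing_eq, mem_iUnion] at hzd
      obtain ⟨e, hze⟩ := hzd
      rcases edge_trichotomy C e with hcut | hin | hout
      · obtain ⟨x, y, hxy, hx, hy⟩ := id hcut
        have hze' : z ∈ segment ℝ (x : ℂ) y := by rw [hxy] at hze; exact hze
        rw [← insert_endpoints_openSegment] at hze'
        rcases hze' with rfl | rfl | hzo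
        · exact ⟨1, by rw [hH1 (coe_mem_inducedDrawing hx)]; simp⟩
        · exact ⟨0, by rw [hH0 (Or.inl (coe_mem_inducedDrawing (s := Cᶜ) hy))]; simp⟩
        · obtain ⟨F, hF, heF⟩ := exists_face_of_mem_region hxy hzo hz.1
          obtain ⟨F', hF', heF'⟩ := exists_face_of_mem_region hxy hzo hz.2
          exact absurd (hSclosed hcut heF heF' hF) hF'
      · exact ⟨1, by rw [hH1 (edgeSegment_subset_inducedDrawing hin hze)]; simp⟩
      · exact ⟨0, by rw [hH0 (Or.inl (edgeSegment_subset_inducedDrawing hout hze))]; simp⟩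
    · exact (notMem_region_inter hzd hz).elim
  obtain ⟨G, hGc, hG1, hG2⟩ := exists_continuous_integer_gluing (X₁ := region S)
    (X₂ := region Sᶜ) isClosed_closure isClosed_closure (region_union_region_compl S)
    H.continuous hint
  have hmem : ∀ z, z ∈ region S ∨ z ∈ region Sᶜ := fun z =>
    eq_univ_iff_forall.1 (region_union_region_compl S) z
  have hGint : ∀ z, (∃ k : ℤ, H z = k) → ∃ k : ℤ, G z = k := by
    rintro z ⟨k, hk⟩
    rcases hmem z with hz | hz
    · obtain ⟨l, hl⟩ := hG1 z hz
      exact ⟨l + k, by push_cast; rw [← hl, ← hk]; ring⟩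
    · exact hG2 z hz
  have hends : ∀ {e : L.Edge} {x y : L.V}, (e : Sym2 L.V) = s(x, y) →
      (x : ℂ) ∈ edgeSegment (e : Sym2 L.V) ∧ (y : ℂ) ∈ edgeSegment (e : Sym2 L.V) := fun hxy =>
    ⟨coe_mem_edgeSegment (hxy ▸ Sym2.mem_mk_left _ _),
      coe_mem_edgeSegment (hxy ▸ Sym2.mem_mk_right _ _)⟩
  have hnoncut : ∀ {e : L.Edge} {x y : L.V}, (e : Sym2 L.V) = s(x, y) → ¬IsCut C e →
      G x = G y ∧ H x = H y := by
    intro e x y hxy he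
    have hconst : ∃ k : ℤ, ∀ z ∈ edgeSegment (e : Sym2 L.V), H z = k := by
      rcases edge_trichotomy C e with hcut | hin | hout
      · exact absurd hcut he
      · exact ⟨1, fun z hz => by rw [hH1 (edgeSegment_subset_inducedDrawing hin hz)]; simp⟩
      · exact ⟨0, fun z hz => by
          rw [hH0 (Or.inl (edgeSegment_subset_inducedDrawing hout hz))]; simp⟩
    obtain ⟨k, hk⟩ := hconst
    obtain ⟨hx, hy⟩ := hends hxy
    exact ⟨(isPreconnected_edgeSegment e).eq_of_integer_valued hGc.continuousOn
      (fun z hz => hGint z ⟨k, hk z hz⟩) hx hy, (hk _ hx).trans (hk _ hy).symm⟩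
  -- Cut edges of `P` lie in the region of `S`, where `G - H` is an integer; along other edges both
  -- functions are constant.
  have hPstep : ∀ e ∈ P, ∀ x y, (e : Sym2 L.V) = s(x, y) → G x - H x = G y - H y := by
    intro e he x y hxy
    by_cases hcut : IsCut C e
    · obtain ⟨F, hF⟩ := exists_adjacent_face e
      have hFS : F ∈ S := ⟨e, he, hcut, F, hF, Relation.ReflTransGen.refl⟩
      obtain ⟨hx, hy⟩ := hends hxy
      exact (isPreconnected_edgeSegment e).eq_of_integer_valued (f := fun z => G z - H z)
        (hGc.sub H.continuous).continuousOn
        (fun z hz => hG1 z (edgeSegment_subset_region hFS hF hz)) hx hy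
    · rw [(hnoncut hxy hcut).1, (hnoncut hxy hcut).2]
  -- By the assumed absence of dual connections, cut edges of `Q` lie in the complementary region,
  -- where `G` itself is an integer.
  have hQstep : ∀ e ∈ Q, ∀ x y, (e : Sym2 L.V) = s(x, y) → G x = G y := by
    intro e he x y hxy
    by_cases hcut : IsCut C e
    · have hsub : edgeSegment (e : Sym2 L.V) ⊆ region Sᶜ := by
        have hs : edgeSegment (e : Sym2 L.V) = closure (openSegment ℝ (x : ℂ) y) := by
          rw [closure_openSegment, hxy]; rfl
        rw [hs]
        refine closure_minimal (fun z hz => ?_) isClosed_closure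
        refine (hmem z).resolve_left fun hzS => ?_
        obtain ⟨F, ⟨f, hf, hfC, F₀, hF₀, hc⟩, heF⟩ := exists_face_of_mem_region hxy hz hzS
        exact hno ⟨f, hf, e, he, hfC, hcut, F₀, F, hF₀, heF, hc⟩
      obtain ⟨hx, hy⟩ := hends hxy
      exact (isPreconnected_edgeSegment e).eq_of_integer_valued hGc.continuousOn
        (fun z hz => hG2 z (hsub hz)) hx hy
    · exact (hnoncut hxy hcut).1
  obtain ⟨y, hy, hyr⟩ := hP (R + 1)
  obtain ⟨y', hy', hyr'⟩ := hQ (R + 1)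
  have hHfar : ∀ z : ℂ, R + 1 < ‖z‖ → H z = 0 := fun z hz => hH0 (Or.inr hz.le)
  -- Far away `H = 0`, so `G` is an integer and hence constant there. Following `P` gives `G o - 1 =
  -- G y`, while following `Q` gives `G o = G y'`: a contradiction.
  have hfar : G y = G y' :=
    (isPreconnected_setOf_lt_norm (by linarith : (0 : ℝ) ≤ R + 1)).eq_of_integer_valued
      hGc.continuousOn (fun z hz => hGint z ⟨0, by rw [hHfar z hz]; simp⟩) hy hy'
  have h1 := reachable_induction (f := fun x : L.V => G x - H x) hPstep hyr
  have h2 := reachable_induction (f := fun x : L.V => G x) hQstep hyr'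
  have h3 : H o = 1 := hH1 (coe_mem_inducedDrawing ho)
  have h4 := hHfar y hy
  rw [h3, h4] at h1
  linarith

end PlanarLattice

/-! ### Infinite clusters from exponential decay of dual connections -/

namespace PlanarLattice

variable {L : PlanarLattice}

theorem DualConnected.mono {ω ω' : L.Config} (h : ω ≤ ω') {F F' : L.Face}
    (hc : DualConnected ω' F F') : DualConnected ω F F' := by
  refine Relation.ReflTransGen.mono ?_ F F' hc
  rintro a b ⟨e, he, hj⟩
  refine ⟨e, ?_, hj⟩
  have := h e
  rw [he] at this
  revert this
  cases ω e <;> simp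

theorem le_openAll (F : Finset L.Edge) (ω : L.Config) : ω ≤ openAll F ω := by
  intro e
  by_cases he : e ∈ F
  · rw [openAll_apply_mem he]; exact le_top
  · rw [openAll_apply_notMem he]

/-- A choice of a face next to each edge. -/
noncomputable def adjacentFace (e : L.Edge) : L.Face := (exists_adjacent_face e).choose

theorem edgeSegment_subset_frontier_adjacentFace (e : L.Edge) :
    edgeSegment (e : Sym2 L.V) ⊆ frontier (adjacentFace e).1 := (exists_adjacent_face e).choose_spec

/-- The translates of a finite set of edges by the multiples `k • u` with `k` in `s`. -/
def translates {u : ℂ} (hu : L.IsPeriod u) (W : Finset L.Edge) (s : Set ℤ) : Set L.Edge :=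
  {f | ∃ k ∈ s, ∃ e ∈ W, f = (hu.zsmul k).iso.mapEdgeSet e}

theorem finite_translates {u : ℂ} (hu : L.IsPeriod u) (W : Finset L.Edge) {s : Set ℤ}
    (hs : s.Finite) : (translates hu W s).Finite := by
  refine (Set.Finite.image2 (fun k e => (hu.zsmul k).iso.mapEdgeSet e) hs W.finite_toSet).subset ?_
  rintro f ⟨k, hk, e, he, rfl⟩
  exact ⟨k, hk, e, he, rfl⟩

theorem reachable_translates {u : ℂ} (hu : L.IsPeriod u) {W : Finset L.Edge}
    (hW : (L.subgraphOf (W : Set L.Edge)).Reachable L.origin (hu.iso L.origin)) {s : Set ℤ} (k : ℤ)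
    (hk : k ∈ s) : (L.subgraphOf (translates hu W s)).Reachable ((hu.zsmul k).iso L.origin)
      ((hu.zsmul (k + 1)).iso L.origin) := by
  have h := subgraphOf_reachable_image (hu.zsmul k).iso hW
  have he : (hu.zsmul k).iso (hu.iso L.origin) = (hu.zsmul (k + 1)).iso L.origin := by
    apply Subtype.ext
    simp only [IsPeriod.coe_iso, add_smul, one_smul]
    ring
  rw [he] at h
  refine h.mono (subgraphOf_mono ?_)
  rintro _ ⟨e, hes, rfl⟩
  exact ⟨k, hk, e, hes, rfl⟩

theorem zero_zsmul_iso_origin {u : ℂ} (hu : L.IsPeriod u) :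
    (hu.zsmul 0).iso L.origin = L.origin := by
  apply Subtype.ext
  rw [IsPeriod.coe_iso, zero_smul, add_zero]

theorem reachable_translates_nonneg {u : ℂ} (hu : L.IsPeriod u) {W : Finset L.Edge}
    (hW : (L.subgraphOf (W : Set L.Edge)).Reachable L.origin (hu.iso L.origin)) (n : ℕ) :
    (L.subgraphOf (translates hu W (Ici 0))).Reachable L.origin ((hu.zsmul n).iso L.origin) := by
  induction n with
  | zero =>
    rw [Nat.cast_zero, zero_zsmul_iso_origin hu]
  | succ n ih =>
    have h := reachable_translates hu hW (s := Ici 0) n (by simp)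
    rw [Nat.cast_succ]
    exact ih.trans h

theorem reachable_translates_neg {u : ℂ} (hu : L.IsPeriod u) {W : Finset L.Edge}
    (hW : (L.subgraphOf (W : Set L.Edge)).Reachable L.origin (hu.iso L.origin)) (n : ℕ) :
    (L.subgraphOf (translates hu W (Iio 0))).Reachable L.origin
      ((hu.zsmul (-n)).iso L.origin) := by
  induction n with
  | zero =>
    rw [Nat.cast_zero, neg_zero, zero_zsmul_iso_origin hu]
  | succ n ih =>
    have h := reachable_translates hu hW (s := Iio 0) (-(n + 1 : ℤ))
      (by rw [mem_Iio]; omega)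
    rw [show -(n + 1 : ℤ) + 1 = -n by ring] at h
    rw [Nat.cast_succ]
    exact ih.trans h.symm

/-- If the cluster of a vertex is finite, although many edges near it have been opened, then there
are dual connections between two distant edges on the two sides. -/
theorem exists_dualConnected_adjacentFace {u w : ℂ} (hu : L.IsPeriod u) (hu0 : u ≠ 0)
    (hw : L.IsPeriod w) {W : Finset L.Edge}
    (hW : (L.subgraphOf (W : Set L.Edge)).Reachable L.origin (hu.iso L.origin)) {N : ℕ}
    {E : Finset L.Edge} (hE : (E : Set L.Edge) = translates hu W (Ico (-N : ℤ) N)) {ω : L.Config}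
    (hfin : ¬ConnectedToInfinity (openAll (shift hw.iso E) ω) (hw.iso L.origin)) :
    ∃ i j : ℕ, ∃ e ∈ W, ∃ f ∈ W, DualConnected ω
      (adjacentFace (hw.iso.mapEdgeSet ((hu.zsmul ((N + i : ℕ) : ℤ)).iso.mapEdgeSet e)))
      (adjacentFace (hw.iso.mapEdgeSet
        ((hu.zsmul (-((N + 1 + j : ℕ) : ℤ))).iso.mapEdgeSet f))) := by
  set ω' := openAll (shift hw.iso E) ω with hω'
  set C : Set L.V := {y | (L.subgraphOf {e | ω' e = true}).Reachable (hw.iso L.origin) y} with hC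
  have hCfin : C.Finite := Set.not_infinite.1 hfin
  have hclosed : ∀ e, IsCut C e → ω' e = false := by
    rintro e ⟨x, y, hxy, hx, hy⟩
    by_contra ho
    have ho' : ω' e = true := by simpa using ho
    exact hy (SimpleGraph.Reachable.trans hx
      (subgraphOf_adj.2 ⟨e, ho', hxy⟩ : (L.subgraphOf {e | ω' e = true}).Adj x y).reachable)
  have hu0' : 0 < ‖u‖ := norm_pos_iff.2 hu0
  have hfar : ∀ r : ℝ, ∃ n : ℕ, ∀ k : ℤ, (n : ℤ) ≤ |k| →
      r < ‖((hw.iso ((hu.zsmul k).iso L.origin) : L.V) : ℂ)‖ := by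
    intro r
    obtain ⟨n, hn⟩ := exists_nat_gt ((r + ‖w‖) / ‖u‖)
    refine ⟨n, fun k hk => ?_⟩
    rw [div_lt_iff₀ hu0'] at hn
    have h1 : ((hw.iso ((hu.zsmul k).iso L.origin) : L.V) : ℂ) = k • u + w := by
      rw [IsPeriod.coe_iso, IsPeriod.coe_iso]
      change (0 : ℂ) + _ + _ = _
      rw [zero_add]
    have h2 : ‖k • u‖ = |(k : ℝ)| * ‖u‖ := by
      rw [← Int.cast_smul_eq_zsmul ℝ, norm_smul, Real.norm_eq_abs]
    have h3 : (n : ℝ) ≤ |(k : ℝ)| := by exact_mod_cast hk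
    have h4 := norm_sub_le (k • u + w) w
    rw [add_sub_cancel_right] at h4
    have h5 := mul_le_mul_of_nonneg_right h3 hu0'.le
    rw [h1]
    linarith
  obtain ⟨e, heP, f, hfQ, heC, hfC, F, F', heF, hfF', hFF'⟩ :=
    exists_dualConnected_of_finite (ω := ω') hCfin (o := hw.iso L.origin)
      (SimpleGraph.Reachable.refl _) hclosed
      (P := hw.iso.mapEdgeSet '' translates hu W (Ici 0))
      (Q := hw.iso.mapEdgeSet '' translates hu W (Iio 0))
      (fun r => by
        obtain ⟨n, hn⟩ := hfar r
        exact ⟨_, hn n (by simp),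
          subgraphOf_reachable_image hw.iso (reachable_translates_nonneg hu hW n)⟩)
      (fun r => by
        obtain ⟨n, hn⟩ := hfar r
        exact ⟨_, hn (-n) (by simp),
          subgraphOf_reachable_image hw.iso (reachable_translates_neg hu hW n)⟩)
  have hle : ω ≤ ω' := le_openAll _ ω
  have hωc : ∀ e, ω' e = false → ω e = false := by
    intro e he
    have := hle e
    rw [he] at this
    revert this
    cases ω e <;> simp
  have hnot : ∀ e, ω' (hw.iso.mapEdgeSet e) = false → e ∉ translates hu W (Ico (-N : ℤ) N) := by
    intro e he hmem
    rw [← hE] at hmem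
    rw [hω', openAll_apply_mem (mapEdgeSet_mem_shift.2 hmem)] at he
    exact absurd he (by simp)
  -- The closed edges `e` and `f` themselves allow the move to the chosen face on either side, so
  -- one face per edge suffices in the union bound.
  have hdual : DualConnected ω (adjacentFace e) (adjacentFace f) := by
    refine Relation.ReflTransGen.trans (Relation.ReflTransGen.single
      ⟨e, hωc e (hclosed e heC), edgeSegment_subset_frontier_adjacentFace e, heF⟩) ?_
    exact Relation.ReflTransGen.trans (hFF'.mono hle) (Relation.ReflTransGen.single
      ⟨f, hωc f (hclosed f hfC), hfF', edgeSegment_subset_frontier_adjacentFace f⟩)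
  obtain ⟨_, ⟨k, hk, e₀, he₀, rfl⟩, rfl⟩ := heP
  obtain ⟨_, ⟨l, hl, f₀, hf₀, rfl⟩, rfl⟩ := hfQ
  -- The opened stretch has indices in `[-N, N)`, so cut edges have index at least `N` on one side
  -- and at most `-(N + 1)` on the other.
  have hkN : (N : ℤ) ≤ k := by
    by_contra hlt
    refine hnot _ (hclosed _ heC) ⟨k, ⟨?_, not_le.1 hlt⟩, e₀, he₀, rfl⟩
    have : (0 : ℤ) ≤ k := hk
    omega
  have hlN : l < -(N : ℤ) := by
    by_contra hlt
    refine hnot _ (hclosed _ hfC) ⟨l, ⟨not_lt.1 hlt, ?_⟩, f₀, hf₀, rfl⟩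
    have : l < (0 : ℤ) := hl
    omega
  obtain ⟨i, hi⟩ := Int.le.dest hkN
  obtain ⟨j, hj⟩ := Int.le.dest (show (N : ℤ) + 1 ≤ -l by omega)
  refine ⟨i, j, e₀, he₀, f₀, hf₀, ?_⟩
  have h1 : ((N + i : ℕ) : ℤ) = k := by push_cast; exact hi
  have h2 : -((N + 1 + j : ℕ) : ℤ) = l := by push_cast; omega
  rw [h1, h2]
  exact hdual

/-- A dual vertex stays within the face diameter of the adjacent edge, and edges of `W` stay near
the origin. Thus `B` depends neither on the translation `w` nor on the indices. -/
theorem exists_dist_pos_adjacentFace_ge (D : L.DualPlacement) {u : ℂ} (hu : L.IsPeriod u)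
    (W : Finset L.Edge) : ∃ B : ℝ, ∀ (w : ℂ) (hw : L.IsPeriod w), ∀ e ∈ W, ∀ f ∈ W, ∀ N i j : ℕ,
      ‖u‖ * (2 * N + i + j) - B ≤ dist
        (D.pos (adjacentFace (hw.iso.mapEdgeSet ((hu.zsmul ((N + i : ℕ) : ℤ)).iso.mapEdgeSet e))))
        (D.pos (adjacentFace (hw.iso.mapEdgeSet
          ((hu.zsmul (-((N + 1 + j : ℕ) : ℤ))).iso.mapEdgeSet f)))) := by
  obtain ⟨R, hR⟩ := L.exists_face_dist_le
  obtain ⟨B, hB⟩ : ∃ B : ℝ, ∀ e ∈ W, ∀ z ∈ edgeSegment (e : Sym2 L.V), ‖z‖ ≤ B := by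
    have := (W.finite_toSet.isCompact_biUnion fun e _ => isCompact_edgeSegment e).isBounded
    obtain ⟨B, hB⟩ := this.exists_norm_le
    exact ⟨B, fun e he z hz =>
      hB z (mem_biUnion (t := fun e : L.Edge => edgeSegment (e : Sym2 L.V)) he hz)⟩
  refine ⟨2 * (R + B), fun w hw e he f hf N i j => ?_⟩
  have key : ∀ e ∈ W, ∀ k : ℤ, dist (D.pos (adjacentFace (hw.iso.mapEdgeSet
      ((hu.zsmul k).iso.mapEdgeSet e)))) (w + k • u) ≤ R + B := by
    intro e he k
    set g := hw.iso.mapEdgeSet ((hu.zsmul k).iso.mapEdgeSet e) with hg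
    obtain ⟨x, y, -, z, hz⟩ : ∃ x y : L.V, (e : Sym2 L.V) = s(x, y) ∧
        ∃ z, z ∈ edgeSegment (e : Sym2 L.V) := by
      obtain ⟨x, y, hxy, -⟩ := exists_endpoints e
      exact ⟨x, y, hxy, x, coe_mem_edgeSegment (hxy ▸ Sym2.mem_mk_left _ _)⟩
    have hz' : z + k • u + w ∈ edgeSegment (g : Sym2 L.V) := by
      rw [hg, hw.edgeSegment, (hu.zsmul k).edgeSegment]
      exact ⟨_, ⟨z, hz, rfl⟩, rfl⟩
    have h1 := hR (adjacentFace g) _ (subset_closure (D.pos_mem _)) _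
      (frontier_subset_closure (edgeSegment_subset_frontier_adjacentFace g hz'))
    have h2 : dist (z + k • u + w) (w + k • u) ≤ B := by
      rw [dist_eq_norm, show z + k • u + w - (w + k • u) = z by ring]
      exact hB e he z hz
    exact (dist_triangle _ _ _).trans (add_le_add h1 h2)
  have h1 := key e he ((N + i : ℕ) : ℤ)
  have h2 := key f hf (-((N + 1 + j : ℕ) : ℤ))
  have h3 : dist (w + ((N + i : ℕ) : ℤ) • u) (w + (-((N + 1 + j : ℕ) : ℤ)) • u) =
      (2 * N + 1 + i + j) * ‖u‖ := by
    rw [dist_add_left, dist_eq_norm, ← sub_smul, ← Int.cast_smul_eq_zsmul ℝ, norm_smul,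
      Real.norm_eq_abs]
    push_cast
    rw [show (N : ℝ) + i - -(N + 1 + j) = 2 * N + 1 + i + j by ring, abs_of_nonneg (by positivity)]
  have h4 := dist_triangle4 (w + ((N + i : ℕ) : ℤ) • u)
    (D.pos (adjacentFace (hw.iso.mapEdgeSet ((hu.zsmul ((N + i : ℕ) : ℤ)).iso.mapEdgeSet e))))
    (D.pos (adjacentFace (hw.iso.mapEdgeSet
      ((hu.zsmul (-((N + 1 + j : ℕ) : ℤ))).iso.mapEdgeSet f))))
    (w + (-((N + 1 + j : ℕ) : ℤ)) • u)
  rw [h3, dist_comm] at h4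
  have h5 := norm_nonneg u
  nlinarith

/-- Under exponential decay of the dual connections, opening enough edges around a vertex makes its
cluster infinite with probability at least `1 / 2`, uniformly over the translates of the origin. -/
theorem exists_measure_finite_cluster_le (D : L.DualPlacement) {φ : Measure L.Config}
    [IsProbabilityMeasure φ] {c : ℝ} (hc : 0 < c) (hdecay : ∀ F F' : L.Face,
      φ.real {ω | DualConnected ω F F'} ≤ Real.exp (-c * dist (D.pos F) (D.pos F'))) {u : ℂ}
    (hu : L.IsPeriod u) (hu0 : u ≠ 0) : ∃ E : Finset L.Edge, ∀ (w : ℂ) (hw : L.IsPeriod w),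
      φ {ω | ¬ConnectedToInfinity (openAll (shift hw.iso E) ω) (hw.iso L.origin)} ≤ 1 / 2 := by
  obtain ⟨W, hW⟩ : ∃ W : Finset L.Edge,
      (L.subgraphOf (W : Set L.Edge)).Reachable L.origin (hu.iso L.origin) := by
    have h : (L.subgraphOf univ).Reachable L.origin (hu.iso L.origin) := by
      refine (L.connected.preconnected _ _).mono fun x y hxy => ?_
      exact subgraphOf_adj.2 ⟨⟨s(x, y), hxy⟩, mem_univ _, rfl⟩
    obtain ⟨W, -, hW⟩ := exists_finset_of_reachable h
    exact ⟨W, hW⟩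
  obtain ⟨B, hB⟩ := exists_dist_pos_adjacentFace_ge D hu W
  set ρ : ℝ := Real.exp (-c * ‖u‖) with hρ
  have hρ0 : 0 ≤ ρ := (Real.exp_pos _).le
  have hρ1 : ρ < 1 := by
    rw [hρ, Real.exp_lt_one_iff]
    have := norm_pos_iff.2 hu0
    nlinarith
  set r : ENNReal := ENNReal.ofReal ρ with hr
  have hr1 : r < 1 := by
    rw [hr, ← ENNReal.ofReal_one]
    exact (ENNReal.ofReal_lt_ofReal_iff one_pos).2 hρ1
  set K : ENNReal := W.card * (W.card * ENNReal.ofReal (Real.exp (c * B))) with hK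
  have hKtop : K ≠ ⊤ := by
    rw [hK]
    exact ENNReal.mul_ne_top (by simp) (ENNReal.mul_ne_top (by simp) ENNReal.ofReal_ne_top)
  have hgeom : (1 - r)⁻¹ ≠ ⊤ := by
    rw [ENNReal.inv_ne_top]
    exact (tsub_pos_of_lt hr1).ne'
  have hlim : Tendsto (fun N : ℕ => K * (1 - r)⁻¹ * (1 - r)⁻¹ * (r ^ 2) ^ N) atTop (𝓝 0) := by
    have h2 : r ^ 2 < 1 := pow_lt_one₀ zero_le hr1 two_ne_zero
    have := ENNReal.Tendsto.const_mul (a := K * (1 - r)⁻¹ * (1 - r)⁻¹)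
      (ENNReal.tendsto_pow_atTop_nhds_zero_of_lt_one h2)
      (Or.inr (ENNReal.mul_ne_top (ENNReal.mul_ne_top hKtop hgeom) hgeom))
    rwa [mul_zero] at this
  -- The quantity made small is the union bound over `i`, `j` and pairs of edges of `W`: two
  -- geometric series times `ρ ^ (2 N)`. It does not involve `w`.
  obtain ⟨N, hN⟩ := (hlim.eventually_le_const (show (0 : ENNReal) < 1 / 2 by simp)).exists
  have hfin := finite_translates hu W (Set.finite_Ico (-N : ℤ) N)
  refine ⟨hfin.toFinset, fun w hw => ?_⟩
  set A : ℕ → ℕ → L.Edge → L.Edge → Set L.Config := fun i j e f => {ω | DualConnected ω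
      (adjacentFace (hw.iso.mapEdgeSet ((hu.zsmul ((N + i : ℕ) : ℤ)).iso.mapEdgeSet e)))
      (adjacentFace (hw.iso.mapEdgeSet
        ((hu.zsmul (-((N + 1 + j : ℕ) : ℤ))).iso.mapEdgeSet f)))} with hA
  have hsub : {ω | ¬ConnectedToInfinity (openAll (shift hw.iso hfin.toFinset) ω)
      (hw.iso L.origin)} ⊆ ⋃ i, ⋃ j, ⋃ e ∈ W, ⋃ f ∈ W, A i j e f := by
    intro ω hω
    obtain ⟨i, j, e, he, f, hf, h⟩ := exists_dualConnected_adjacentFace hu hu0 hw hW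
      hfin.coe_toFinset hω
    simp only [mem_iUnion]
    exact ⟨i, j, e, he, f, hf, h⟩
  have hone : ∀ i j, ∀ e ∈ W, ∀ f ∈ W,
      φ (A i j e f) ≤ ENNReal.ofReal (Real.exp (c * B)) * ((r ^ 2) ^ N * r ^ i * r ^ j) := by
    intro i j e he f hf
    have hrpow : (r ^ 2) ^ N * r ^ i * r ^ j = ENNReal.ofReal (ρ ^ (2 * N + i + j)) := by
      rw [ENNReal.ofReal_pow hρ0, ← hr, ← pow_mul, ← pow_add, ← pow_add]
    rw [hrpow, ← ENNReal.ofReal_mul (Real.exp_pos _).le, ← ofReal_measureReal (μ := φ)]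
    refine ENNReal.ofReal_le_ofReal ((hdecay _ _).trans ?_)
    rw [hρ, ← Real.exp_nat_mul, ← Real.exp_add, Real.exp_le_exp]
    have := mul_le_mul_of_nonneg_left (hB w hw e he f hf N i j) hc.le
    push_cast
    linarith
  have htwo : ∀ i j, φ (⋃ e ∈ W, ⋃ f ∈ W, A i j e f) ≤ K * (r ^ 2) ^ N * r ^ i * r ^ j := by
    intro i j
    calc φ (⋃ e ∈ W, ⋃ f ∈ W, A i j e f) ≤ ∑ e ∈ W, φ (⋃ f ∈ W, A i j e f) :=
          measure_biUnion_finset_le _ _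
      _ ≤ ∑ e ∈ W, ∑ f ∈ W, φ (A i j e f) :=
          Finset.sum_le_sum fun e _ => measure_biUnion_finset_le _ _
      _ ≤ ∑ e ∈ W, ∑ f ∈ W,
          ENNReal.ofReal (Real.exp (c * B)) * ((r ^ 2) ^ N * r ^ i * r ^ j) :=
          Finset.sum_le_sum fun e he => Finset.sum_le_sum fun f hf => hone i j e he f hf
      _ = _ := by
          simp only [Finset.sum_const, nsmul_eq_mul, hK]
          ring
  calc φ _ ≤ φ (⋃ i, ⋃ j, ⋃ e ∈ W, ⋃ f ∈ W, A i j e f) := measure_mono hsub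
    _ ≤ ∑' i, φ (⋃ j, ⋃ e ∈ W, ⋃ f ∈ W, A i j e f) := measure_iUnion_le _
    _ ≤ ∑' i, ∑' j, φ (⋃ e ∈ W, ⋃ f ∈ W, A i j e f) :=
        ENNReal.tsum_le_tsum fun i => measure_iUnion_le _
    _ ≤ ∑' i, ∑' j, K * (r ^ 2) ^ N * r ^ i * r ^ j :=
        ENNReal.tsum_le_tsum fun i => ENNReal.tsum_le_tsum fun j => htwo i j
    _ = K * (1 - r)⁻¹ * (1 - r)⁻¹ * (r ^ 2) ^ N := by
        simp only [ENNReal.tsum_mul_left, ENNReal.tsum_mul_right, ENNReal.tsum_geometric]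
        ring
    _ ≤ 1 / 2 := hN

/-- Under exponential decay of the dual connections, all translates of the origin are in an infinite
cluster with probability bounded below. -/
theorem exists_pos_le_connectedToInfinity {p q : ℝ} (hp : p ∈ Ioo (0 : ℝ) 1) (hq : 1 ≤ q)
    (D : L.DualPlacement) {φ : Measure L.Config} (hφ : IsRandomClusterMeasure p q φ) {c : ℝ}
    (hc : 0 < c) (hdecay : ∀ F F' : L.Face,
      φ.real {ω | DualConnected ω F F'} ≤ Real.exp (-c * dist (D.pos F) (D.pos F'))) :
    ∃ δ : ℝ, 0 < δ ∧ ∀ (w : ℂ) (hw : L.IsPeriod w),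
      δ ≤ φ.real {ω | ConnectedToInfinity ω (hw.iso L.origin)} := by
  have := hφ.isProbabilityMeasure
  obtain ⟨u, v, h, hu, -⟩ := L.exists_isPeriod
  obtain ⟨E, hE⟩ := exists_measure_finite_cluster_le D hc hdecay hu (h.ne_zero 0)
  have hcost := openingCost_pos hp hq E.card
  -- After opening, the cluster is infinite with probability at least 1/2; finite energy divides
  -- this by the cost, which depends only on the number of opened edges and hence not on `w`.
  refine ⟨1 / 2 / openingCost p q E.card, by positivity, fun w hw => ?_⟩
  set A : Set L.Config := {ω | ConnectedToInfinity ω (hw.iso L.origin)} with hA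
  have hsmall : φ.real (openAll (shift hw.iso E) ⁻¹' A)ᶜ ≤ 1 / 2 := by
    have := ENNReal.toReal_mono (by simp) (hE w hw)
    have h2 : (1 / 2 : ENNReal).toReal = 1 / 2 := by simp
    rw [h2] at this
    exact this
  have hmeas : MeasurableSet (openAll (shift hw.iso E) ⁻¹' A) :=
    (continuous_openAll _).measurable (measurableSet_connectedToInfinity _)
  rw [probReal_compl_eq_one_sub hmeas] at hsmall
  have hfe := hφ.preimage_openAll_le hp hq (shift hw.iso E) A
  rw [show (shift hw.iso E).card = E.card from Finset.card_map _] at hfe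
  have hfe' := ENNReal.toReal_mono
    (ENNReal.mul_ne_top ENNReal.ofReal_ne_top (measure_ne_top _ _)) hfe
  rw [ENNReal.toReal_mul, ENNReal.toReal_ofReal hcost.le] at hfe'
  change φ.real (openAll (shift hw.iso E) ⁻¹' A) ≤ _ * φ.real A at hfe'
  rw [div_le_iff₀ hcost]
  linarith

end PlanarLattice

theorem proposition5p3 (L : PlanarLattice) (D : L.DualPlacement) (q : ℝ) (hq : 1 ≤ q)
    (p : ℝ) (hp : p ∈ Set.Ioo (0 : ℝ) 1)
    (φ : MeasureTheory.Measure L.Config) (hφ : PlanarLattice.IsRandomClusterMeasure p q φ)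
    (hdecay : ∃ c : ℝ, 0 < c ∧ ∀ u v : L.Face,
      φ.real {ω | PlanarLattice.DualConnected ω u v} ≤ Real.exp (-c * dist (D.pos u) (D.pos v))) :
    0 < φ {ω | PlanarLattice.ConnectedToInfinity ω L.origin} ∧ L.criticalPoint q ≤ p := by
  have := hφ.isProbabilityMeasure
  obtain ⟨c, hc, hdecay⟩ := hdecay
  obtain ⟨δ, hδ, hδφ⟩ := PlanarLattice.exists_pos_le_connectedToInfinity hp hq D hφ hc hdecay
  obtain ⟨u, v, h, hu, hv⟩ := L.exists_isPeriod
  refine ⟨?_, PlanarLattice.criticalPoint_le_of_connectedToInfinity hp hq hφ h hu hv hδ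
    fun m n => hδφ _ _⟩
  have h0 := hδφ 0 PlanarLattice.IsPeriod.zero
  have horigin : (PlanarLattice.IsPeriod.zero (L := L)).iso L.origin = L.origin :=
    Subtype.ext (by rw [PlanarLattice.IsPeriod.coe_iso, add_zero])
  rw [horigin] at h0
  exact (ENNReal.toReal_pos_iff.1 (hδ.trans_le h0)).1
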